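/- Let $d\ge 2$ and $k\ge 1$ be integers with $k<2d$, and let $0<\epsilon\le 1$. Notation. $\Sigma_d$ is the space of sequences $\alpha=\alpha_1\alpha_2\dots$ in $\{1,\dots,d\}$ with the product topology; $\Sigma_d^{dual}$ is a second copy of it, with points $j=j_1j_2\dots$. $Simp_{2d-2}$ is the set of points of $(0,1)^{2d-1}$ with coordinate sum $1$; a point of it encodes the partition of $[0,1]$ into $d$ intervals, whose lengths are the first $d$ coordinates, separated by $d-1$ gaps, whose lengths are the last $d-1$ coordinates. An embedding $h:\Sigma_d\to\mathbb R$ is a topological embedding that is increasing for the lexicographic order and whose image has convex hull $[0,1]$. It is $C^{k+\epsilon}$ if for each $i$ the map $h(\alpha)\mapsto h(i\alpha)$ extends to a contraction $\mathbb R\to\mathbb R$ (Lipschitz constant $<1$) with everywhere positive derivative that is $C^k$ with $\epsilon$-Hölder $k$-th derivative (Lipschitz if $\epsilon=1$). Put $I_{j_1\dots j_n}=h(\{\alpha:\alpha_1=j_n,\dots,\alpha_n=j_1\})$ and let $S(j_1\dots j_n)\in Simp_{2d-2}$ record the lengths of the convex hulls of $I_{1j_1\dots j_n},\dots,I_{dj_1\dots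 j_n}$ and of the $d-1$ gaps between them, divided by the length of the convex hull of $I_{j_1\dots j_n}$. A function $S:\Sigma_d^{dual}\to Simp_{2d-2}$ is the scaling function of $h$ if $S(j)=\lim_{n\to\infty}S(j_1\dots j_n)$ for every $j\in\Sigma_d^{dual}$. For $S:\Sigma_d^{dual}\to Simp_{2d-2}$ and distinct $j,j'$ with longest common beginning $j_1\dots j_n$ put $$\rho_S(j,j')=\sup_{w\in\Sigma_d^{dual}}\ \prod_{t=1}^{n}S(j_{t+1}\dots j_nw)_{j_t}$$ (an empty product is $1$), and put $\rho_S(j,j)=0$. Let $A(j)\subset[0,1]$ be the set of the $2d$ end points of the $d$ intervals of the partition encoded by $S(j)$. For $A_1,A_2\subset[0,1]$ and $M\in\mathbb R$ let $D^k_{var}(M)(A_1,A_2)$ be the set of orientation preserving $C^k$ diffeomorphisms $\phi$ of $[0,1]$ with $\phi(A_1)=A_2$ and $\sup_{x,y\in[0,1]}|D^k\phi(x)-D^k\phi(y)|<M$. For $j_0\in\{1,\dots,d\}$ and such a map $\phi$ with $\phi(A(j))=A(j')$ let $R_{j_0}\phi:[0,1]\to[0,1]$ be the restriction of $\phi$ to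 the $j_0$-th interval of $S(j)$, which $\phi$ maps onto the $j_0$-th interval of $S(j')$, with both intervals rescaled affinely to $[0,1]$. Theorem. Let $S:\Sigma_d^{dual}\to Simp_{2d-2}$ be any function. The following are equivalent. 1. There exists a $C^{k+\epsilon}$ embedding of $\Sigma_d$ with scaling function $S$. 2. There exists a constant $C$ such that for all distinct $j,j'\in\Sigma_d^{dual}$ and all $j_0=1,\dots,d$ $$D^k_{var}\big(C\rho_S(j_0j,j_0j')^{k+\epsilon-1}\big)\big(A(j_0j),A(j_0j')\big)\ \cap\ R_{j_0}\Big(D^k_{var}\big(C\rho_S(j,j')^{k+\epsilon-1}\big)\big(A(j),A(j')\big)\Big)\neq\emptyset .$$ -/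

import Mathlib

open Set Filter Topology

noncomputable section

namespace CantorScaling

/-- Infinite sequences of symbols from an alphabet with `d` letters. Both the Cantor set `Σ_d`
and its dual `Σ_d^dual` have such sequences as their points. -/
abbrev Word (d : ℕ) : Type := ℕ → Fin d

/-- The sequence `i α₁ α₂ …`. -/
def prepend {d : ℕ} (i : Fin d) (α : Word d) : Word d
  | 0 => i
  | n + 1 => α n

/-! ### The simplex of ratio geometries -/

/-- Coordinates of a ratio geometry: `d` intervals (`Sum.inl`) and the `d - 1` gaps between
consecutive intervals (`Sum.inr`; gap `g` lies between the intervals `g` and `g + 1`). -/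
abbrev Coord (d : ℕ) : Type := Fin d ⊕ Fin (d - 1)

/-- `Simp_{2d-2}`: the points of `(0,1)^(2d-1)` whose coordinates sum up to one. -/
def simp (d : ℕ) : Set (Coord d → ℝ) :=
  {s | (∀ c, s c ∈ Ioo (0 : ℝ) 1) ∧ ∑ c, s c = 1}

/-- Left end point of the `i`-th interval in the partition of `[0,1]` encoded by `s`. -/
def leftEnd {d : ℕ} (s : Coord d → ℝ) (i : Fin d) : ℝ :=
  (∑ m : Fin d with m < i, s (Sum.inl m)) +
    ∑ g : Fin (d - 1) with g.val < i.val, s (Sum.inr g)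

/-- Right end point of the `i`-th interval in the partition of `[0,1]` encoded by `s`. -/
def rightEnd {d : ℕ} (s : Coord d → ℝ) (i : Fin d) : ℝ :=
  leftEnd s i + s (Sum.inl i)

/-- The set of the `2d` end points of the partition of `[0,1]` encoded by `s`. -/
def endPoints {d : ℕ} (s : Coord d → ℝ) : Set ℝ :=
  range (leftEnd s) ∪ range (rightEnd s)

/-! ### Embeddings of `Σ_d` into the line and their scaling functions -/

/-- `h` is a topological embedding of `Σ_d` into the line with the standard (lexicographic)
order, and the convex hull of its image is `[0,1]`. -/
structure IsOrderedEmbedding {d : ℕ} (h : Word d → ℝ) : Prop where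
  isEmbedding : IsEmbedding h
  order : ∀ (α β : Word d) (m : ℕ), (∀ i < m, α i = β i) → α m ≠ β m →
    (h β < h α ↔ β m < α m)
  hull : convexHull ℝ (range h) = Icc 0 1

/-- `F : ℝ → ℝ` is of class `C^{k+ε}`: it is `C^k` and its `k`-th derivative is `ε`-Hölder
(Lipschitz if `ε = 1`). -/
def IsCkHolder (k : ℕ) (ε : ℝ) (F : ℝ → ℝ) : Prop :=
  ContDiff ℝ k F ∧
    ∃ K : ℝ, ∀ x y : ℝ, |iteratedDeriv k F x - iteratedDeriv k F y| ≤ K * |x - y| ^ ε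

/-- `h` is a `C^{k+ε}` embedding: each right inverse `f_i⁻¹ : h α ↦ h (i α)` of the induced shift
map extends to a `C^{k+ε}` contraction of `ℝ` with positive derivative. -/
def IsSmoothEmbedding {d : ℕ} (k : ℕ) (ε : ℝ) (h : Word d → ℝ) : Prop :=
  IsOrderedEmbedding h ∧
    ∀ i : Fin d, ∃ F : ℝ → ℝ,
      (∀ α : Word d, F (h α) = h (prepend i α)) ∧
      IsCkHolder k ε F ∧
      (∃ c, ContractingWith c F) ∧
      ∀ x, 0 < deriv F x

/-- `I_{j₁…jₙ} = h {α | α₁ = jₙ, …, αₙ = j₁}`, for the first `n` letters `j₁…jₙ` of `j`. -/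
def piece {d : ℕ} (h : Word d → ℝ) (j : Word d) (n : ℕ) : Set ℝ :=
  h '' {α | ∀ i < n, α i = j (n - 1 - i)}

/-- Length of the convex hull of a (bounded, nonempty) set of reals. -/
def hullLength (J : Set ℝ) : ℝ := sSup J - sInf J

/-- The ratio geometry `S(j₁…jₙ)` at level `n` of the embedding `h`, for the first `n` letters of
`j`: the lengths of the `d` intervals `I_{j₀j₁…jₙ}` and of the `d - 1` gaps between them, divided
by the length of `I_{j₁…jₙ}`. -/
def levelScaling {d : ℕ} (h : Word d → ℝ) (j : Word d) (n : ℕ) : Coord d → ℝ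
  | Sum.inl i => hullLength (piece h (prepend i j) (n + 1)) / hullLength (piece h j n)
  | Sum.inr g =>
      (sInf (piece h (prepend ⟨(g : ℕ) + 1, by omega⟩ j) (n + 1)) -
        sSup (piece h (prepend ⟨(g : ℕ), by omega⟩ j) (n + 1))) / hullLength (piece h j n)

/-- `S` is the scaling function of `h`: `S(j) = lim S(j₁…jₙ)` for every `j ∈ Σ_d^dual`. -/
def IsScalingFunction {d : ℕ} (h : Word d → ℝ) (S : Word d → simp d) : Prop :=
  ∀ j : Word d, Tendsto (fun n => levelScaling h j n) atTop (𝓝 (S j : Coord d → ℝ))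

/-! ### The metric `ρ_S` -/

/-- The sequence `j_s j_{s+1} … j_{n-1} w₀ w₁ …` (positions counted from zero, `s ≤ n`). -/
def splice {d : ℕ} (j : Word d) (s n : ℕ) (w : Word d) : Word d :=
  fun m => if s + m < n then j (s + m) else w (s + m - n)

open Classical in
/-- `ρ_S(j,j') = sup_w ∏_{t=1}^{n} S(j_{t+1}…jₙw)_{j_t}`, `n` being the length of the longest
common beginning of `j ≠ j'` (with positions counted from zero, this is the first position where
`j` and `j'` differ), and `ρ_S(j,j) = 0`. -/
def rho {d : ℕ} (S : Word d → simp d) (j j' : Word d) : ℝ :=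
  if j = j' then 0
  else ⨆ w : Word d, ∏ t ∈ Finset.range (PiNat.firstDiff j j'),
    (S (splice j (t + 1) (PiNat.firstDiff j j') w) : Coord d → ℝ) (Sum.inl (j t))

/-! ### Diffeomorphisms of the unit interval

Maps of `[0,1]` are represented by functions `ℝ → ℝ`; only their values on `[0,1]` matter. -/

/-- `D^k(A₁,A₂)`: (orientation preserving) `C^k` diffeomorphisms of `[0,1]` mapping `A₁` onto
`A₂`. -/
def diffeos (k : ℕ) (A₁ A₂ : Set ℝ) : Set (ℝ → ℝ) :=
  {φ | MapsTo φ (Icc 0 1) (Icc 0 1) ∧ StrictMonoOn φ (Icc 0 1) ∧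
    ContDiffOn ℝ k φ (Icc 0 1) ∧
    (∃ ψ : ℝ → ℝ, MapsTo ψ (Icc 0 1) (Icc 0 1) ∧ InvOn ψ φ (Icc 0 1) (Icc 0 1) ∧
      ContDiffOn ℝ k ψ (Icc 0 1)) ∧
    φ '' A₁ = A₂}

/-- `D^k_var(M)(A₁,A₂)`: those elements `φ` of `D^k(A₁,A₂)` for which
`sup_{x,y ∈ [0,1]} |D^kφ(x) - D^kφ(y)| < M`. -/
def diffeosVar (k : ℕ) (M : ℝ) (A₁ A₂ : Set ℝ) : Set (ℝ → ℝ) :=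
  {φ | φ ∈ diffeos k A₁ A₂ ∧
    (⨆ p : Icc (0 : ℝ) 1 × Icc (0 : ℝ) 1,
      |iteratedDerivWithin k φ (Icc 0 1) p.1 - iteratedDerivWithin k φ (Icc 0 1) p.2|) < M}

/-- `R_i`: restrict `φ` to the `i`-th interval of the partition encoded by `s`, as a map to the
`i`-th interval of the partition encoded by `s'`, and rescale both intervals affinely to
`[0,1]`. -/
def renorm {d : ℕ} (s s' : Coord d → ℝ) (i : Fin d) (φ : ℝ → ℝ) : ℝ → ℝ :=
  fun x => (φ (leftEnd s i + (rightEnd s i - leftEnd s i) * x) - leftEnd s' i) /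
    (rightEnd s' i - leftEnd s' i)

end CantorScaling

end

/-! Write `κ = k + ε - 1`. Restricting a `C^{k+ε}` map to an interval of length `s`, whose image has
comparable length, and rescaling both to `[0,1]` multiplies the oscillation of the `k`-th derivative
by about `s ^ k / s * s ^ ε = s ^ κ`. If two dual words begin with the same word `l`, the relevant
`s` is the product of scalings along `l`, which `rho` dominates. This explains the bound in
condition 2.

From an embedding to the diffeomorphisms: compositions of the branches along `j`, normalized to fix
`0` and `1`, converge to a diffeomorphism `Φ j`, because their logarithmic derivatives are partial
sums of a series that converges geometrically with Hölder bounds of order `k - 1`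
(`exists_limit_coordinates`). The partition `S j` is the image under `Φ j` of the first-level
partition, and `Φ j ∘ F i` equals `Φ (prepend i j)` up to an affine map
(`IsSmoothEmbedding.exists_coordinates`). Hence the transition maps `Φ j' ∘ (Φ j)⁻¹` respect the
partitions, are uniformly bounded in `C^{k+ε}`, and renormalize exactly to one another. The scaling
count then gives `tameCondition_of_coordinates`.

From the diffeomorphisms to an embedding: the maps given for different pairs need not be compatible.
But two maps for the same pair agree at `2 * d > k` end points, so by Rolle's theorem all their
derivatives up to order `k` are close (`diffeosVar_close`). Hence the maps are almost compatible
with renormalization. This yields a uniform lower bound for the ratios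
(`TameCondition.exists_lower_bound`), exponentially small dependence of `S` on remote letters
(`TameCondition.exists_decay`), bounded distortion (`exists_distortion`), and polynomials almost
invariant under renormalization (`TameCondition.exists_polynomials`).

A Cantor set is then built whose ratios at the address `l` are, from some level on, those of `S` at
`l` followed by a fixed word (`model`). The branch `i` must carry the interval `l` to the interval
`l ++ [i]`. The polynomials, placed on these intervals, converge to Whitney data of class `C^{k+ε}`
(`exists_whitneyData`), which extend to the line (`WhitneyData.exists_extension`). The slopes on the
Cantor set and across its gaps stay in a compact part of `(0,1)`, so a modification away from the
Cantor set makes the extension an increasing contraction (`exists_contraction`). -/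

/-! ### Chains of derivatives on the unit interval -/

namespace CantorScaling

/-- The unit interval as a set of reals. -/
abbrev UI : Set ℝ := Icc (0 : ℝ) 1

theorem uniqueDiffOn_UI : UniqueDiffOn ℝ UI := uniqueDiffOn_Icc zero_lt_one

/-- `g 0, …, g k` are successive derivatives on the unit interval. -/
def IsDerivChain (k : ℕ) (g : ℕ → ℝ → ℝ) : Prop :=
  ∀ m < k, ∀ x ∈ UI, HasDerivWithinAt (g m) (g (m + 1) x) UI x

theorem IsDerivChain.of_contDiffOn {k : ℕ} {f : ℝ → ℝ} (hf : ContDiffOn ℝ k f UI) :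
    IsDerivChain k (fun m => iteratedDerivWithin m f UI) := by
  intro m hm x hx
  have h := hf.differentiableOn_iteratedDerivWithin (m := m) (by exact_mod_cast hm)
    uniqueDiffOn_UI
  have := (h x hx).hasDerivWithinAt
  simpa [iteratedDerivWithin_succ] using this

theorem IsDerivChain.eqOn_iteratedDerivWithin {k : ℕ} {g : ℕ → ℝ → ℝ} (hg : IsDerivChain k g)
    {f : ℝ → ℝ} (hf : EqOn f (g 0) UI) {m : ℕ} (hm : m ≤ k) :
    EqOn (iteratedDerivWithin m f UI) (g m) UI := by
  induction m with
  | zero => intro x hx; simpa using hf hx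
  | succ m ih =>
    intro x hx
    have ih := ih (by omega)
    rw [iteratedDerivWithin_succ, derivWithin_congr ih (ih hx)]
    exact (hg m (by omega) x hx).derivWithin (uniqueDiffOn_UI x hx)

theorem IsDerivChain.continuousOn {k : ℕ} {g : ℕ → ℝ → ℝ} (hg : IsDerivChain k g) {m : ℕ}
    (hm : m < k) : ContinuousOn (g m) UI :=
  fun x hx => (hg m hm x hx).continuousWithinAt

theorem IsDerivChain.contDiffOn {k : ℕ} {g : ℕ → ℝ → ℝ} (hg : IsDerivChain k g)
    (hk : ContinuousOn (g k) UI) {f : ℝ → ℝ} (hf : EqOn f (g 0) UI) : ContDiffOn ℝ k f UI := by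
  rw [contDiffOn_nat_iff_continuousOn_differentiableOn_deriv uniqueDiffOn_UI]
  refine ⟨fun m hm => ?_, fun m hm => ?_⟩
  · rcases hm.lt_or_eq with h | rfl
    · exact (hg.continuousOn h).congr (hg.eqOn_iteratedDerivWithin hf hm)
    · exact hk.congr (hg.eqOn_iteratedDerivWithin hf le_rfl)
  · have : DifferentiableOn ℝ (g m) UI :=
      fun x hx => (hg m hm x hx).differentiableWithinAt
    exact this.congr (hg.eqOn_iteratedDerivWithin hf hm.le)

theorem IsDerivChain.mono {k k' : ℕ} {g : ℕ → ℝ → ℝ} (hg : IsDerivChain k g) (h : k' ≤ k) :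
    IsDerivChain k' g := fun m hm => hg m (hm.trans_le h)

theorem IsDerivChain.sub {k : ℕ} {f g : ℕ → ℝ → ℝ} (hf : IsDerivChain k f)
    (hg : IsDerivChain k g) : IsDerivChain k (fun m x => f m x - g m x) :=
  fun m hm x hx => (hf m hm x hx).sub (hg m hm x hx)

/-- The successive derivatives of a polynomial. -/
noncomputable def polyChain (p : Polynomial ℝ) (m : ℕ) (x : ℝ) : ℝ :=
  (Polynomial.derivative^[m] p).eval x

theorem polyChain_hasDerivAt (p : Polynomial ℝ) (m : ℕ) (x : ℝ) :
    HasDerivAt (polyChain p m) (polyChain p (m + 1) x) x := by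
  unfold polyChain
  rw [Function.iterate_succ_apply']
  exact Polynomial.hasDerivAt _ _

theorem polyChain_isDerivChain (k : ℕ) (p : Polynomial ℝ) : IsDerivChain k (polyChain p) :=
  fun m _ x _ => (polyChain_hasDerivAt p m x).hasDerivWithinAt

theorem polyChain_const {p : Polynomial ℝ} {k : ℕ} (hp : p.natDegree ≤ k) (x y : ℝ) :
    polyChain p k x = polyChain p k y := by
  unfold polyChain
  have h : (Polynomial.derivative^[k] p).natDegree = 0 := by
    have := Polynomial.natDegree_iterate_derivative p k
    omega
  rw [Polynomial.eq_C_of_natDegree_eq_zero h]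
  simp

theorem polyChain_eq_zero {p : Polynomial ℝ} {k : ℕ} (hp : p.natDegree < k) (x : ℝ) :
    polyChain p k x = 0 := by
  unfold polyChain
  rw [Polynomial.iterate_derivative_eq_zero hp]
  simp

/-- Rescaling `t ↦ (g (a + s t) - a') / s'` on the level of chains. -/
noncomputable def zoomChain (a s a' s' : ℝ) (g : ℕ → ℝ → ℝ) (m : ℕ) (t : ℝ) : ℝ :=
  s ^ m / s' * (g m (a + s * t) - if m = 0 then a' else 0)

theorem zoom_mem {a s t : ℝ} (ha : 0 ≤ a) (hs : 0 ≤ s) (h : a + s ≤ 1) (ht : t ∈ UI) :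
    a + s * t ∈ UI :=
  ⟨by nlinarith [ht.1], by nlinarith [ht.2]⟩

theorem IsDerivChain.zoom {k : ℕ} {g : ℕ → ℝ → ℝ} (hg : IsDerivChain k g) {a s : ℝ}
    (a' s' : ℝ) (ha : 0 ≤ a) (hs : 0 ≤ s) (h : a + s ≤ 1) :
    IsDerivChain k (zoomChain a s a' s' g) := by
  intro m hm x hx
  have h1 : HasDerivWithinAt (fun t => a + s * t) s UI x := by
    simpa using (((hasDerivAt_id x).const_mul s).const_add a).hasDerivWithinAt
  have h2 := (hg m hm _ (zoom_mem ha hs h hx)).comp x h1 (fun t ht => zoom_mem ha hs h ht)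
  have h3 := (h2.sub_const (if m = 0 then a' else 0)).const_mul (s ^ m / s')
  refine h3.congr_deriv ?_
  simp [zoomChain]
  ring

/-- Rolle's theorem between consecutive zeros: each differentiation loses at most one zero. -/
theorem IsDerivChain.exists_zeros_deriv {k : ℕ} {g : ℕ → ℝ → ℝ} (hg : IsDerivChain k g) {m n : ℕ}
    (hm : m < k) {Z : Finset ℝ} (hZ : ∀ z ∈ Z, z ∈ UI ∧ g m z = 0) (hn : n + 1 ≤ Z.card) :
    ∃ Z' : Finset ℝ, (∀ z ∈ Z', z ∈ UI ∧ g (m + 1) z = 0) ∧ n ≤ Z'.card := by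
  obtain ⟨Y, hYZ, hY⟩ := Finset.exists_subset_card_eq hn
  let e := Y.orderEmbOfFin hY
  have he : ∀ i, e i ∈ UI ∧ g m (e i) = 0 := fun i => hZ _ (hYZ (Y.orderEmbOfFin_mem hY i))
  have key : ∀ i : Fin n, ∃ c ∈ Ioo (e i.castSucc) (e i.succ), g (m + 1) c = 0 := by
    intro i
    have hlt : e i.castSucc < e i.succ := e.strictMono Fin.castSucc_lt_succ
    have hsub : Icc (e i.castSucc) (e i.succ) ⊆ UI :=
      fun x hx => ⟨(he _).1.1.trans hx.1, hx.2.trans (he _).1.2⟩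
    refine exists_hasDerivAt_eq_zero hlt ((hg.continuousOn hm).mono hsub)
      ((he _).2.trans (he _).2.symm) fun x hx => ?_
    have hx' : x ∈ UI := hsub ⟨hx.1.le, hx.2.le⟩
    refine (hg m hm x hx').hasDerivAt (Icc_mem_nhds ?_ ?_)
    · exact (he _).1.1.trans_lt hx.1
    · exact hx.2.trans_le (he _).1.2
  choose c hc hc0 using key
  have hmono : StrictMono c := by
    intro i j hij
    have : e i.succ ≤ e j.castSucc := e.monotone (by
      rw [Fin.le_def]; simpa using hij)
    exact (hc i).2.trans_le (this.trans (hc j).1.le)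
  refine ⟨Finset.univ.image c, ?_, ?_⟩
  · intro z hz
    obtain ⟨i, -, rfl⟩ := Finset.mem_image.1 hz
    exact ⟨⟨(he _).1.1.trans (hc i).1.le, (hc i).2.le.trans (he _).1.2⟩, hc0 i⟩
  · rw [Finset.card_image_of_injective _ hmono.injective]; simp

theorem IsDerivChain.exists_zero {k : ℕ} {g : ℕ → ℝ → ℝ} (hg : IsDerivChain k g)
    {Z : Finset ℝ} (hZ : ∀ z ∈ Z, z ∈ UI ∧ g 0 z = 0) (hn : k < Z.card) {m : ℕ} (hm : m ≤ k) :
    ∃ z ∈ UI, g m z = 0 := by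
  have : ∃ Z' : Finset ℝ, (∀ z ∈ Z', z ∈ UI ∧ g m z = 0) ∧ k + 1 - m ≤ Z'.card := by
    induction m with
    | zero => exact ⟨Z, hZ, by omega⟩
    | succ m ih =>
      obtain ⟨Z', h1, h2⟩ := ih (by omega)
      exact hg.exists_zeros_deriv (by omega) h1 (by omega)
  obtain ⟨Z', h1, h2⟩ := this
  obtain ⟨z, hz⟩ := Finset.card_pos.1 (show 0 < Z'.card by omega)
  exact ⟨z, h1 z hz⟩

theorem IsDerivChain.abs_sub_le {k : ℕ} {g : ℕ → ℝ → ℝ} (hg : IsDerivChain k g) {m : ℕ}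
    (hm : m < k) {M : ℝ} (hM : ∀ x ∈ UI, |g (m + 1) x| ≤ M) {x y : ℝ} (hx : x ∈ UI)
    (hy : y ∈ UI) : |g m y - g m x| ≤ M * |y - x| := by
  have := Convex.norm_image_sub_le_of_norm_hasDerivWithin_le (hg m hm) (C := M)
    (by simpa using hM) (convex_Icc 0 1) hx hy
  simpa using this

theorem abs_sub_le_one {x y : ℝ} (hx : x ∈ UI) (hy : y ∈ UI) : |x - y| ≤ 1 := by
  rw [abs_le]; constructor <;> linarith [hx.1, hx.2, hy.1, hy.2]

/-- If every `g m` with `m ≤ k` has a zero and the top one oscillates by at most `M`, then all of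
them are bounded by `M`. -/
theorem IsDerivChain.abs_le_of_zeros {k : ℕ} {g : ℕ → ℝ → ℝ} (hg : IsDerivChain k g) {M : ℝ}
    (hz : ∀ m ≤ k, ∃ z ∈ UI, g m z = 0) (hM : ∀ x ∈ UI, ∀ y ∈ UI, |g k x - g k y| ≤ M)
    {m : ℕ} (hm : m ≤ k) : ∀ x ∈ UI, |g m x| ≤ M := by
  have hM0 : 0 ≤ M := (abs_nonneg _).trans (hM 0 (by simp) 0 (by simp))
  induction hn : k - m generalizing m with
  | zero =>
    obtain rfl : m = k := by omega
    intro x hx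
    obtain ⟨z, hz, hz0⟩ := hz m le_rfl
    simpa [hz0] using hM x hx z hz
  | succ n ih =>
    intro x hx
    obtain ⟨z, hz, hz0⟩ := hz m hm
    have := hg.abs_sub_le (by omega) (ih (m := m + 1) (by omega) (by omega)) hz hx
    rw [hz0, sub_zero] at this
    exact this.trans (mul_le_of_le_one_right hM0 (abs_sub_le_one hx hz))

/-- More than `k` zeros leave a zero for every derivative up to order `k`, and from these zeros the
bound on the oscillation of the top derivative integrates down to all lower orders. -/
theorem IsDerivChain.abs_le_of_finset {k : ℕ} {g : ℕ → ℝ → ℝ} (hg : IsDerivChain k g) {M : ℝ}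
    {Z : Finset ℝ} (hZ : ∀ z ∈ Z, z ∈ UI ∧ g 0 z = 0) (hn : k < Z.card)
    (hM : ∀ x ∈ UI, ∀ y ∈ UI, |g k x - g k y| ≤ M) {m : ℕ} (hm : m ≤ k) :
    ∀ x ∈ UI, |g m x| ≤ M :=
  hg.abs_le_of_zeros (fun _ h => hg.exists_zero hZ hn h) hM hm

theorem polyChain_bddOn (p : Polynomial ℝ) (k : ℕ) :
    ∃ B, 0 ≤ B ∧ ∀ m ≤ k, ∀ x ∈ UI, |polyChain p m x| ≤ B := by
  have : ∀ m, ∃ B, 0 ≤ B ∧ ∀ x ∈ UI, |polyChain p m x| ≤ B := by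
    intro m
    obtain ⟨B, hB⟩ := isCompact_Icc.exists_bound_of_continuousOn (s := UI)
      (f := polyChain p m) (Polynomial.continuous _).continuousOn
    exact ⟨B, (norm_nonneg _).trans (hB 0 (by simp)), hB⟩
  choose B hB0 hB using this
  refine ⟨∑ m ∈ Finset.range (k + 1), B m, Finset.sum_nonneg fun m _ => hB0 m,
    fun m hm x hx => (hB m x hx).trans ?_⟩
  exact Finset.single_le_sum (fun m _ => hB0 m) (Finset.mem_range.2 (by omega))

/-- A function into the unit interval whose `k`-th derivative oscillates by at most `M` has its
first `k` derivatives bounded in terms of `k` and `M`. -/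
theorem exists_deriv_bound (k : ℕ) : ∃ B, 0 ≤ B ∧ ∀ (g : ℕ → ℝ → ℝ) (M : ℝ), IsDerivChain k g →
    (∀ x ∈ UI, |g 0 x| ≤ 1) → (∀ x ∈ UI, ∀ y ∈ UI, |g k x - g k y| ≤ M) →
    ∀ m ≤ k, ∀ x ∈ UI, |g m x| ≤ M + B := by
  classical
  -- Equally spaced nodes `0, 1/k, …, 1`; for `k = 0` the single node is `0 / 0 = 0`. The
  -- interpolating polynomial at these `k + 1` nodes is bounded through the Lagrange basis, and
  -- subtracting it does not change the oscillation of the `k`-th derivative.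
  let v : ℕ → ℝ := fun i => (i : ℝ) / k
  let s := Finset.range (k + 1)
  choose B hB0 hB using fun i => polyChain_bddOn (Lagrange.basis s v i) k
  refine ⟨∑ i ∈ s, B i, Finset.sum_nonneg fun i _ => hB0 i, fun g M hg h0 hM m hm x hx => ?_⟩
  have hinj : InjOn v s := by
    intro i hi j hj hij
    rcases Nat.eq_zero_or_pos k with rfl | hk
    · simp [s] at hi hj; omega
    · have hk' : (k : ℝ) ≠ 0 := by positivity
      simp only [v, div_left_inj' hk'] at hij
      exact_mod_cast hij
  have hv : ∀ i ∈ s, v i ∈ UI := by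
    intro i hi
    have : (i : ℝ) ≤ k := by exact_mod_cast Nat.lt_succ_iff.1 (Finset.mem_range.1 hi)
    exact ⟨by positivity, div_le_one_of_le₀ this (by positivity)⟩
  let p := Lagrange.interpolate s v fun i => g 0 (v i)
  have hp : p.natDegree ≤ k := by
    have h : p.degree < s.card := Lagrange.degree_interpolate_lt _ hinj
    rw [Finset.card_range, Polynomial.degree_lt_iff_coeff_zero] at h
    exact Polynomial.natDegree_le_iff_coeff_eq_zero.2 fun m hm => h m hm
  have hpb : |polyChain p m x| ≤ ∑ i ∈ s, B i := by
    have : polyChain p m x = ∑ i ∈ s, g 0 (v i) * polyChain (Lagrange.basis s v i) m x := by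
      simp only [polyChain, p, Lagrange.interpolate_apply]
      rw [Polynomial.iterate_derivative_sum, Polynomial.eval_finsetSum]
      refine Finset.sum_congr rfl fun i _ => ?_
      rw [Polynomial.iterate_derivative_C_mul]; simp
    rw [this]
    refine (Finset.abs_sum_le_sum_abs _ _).trans (Finset.sum_le_sum fun i hi => ?_)
    rw [abs_mul]
    calc _ ≤ 1 * B i := mul_le_mul (h0 _ (hv i hi)) (hB i m hm x hx) (abs_nonneg _) zero_le_one
      _ = B i := one_mul _
  have hd := (hg.sub (polyChain_isDerivChain k p)).abs_le_of_finset (M := M) (Z := s.image v)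
    (by
      intro z hz
      obtain ⟨i, hi, rfl⟩ := Finset.mem_image.1 hz
      refine ⟨hv i hi, ?_⟩
      have := Lagrange.eval_interpolate_at_node (fun i => g 0 (v i)) hinj hi
      simp only [polyChain, Function.iterate_zero, id, p, this, sub_self])
    (by rw [Finset.card_image_of_injOn hinj]; simp [s])
    (by
      intro x hx y hy
      simp only [polyChain_const hp x y]
      simpa using hM x hx y hy) hm x hx
  calc |g m x| = |(g m x - polyChain p m x) + polyChain p m x| := by ring_nf
    _ ≤ _ := (abs_add_le _ _).trans (add_le_add hd hpb)

end CantorScaling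

/-! ### Partitions of the unit interval and their diffeomorphisms -/

namespace CantorScaling

section Partition

variable {d : ℕ} {s : Coord d → ℝ}

theorem leftEnd_zero (s : Coord d → ℝ) (i : Fin d) (hi : i.val = 0) : leftEnd s i = 0 := by
  unfold leftEnd
  rw [Finset.sum_eq_zero, Finset.sum_eq_zero, add_zero]
  · intro g hg; simp [hi] at hg
  · intro m hm; simp [Fin.lt_def, hi] at hm

theorem leftEnd_succ (s : Coord d → ℝ) (g : Fin (d - 1)) :
    leftEnd s ⟨g + 1, by omega⟩ = rightEnd s ⟨g, by omega⟩ + s (Sum.inr g) := by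
  unfold rightEnd leftEnd
  have h1 : (Finset.univ.filter fun m : Fin d => m < ⟨g + 1, by omega⟩) =
      insert ⟨g, by omega⟩ (Finset.univ.filter fun m : Fin d => m < ⟨g, by omega⟩) := by
    ext m
    simp only [Finset.mem_filter, Finset.mem_univ, true_and, Finset.mem_insert, Fin.lt_def,
      Fin.ext_iff]
    omega
  have h2 : (Finset.univ.filter fun m : Fin (d - 1) => m.val < g.val + 1) =
      insert g (Finset.univ.filter fun m : Fin (d - 1) => m.val < g.val) := by
    ext m; simp [Fin.ext_iff]; omega
  simp only [h1, h2]
  rw [Finset.sum_insert (by simp), Finset.sum_insert (by simp)]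
  ring

theorem rightEnd_last (hs : s ∈ simp d) (i : Fin d) (hi : i.val + 1 = d) : rightEnd s i = 1 := by
  have := hs.2
  rw [Fintype.sum_sum_type] at this
  unfold rightEnd leftEnd
  have h1 : (Finset.univ : Finset (Fin d)) =
      insert i (Finset.univ.filter fun m : Fin d => m < i) := by
    ext m
    simp only [Finset.mem_filter, Finset.mem_univ, true_and, Finset.mem_insert, Fin.lt_def,
      Fin.ext_iff, true_iff]
    omega
  have h2 : (Finset.univ.filter fun m : Fin (d - 1) => m.val < i.val) = Finset.univ := by
    ext m; simp; omega
  rw [h2]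
  rw [h1, Finset.sum_insert (by simp)] at this
  linarith

theorem simp_pos (hs : s ∈ simp d) (c : Coord d) : 0 < s c := (hs.1 c).1

theorem leftEnd_nonneg (hs : s ∈ simp d) (i : Fin d) : 0 ≤ leftEnd s i :=
  add_nonneg (Finset.sum_nonneg fun _ _ => (simp_pos hs _).le)
    (Finset.sum_nonneg fun _ _ => (simp_pos hs _).le)

theorem leftEnd_lt_rightEnd (hs : s ∈ simp d) (i : Fin d) : leftEnd s i < rightEnd s i :=
  lt_add_of_pos_right _ (simp_pos hs _)

theorem leftEnd_mono (hs : s ∈ simp d) {i j : Fin d} (h : i ≤ j) : leftEnd s i ≤ leftEnd s j := by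
  unfold leftEnd
  refine add_le_add ?_ ?_
  · refine Finset.sum_le_sum_of_subset_of_nonneg ?_ fun _ _ _ => (simp_pos hs _).le
    intro m hm; simp at hm ⊢; exact hm.trans_le h
  · refine Finset.sum_le_sum_of_subset_of_nonneg ?_ fun _ _ _ => (simp_pos hs _).le
    intro m hm; simp at hm ⊢; exact hm.trans_le h

theorem rightEnd_add_le (hs : s ∈ simp d) {i j : Fin d} (h : i < j) :
    rightEnd s i + s (Sum.inr ⟨i, by omega⟩) ≤ leftEnd s j := by
  have := leftEnd_succ s ⟨i, by omega⟩
  simp only at this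
  rw [show (⟨i.val, by omega⟩ : Fin d) = i from rfl] at this
  rw [← this]
  exact leftEnd_mono hs (by rw [Fin.le_def]; exact h)

theorem rightEnd_lt_leftEnd (hs : s ∈ simp d) {i j : Fin d} (h : i < j) :
    rightEnd s i < leftEnd s j :=
  (lt_add_of_pos_right _ (simp_pos hs _)).trans_le (rightEnd_add_le hs h)

theorem rightEnd_le_one (hs : s ∈ simp d) (i : Fin d) : rightEnd s i ≤ 1 := by
  have hd : d - 1 < d := by have := i.2; omega
  rcases lt_or_eq_of_le (show i ≤ ⟨d - 1, hd⟩ by rw [Fin.le_def]; simp; omega) with h | h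
  · rw [← rightEnd_last hs ⟨d - 1, hd⟩ (by simp; omega)]
    exact ((rightEnd_lt_leftEnd hs h).trans (leftEnd_lt_rightEnd hs _)).le
  · exact (rightEnd_last hs i (by rw [h]; simp; omega)).le

theorem leftEnd_mem (hs : s ∈ simp d) (i : Fin d) : leftEnd s i ∈ UI :=
  ⟨leftEnd_nonneg hs i, (leftEnd_lt_rightEnd hs i).le.trans (rightEnd_le_one hs i)⟩

theorem rightEnd_mem (hs : s ∈ simp d) (i : Fin d) : rightEnd s i ∈ UI :=
  ⟨(leftEnd_nonneg hs i).trans (leftEnd_lt_rightEnd hs i).le, rightEnd_le_one hs i⟩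

theorem endPoints_subset (hs : s ∈ simp d) : endPoints s ⊆ UI := by
  rintro x (⟨i, rfl⟩ | ⟨i, rfl⟩)
  exacts [leftEnd_mem hs i, rightEnd_mem hs i]

/-- The end points of the partition in increasing order. -/
noncomputable def endPointEnum (s : Coord d → ℝ) (p : Fin d ×ₗ Bool) : ℝ :=
  if (ofLex p).2 then rightEnd s (ofLex p).1 else leftEnd s (ofLex p).1

theorem endPointEnum_false (s : Coord d → ℝ) (i : Fin d) :
    endPointEnum s (toLex (i, false)) = leftEnd s i := rfl

theorem endPointEnum_true (s : Coord d → ℝ) (i : Fin d) :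
    endPointEnum s (toLex (i, true)) = rightEnd s i := rfl

theorem endPointEnum_strictMono (hs : s ∈ simp d) : StrictMono (endPointEnum s) := by
  intro p q hpq
  obtain ⟨⟨i, b⟩, rfl⟩ : ∃ x : Fin d × Bool, toLex x = p := ⟨ofLex p, rfl⟩
  obtain ⟨⟨j, b'⟩, rfl⟩ : ∃ x : Fin d × Bool, toLex x = q := ⟨ofLex q, rfl⟩
  rcases Prod.Lex.toLex_lt_toLex.1 hpq with h | ⟨h, h'⟩
  · have h1 := rightEnd_lt_leftEnd hs h
    have h2 := leftEnd_lt_rightEnd hs i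
    have h3 := leftEnd_lt_rightEnd hs j
    cases b <;> cases b' <;> simp only [endPointEnum_false, endPointEnum_true] <;> linarith
  · obtain rfl : i = j := h
    cases b <;> cases b'
    exacts [absurd h' (lt_irrefl false), leftEnd_lt_rightEnd hs i, absurd h' (by simp),
      absurd h' (lt_irrefl true)]

theorem range_endPointEnum (s : Coord d → ℝ) : range (endPointEnum s) = endPoints s := by
  ext x
  constructor
  · rintro ⟨⟨i, b⟩, rfl⟩
    cases b
    · exact Or.inl ⟨i, rfl⟩
    · exact Or.inr ⟨i, rfl⟩
  · rintro (⟨i, rfl⟩ | ⟨i, rfl⟩)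
    · exact ⟨toLex (i, false), rfl⟩
    · exact ⟨toLex (i, true), rfl⟩

/-- The end points of the partition as a finite set. -/
noncomputable def endPointFinset (s : Coord d → ℝ) : Finset ℝ := Finset.univ.image (endPointEnum s)

theorem mem_endPointFinset {x : ℝ} : x ∈ endPointFinset s ↔ x ∈ endPoints s := by
  rw [← range_endPointEnum]; simp [endPointFinset]

theorem card_endPointFinset (hs : s ∈ simp d) : (endPointFinset s).card = 2 * d := by
  rw [endPointFinset, Finset.card_image_of_injective _ (endPointEnum_strictMono hs).injective]
  simp only [Finset.card_univ]
  rw [Fintype.card_congr (toLex (α := Fin d × Bool)).symm]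
  simp [mul_comm]

/-- Both partitions have end points of the same finite order type, so an increasing map that sends
one set of end points onto the other must preserve ranks. -/
theorem map_endPointEnum {k : ℕ} {s' : Coord d → ℝ} (hs : s ∈ simp d) (hs' : s' ∈ simp d)
    {φ : ℝ → ℝ} (hφ : φ ∈ diffeos k (endPoints s) (endPoints s')) (p : Fin d ×ₗ Bool) :
    φ (endPointEnum s p) = endPointEnum s' p := by
  have hmem : ∀ p, endPointEnum s p ∈ UI := fun p =>
    endPoints_subset hs (range_endPointEnum s ▸ mem_range_self p)
  have h1 : StrictMono (φ ∘ endPointEnum s) := fun p q h =>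
    hφ.2.1 (hmem p) (hmem q) (endPointEnum_strictMono hs h)
  have h2 := (StrictMono.range_inj h1 (endPointEnum_strictMono hs')).1 (by
    rw [range_comp, range_endPointEnum, range_endPointEnum, hφ.2.2.2.2])
  exact congrFun h2 p

theorem map_leftEnd {k : ℕ} {s' : Coord d → ℝ} (hs : s ∈ simp d) (hs' : s' ∈ simp d)
    {φ : ℝ → ℝ} (hφ : φ ∈ diffeos k (endPoints s) (endPoints s')) (i : Fin d) :
    φ (leftEnd s i) = leftEnd s' i :=
  map_endPointEnum hs hs' hφ (toLex (i, false))

theorem map_rightEnd {k : ℕ} {s' : Coord d → ℝ} (hs : s ∈ simp d) (hs' : s' ∈ simp d)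
    {φ : ℝ → ℝ} (hφ : φ ∈ diffeos k (endPoints s) (endPoints s')) (i : Fin d) :
    φ (rightEnd s i) = rightEnd s' i :=
  map_endPointEnum hs hs' hφ (toLex (i, true))

theorem map_endPoints {s' : Coord d → ℝ} {φ : ℝ → ℝ}
    (hl : ∀ i, φ (leftEnd s i) = leftEnd s' i) (hr : ∀ i, φ (rightEnd s i) = rightEnd s' i) :
    φ '' endPoints s = endPoints s' := by
  unfold endPoints
  rw [image_union, ← range_comp, ← range_comp]
  congr 2
  · exact funext hl
  · exact funext hr

/-- Left end point of the interval or gap with coordinate `c`. -/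
def coordStart (s : Coord d → ℝ) : Coord d → ℝ
  | Sum.inl i => leftEnd s i
  | Sum.inr g => rightEnd s ⟨g, by omega⟩

theorem coordStart_mem (hs : s ∈ simp d) (c : Coord d) : coordStart s c ∈ UI := by
  rcases c with i | g
  exacts [leftEnd_mem hs i, rightEnd_mem hs _]

theorem coordStart_add_mem (hs : s ∈ simp d) (c : Coord d) : coordStart s c + s c ∈ UI := by
  rcases c with i | g
  · exact rightEnd_mem hs i
  · simp only [coordStart]; rw [← leftEnd_succ]; exact leftEnd_mem hs _

theorem map_coordStart {k : ℕ} {s' : Coord d → ℝ} (hs : s ∈ simp d) (hs' : s' ∈ simp d)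
    {φ : ℝ → ℝ} (hφ : φ ∈ diffeos k (endPoints s) (endPoints s')) (c : Coord d) :
    φ (coordStart s c) = coordStart s' c ∧
      φ (coordStart s c + s c) = coordStart s' c + s' c := by
  rcases c with i | g
  · exact ⟨map_leftEnd hs hs' hφ i, map_rightEnd hs hs' hφ i⟩
  · refine ⟨map_rightEnd hs hs' hφ _, ?_⟩
    simp only [coordStart]
    rw [← leftEnd_succ, ← leftEnd_succ]
    exact map_leftEnd hs hs' hφ _

theorem map_zero_one {k : ℕ} {s' : Coord d → ℝ} (hd : 0 < d) (hs : s ∈ simp d)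
    (hs' : s' ∈ simp d) {φ : ℝ → ℝ} (hφ : φ ∈ diffeos k (endPoints s) (endPoints s')) :
    φ 0 = 0 ∧ φ 1 = 1 := by
  constructor
  · have := map_leftEnd hs hs' hφ ⟨0, hd⟩
    rwa [leftEnd_zero _ _ rfl, leftEnd_zero _ _ rfl] at this
  · have := map_rightEnd hs hs' hφ ⟨d - 1, by omega⟩
    rwa [rightEnd_last hs _ (by simp; omega), rightEnd_last hs' _ (by simp; omega)] at this

theorem simp_le_one_sub {δ : ℝ} (hd : 2 ≤ d) (hs : s ∈ simp d) (h : ∀ c, δ ≤ s c) (c : Coord d) :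
    s c ≤ 1 - δ := by
  have hsum := hs.2
  obtain ⟨c', hc'⟩ : ∃ c', c' ≠ c := by
    rcases c with i | g
    · exact ⟨Sum.inr ⟨0, by omega⟩, by simp⟩
    · exact ⟨Sum.inl ⟨0, by omega⟩, by simp⟩
  have : s c + s c' ≤ ∑ c, s c := by
    rw [← Finset.sum_pair hc'.symm]
    exact Finset.sum_le_sum_of_subset_of_nonneg (by simp) fun _ _ _ => (simp_pos hs _).le
  linarith [h c']

end Partition

/-- Needed because a real supremum over an unbounded family takes the default value `0`, and a bound
on it would then say nothing. -/
theorem bddAbove_osc {k : ℕ} {φ : ℝ → ℝ} (h : ContDiffOn ℝ k φ UI) :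
    BddAbove (range fun p : Icc (0 : ℝ) 1 × Icc (0 : ℝ) 1 =>
      |iteratedDerivWithin k φ (Icc 0 1) p.1 - iteratedDerivWithin k φ (Icc 0 1) p.2|) := by
  obtain ⟨B, hB⟩ := isCompact_Icc.exists_bound_of_continuousOn (s := UI)
    (h.continuousOn_iteratedDerivWithin le_rfl uniqueDiffOn_UI)
  refine ⟨B + B, ?_⟩
  rintro _ ⟨p, rfl⟩
  exact (abs_sub _ _).trans (add_le_add (hB _ p.1.2) (hB _ p.2.2))

theorem diffeosVar_osc {k : ℕ} {M : ℝ} {A A' : Set ℝ} {φ : ℝ → ℝ} (h : φ ∈ diffeosVar k M A A') :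
    ∀ x ∈ UI, ∀ y ∈ UI, |iteratedDerivWithin k φ UI x - iteratedDerivWithin k φ UI y| ≤ M :=
  fun x hx y hy => (le_ciSup (bddAbove_osc h.1.2.2.1) (⟨x, hx⟩, ⟨y, hy⟩)).trans h.2.le

theorem mem_diffeosVar {k : ℕ} {M M' : ℝ} {A A' : Set ℝ} {φ : ℝ → ℝ} (h : φ ∈ diffeos k A A')
    (hM : ∀ x ∈ UI, ∀ y ∈ UI,
      |iteratedDerivWithin k φ UI x - iteratedDerivWithin k φ UI y| ≤ M') (hM' : M' < M) :
    φ ∈ diffeosVar k M A A' := by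
  have : Nonempty (Icc (0 : ℝ) 1) := ⟨⟨0, by simp⟩⟩
  exact ⟨h, (ciSup_le fun p => hM _ p.1.2 _ p.2.2).trans_lt hM'⟩

/-- The chain of derivatives of a smooth function on the unit interval. -/
noncomputable abbrev derivChain (φ : ℝ → ℝ) (m : ℕ) : ℝ → ℝ := iteratedDerivWithin m φ UI

theorem diffeos_chain {k : ℕ} {A A' : Set ℝ} {φ : ℝ → ℝ} (h : φ ∈ diffeos k A A') :
    IsDerivChain k (derivChain φ) := IsDerivChain.of_contDiffOn h.2.2.1

/-- The hypothesis `k < 2 * d` acts here: the difference vanishes at all `2 * d` end points, which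
is more than `k` zeros. Any two admissible maps are therefore interchangeable up to the admitted
error. -/
theorem diffeosVar_close {d k : ℕ} {M : ℝ} {s s' : Coord d → ℝ} (hk : k < 2 * d)
    (hs : s ∈ simp d) (hs' : s' ∈ simp d) {φ ψ : ℝ → ℝ}
    (hφ : φ ∈ diffeosVar k M (endPoints s) (endPoints s'))
    (hψ : ψ ∈ diffeosVar k M (endPoints s) (endPoints s')) {m : ℕ} (hm : m ≤ k) :
    ∀ x ∈ UI, |derivChain φ m x - derivChain ψ m x| ≤ 2 * M := by
  refine ((diffeos_chain hφ.1).sub (diffeos_chain hψ.1)).abs_le_of_finset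
    (Z := endPointFinset s) ?_ ?_ ?_ hm
  · intro z hz
    rw [mem_endPointFinset] at hz
    refine ⟨endPoints_subset hs hz, ?_⟩
    obtain ⟨p, rfl⟩ := (range_endPointEnum s).symm ▸ hz
    simp only [derivChain, iteratedDerivWithin_zero]
    rw [map_endPointEnum hs hs' hφ.1, map_endPointEnum hs hs' hψ.1, sub_self]
  · rw [card_endPointFinset hs]; exact hk
  · intro x hx y hy
    have h1 := diffeosVar_osc hφ x hx y hy
    have h2 := diffeosVar_osc hψ x hx y hy
    rw [abs_le] at h1 h2 ⊢
    simp only [derivChain]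
    constructor <;> linarith

/-- Taylor polynomial at `0` built from a chain of derivatives. -/
noncomputable def taylorPoly (k : ℕ) (g : ℕ → ℝ → ℝ) : Polynomial ℝ :=
  ∑ r ∈ Finset.range (k + 1), Polynomial.monomial r (g r 0 / r.factorial)

theorem natDegree_taylorPoly (k : ℕ) (g : ℕ → ℝ → ℝ) : (taylorPoly k g).natDegree ≤ k := by
  refine Polynomial.natDegree_sum_le_of_forall_le _ _ fun r hr => ?_
  exact (Polynomial.natDegree_monomial_le _).trans (Nat.lt_succ_iff.1 (Finset.mem_range.1 hr))

theorem polyChain_taylorPoly {k : ℕ} (g : ℕ → ℝ → ℝ) {m : ℕ} (hm : m ≤ k) :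
    polyChain (taylorPoly k g) m 0 = g m 0 := by
  unfold polyChain
  rw [← Polynomial.coeff_zero_eq_eval_zero, Polynomial.coeff_iterate_derivative, zero_add,
    Nat.descFactorial_self, taylorPoly, Polynomial.finsetSum_coeff]
  simp only [Polynomial.coeff_monomial]
  rw [Finset.sum_ite_eq' (Finset.range (k + 1)) m, if_pos (Finset.mem_range.2 (by omega))]
  rw [nsmul_eq_mul]
  have : (m.factorial : ℝ) ≠ 0 := by exact_mod_cast m.factorial_ne_zero
  field_simp

/-- After subtraction of the Taylor polynomial every derivative up to order `k` vanishes at `0`,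
while the top derivative has changed only by a constant. -/
theorem IsDerivChain.taylor_close {k : ℕ} {g : ℕ → ℝ → ℝ} (hg : IsDerivChain k g) {M : ℝ}
    (hM : ∀ x ∈ UI, ∀ y ∈ UI, |g k x - g k y| ≤ M) {m : ℕ} (hm : m ≤ k) :
    ∀ x ∈ UI, |g m x - polyChain (taylorPoly k g) m x| ≤ M := by
  refine (hg.sub (polyChain_isDerivChain k _)).abs_le_of_zeros (fun m hm => ⟨0, by simp, ?_⟩)
    ?_ hm
  · simp [polyChain_taylorPoly g hm]
  · intro x hx y hy
    simp only [polyChain_const (natDegree_taylorPoly k g) x y]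
    simpa using hM x hx y hy

end CantorScaling

/-! ### Words and the metric `rho` -/

namespace CantorScaling

variable {d : ℕ}

@[simp] theorem prepend_zero (c : Fin d) (x : Word d) : prepend c x 0 = c := rfl

@[simp] theorem prepend_succ (c : Fin d) (x : Word d) (n : ℕ) : prepend c x (n + 1) = x n := rfl

/-- The infinite word obtained by writing a finite word in front of an infinite one. -/
def app : List (Fin d) → Word d → Word d
  | [], w => w
  | c :: l, w => prepend c (app l w)

@[simp] theorem app_nil (w : Word d) : app [] w = w := rfl

@[simp] theorem app_cons (c : Fin d) (l : List (Fin d)) (w : Word d) :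
    app (c :: l) w = prepend c (app l w) := rfl

theorem app_append (l l' : List (Fin d)) (w : Word d) : app (l ++ l') w = app l (app l' w) := by
  induction l with
  | nil => rfl
  | cons c l ih => simp [ih]

theorem app_add (l : List (Fin d)) (w : Word d) (m : ℕ) : app l w (l.length + m) = w m := by
  induction l with
  | nil => simp
  | cons c l ih =>
    rw [List.length_cons, show l.length + 1 + m = (l.length + m) + 1 by ring]
    simpa using ih

theorem app_length (l : List (Fin d)) (w : Word d) : app l w l.length = w 0 := app_add l w 0

theorem app_lt (l : List (Fin d)) (w w' : Word d) {m : ℕ} (hm : m < l.length) :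
    app l w m = app l w' m := by
  induction l generalizing m with
  | nil => simp at hm
  | cons c l ih =>
    cases m with
    | zero => rfl
    | succ m => exact ih (by simpa using hm)

theorem prepend_injective (c : Fin d) : Function.Injective (prepend c) := by
  intro x y h
  ext1 n
  exact congrFun h (n + 1)

theorem app_injective (l : List (Fin d)) : Function.Injective (app l) := by
  intro x y h
  ext1 n
  rw [← app_add l x, ← app_add l y, h]

/-- The first `n` letters of an infinite word. -/
def tk (j : Word d) : ℕ → List (Fin d)
  | 0 => []
  | n + 1 => j 0 :: tk (fun m => j (m + 1)) n

@[simp] theorem tk_length (j : Word d) (n : ℕ) : (tk j n).length = n := by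
  induction n generalizing j with
  | zero => rfl
  | succ n ih => simp [tk, ih]

theorem app_tk (j : Word d) (n : ℕ) : app (tk j n) (fun m => j (n + m)) = j := by
  induction n generalizing j with
  | zero => simp [tk]
  | succ n ih =>
    ext1 m
    cases m with
    | zero => rfl
    | succ m =>
      have := congrFun (ih fun m => j (m + 1)) m
      simp only [tk, app_cons, prepend_succ]
      rw [← this]
      simp only [show ∀ m, n + 1 + m = n + m + 1 from fun m => by ring]

theorem tk_congr {j j' : Word d} {n : ℕ} (h : ∀ m < n, j m = j' m) : tk j n = tk j' n := by
  induction n generalizing j j' with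
  | zero => rfl
  | succ n ih =>
    simp only [tk]
    rw [h 0 (by omega), ih fun m hm => h (m + 1) (by omega)]

theorem firstDiff_eq {x y : Word d} {n : ℕ} (h : ∀ m < n, x m = y m) (hn : x n ≠ y n) :
    PiNat.firstDiff x y = n := by
  have hxy : x ≠ y := fun e => hn (by rw [e])
  apply le_antisymm
  · by_contra! hlt
    exact hn (PiNat.apply_eq_of_lt_firstDiff hlt)
  · by_contra! hlt
    exact PiNat.apply_firstDiff_ne hxy (h _ hlt)

theorem firstDiff_app (l : List (Fin d)) {v v' : Word d} (h : v 0 ≠ v' 0) :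
    PiNat.firstDiff (app l v) (app l v') = l.length :=
  firstDiff_eq (fun m hm => app_lt l v v' hm) (by rwa [app_length, app_length])

theorem exists_app {x x' : Word d} (h : x ≠ x') :
    ∃ l v v', v 0 ≠ v' 0 ∧ x = app l v ∧ x' = app l v' := by
  have h1 := PiNat.apply_firstDiff_ne h
  set n := PiNat.firstDiff x x'
  refine ⟨tk x n, fun m => x (n + m), fun m => x' (n + m), h1, (app_tk x n).symm, ?_⟩
  rw [tk_congr (j' := x') fun m hm => PiNat.apply_eq_of_lt_firstDiff hm]
  exact (app_tk x' n).symm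

theorem splice_prepend (c : Fin d) (x w : Word d) (s n : ℕ) :
    splice (prepend c x) (s + 1) (n + 1) w = splice x s n w := by
  ext1 m
  unfold splice
  rw [show s + 1 + m = s + m + 1 by ring]
  simp

theorem splice_app (l : List (Fin d)) (v w : Word d) : splice (app l v) 0 l.length w = app l w := by
  ext1 m
  unfold splice
  split_ifs with h
  · rw [zero_add]; exact app_lt l v w (by omega)
  · obtain ⟨k, rfl⟩ := Nat.exists_eq_add_of_le (show l.length ≤ m by omega)
    rw [app_add]; congr 1; omega

/-- The product of the scalings along a finite word followed by `w`. -/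
def Pr (S : Word d → simp d) : List (Fin d) → Word d → ℝ
  | [], _ => 1
  | c :: l, w => (S (app l w)).1 (Sum.inl c) * Pr S l w

variable (S : Word d → simp d)

theorem prod_splice (l : List (Fin d)) (v w : Word d) :
    ∏ t ∈ Finset.range l.length,
      (S (splice (app l v) (t + 1) l.length w) : Coord d → ℝ) (Sum.inl (app l v t)) =
      Pr S l w := by
  induction l with
  | nil => simp [Pr]
  | cons c l ih =>
    rw [List.length_cons, Finset.prod_range_succ']
    simp only [app_cons, prepend_succ, prepend_zero, Pr]
    rw [splice_prepend, splice_app, mul_comm, ← ih]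
    congr 1
    exact Finset.prod_congr rfl fun t _ => by rw [splice_prepend]

theorem Pr_pos (l : List (Fin d)) (w : Word d) : 0 < Pr S l w := by
  induction l with
  | nil => exact one_pos
  | cons c l ih => exact mul_pos (simp_pos (S _).2 _) ih

theorem Pr_le_pow {t : ℝ} (h : ∀ x c, (S x).1 c ≤ t) (l : List (Fin d)) (w : Word d) :
    Pr S l w ≤ t ^ l.length := by
  induction l with
  | nil => simp [Pr]
  | cons c l ih =>
    rw [List.length_cons, pow_succ']
    exact mul_le_mul (h _ _) ih (Pr_pos S l w).le ((simp_pos (S w).2 (Sum.inl c)).le.trans (h w _))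

theorem Pr_le_one (l : List (Fin d)) (w : Word d) : Pr S l w ≤ 1 := by
  simpa using Pr_le_pow S (t := 1) (fun x c => ((S x).2.1 c).2.le) l w

theorem Pr_append (l l' : List (Fin d)) (w : Word d) :
    Pr S (l ++ l') w = Pr S l (app l' w) * Pr S l' w := by
  induction l with
  | nil => simp [Pr]
  | cons c l ih => simp [Pr, ih, app_append, mul_assoc]

theorem bddAbove_Pr (l : List (Fin d)) : BddAbove (range fun w => Pr S l w) :=
  ⟨1, by rintro _ ⟨w, rfl⟩; exact Pr_le_one S l w⟩

theorem rho_app (l : List (Fin d)) {v v' : Word d} (h : v 0 ≠ v' 0) :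
    rho S (app l v) (app l v') = ⨆ w, Pr S l w := by
  unfold rho
  rw [if_neg fun e => h (congrFun (app_injective l e) 0), firstDiff_app l h]
  simp only [prod_splice]

theorem Pr_le_rho (l : List (Fin d)) {v v' : Word d} (h : v 0 ≠ v' 0) (w : Word d) :
    Pr S l w ≤ rho S (app l v) (app l v') := by
  rw [rho_app S l h]
  exact le_ciSup (bddAbove_Pr S l) w

/-- The words `v` and `v'` may have further letters in common; these only add factors at most `1` to
the product. -/
theorem rho_app_le {B : ℝ} (l : List (Fin d)) {v v' : Word d} (h : v ≠ v')
    (hB : ∀ w, Pr S l w ≤ B) : rho S (app l v) (app l v') ≤ B := by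
  have : Nonempty (Word d) := ⟨v⟩
  obtain ⟨l', u, u', hu, rfl, rfl⟩ := exists_app h
  rw [← app_append, ← app_append, rho_app S _ hu]
  refine ciSup_le fun w => ?_
  rw [Pr_append]
  exact (mul_le_of_le_one_right (Pr_pos S _ _).le (Pr_le_one S _ _)).trans (hB _)

theorem rho_pos {x x' : Word d} (h : x ≠ x') : 0 < rho S x x' := by
  obtain ⟨l, v, v', hv, rfl, rfl⟩ := exists_app h
  exact (Pr_pos S l v).trans_le (Pr_le_rho S l hv v)

theorem rho_le_one {x x' : Word d} (h : x ≠ x') : rho S x x' ≤ 1 :=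
  rho_app_le S [] h fun _ => le_rfl

/-- Allows errors measured by `rho` at one level to be charged to the next, smaller level at the
cost of a constant. -/
theorem rho_prepend {δ : ℝ} (hδ : ∀ x c, δ ≤ (S x).1 c) {x x' : Word d} (h : x ≠ x')
    (c : Fin d) : δ * rho S x x' ≤ rho S (prepend c x) (prepend c x') := by
  obtain ⟨l, v, v', hv, rfl, rfl⟩ := exists_app h
  have : Nonempty (Word d) := ⟨v⟩
  rcases le_or_gt δ 0 with h0 | h0
  · exact (mul_nonpos_of_nonpos_of_nonneg h0 (rho_pos S h).le).trans
      (rho_pos S fun e => h (prepend_injective c e)).le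
  rw [rho_app S l hv, mul_comm, ← le_div_iff₀ h0]
  refine ciSup_le fun w => ?_
  rw [le_div_iff₀ h0]
  calc Pr S l w * δ ≤ Pr S (c :: l) w := by
        rw [mul_comm]; exact mul_le_mul_of_nonneg_right (hδ _ _) (Pr_pos S l w).le
    _ ≤ _ := Pr_le_rho S (c :: l) hv w

theorem prepend_ne {x x' : Word d} (h : x ≠ x') (c : Fin d) : prepend c x ≠ prepend c x' :=
  fun e => h (prepend_injective c e)

end CantorScaling

/-! ### From the tame condition to an embedding. -/

/-! ### Tame diffeomorphisms -/

namespace CantorScaling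

variable {d k : ℕ} {C κ : ℝ} {S : Word d → simp d}

/-- The diffeomorphisms between the partitions `S x` and `S x'` that are close to polynomials
of degree at most `k` to the order prescribed by `rho`. -/
def tame (S : Word d → simp d) (k : ℕ) (C κ : ℝ) (x x' : Word d) : Set (ℝ → ℝ) :=
  diffeosVar k (C * rho S x x' ^ κ) (endPoints (S x).1) (endPoints (S x').1)

/-- Each pair of distinct words has a tame diffeomorphism whose renormalization is tame. -/
def TameCondition (S : Word d → simp d) (k : ℕ) (C κ : ℝ) : Prop :=
  ∀ x x' : Word d, x ≠ x' → ∀ c : Fin d,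
    ∃ ψ ∈ tame S k C κ x x',
      renorm (S x).1 (S x').1 c ψ ∈ tame S k C κ (prepend c x) (prepend c x')

theorem derivChain_renorm {s s' : Coord d → ℝ} (hs : s ∈ simp d) {A A' : Set ℝ} {ψ : ℝ → ℝ}
    (hψ : ψ ∈ diffeos k A A') (i : Fin d) {m : ℕ} (hm : m ≤ k) :
    EqOn (derivChain (renorm s s' i ψ) m)
      (zoomChain (leftEnd s i) (s (Sum.inl i)) (leftEnd s' i) (s' (Sum.inl i)) (derivChain ψ) m)
      UI := by
  refine ((diffeos_chain hψ).zoom _ _ (leftEnd_nonneg hs i) (simp_pos hs _).le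
    (rightEnd_le_one hs i)).eqOn_iteratedDerivWithin ?_ hm
  intro x _
  simp [zoomChain, renorm, rightEnd]
  ring

theorem TameCondition.exists_tame (H : TameCondition S k C κ) (hd : 0 < d) {x x' : Word d}
    (h : x ≠ x') : ∃ ψ, ψ ∈ tame S k C κ x x' := by
  obtain ⟨ψ, h1, -⟩ := H x x' h ⟨0, hd⟩
  exact ⟨ψ, h1⟩

theorem exists_ne_word (hd : 2 ≤ d) (x : Word d) : ∃ x', x' ≠ x := by
  have : Nontrivial (Fin d) := Fin.nontrivial_iff_two_le.2 hd
  obtain ⟨c, hc⟩ := exists_ne (x 0)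
  exact ⟨fun _ => c, fun e => hc (congrFun e 0)⟩

/-- The oscillation is nonnegative and strictly below `C * rho ^ κ`. -/
theorem TameCondition.pos (H : TameCondition S k C κ) (hd : 2 ≤ d) : 0 < C := by
  let x : Word d := fun _ => ⟨0, by omega⟩
  obtain ⟨x', hx'⟩ := exists_ne_word hd x
  obtain ⟨ψ, h1⟩ := H.exists_tame (by omega) hx'
  have h3 : 0 < C * rho S x' x ^ κ := by
    have : Nonempty (Icc (0 : ℝ) 1 × Icc (0 : ℝ) 1) := ⟨⟨0, by simp⟩, ⟨0, by simp⟩⟩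
    exact (Real.iSup_nonneg fun p => abs_nonneg _).trans_lt h1.2
  exact pos_of_mul_pos_left h3 (Real.rpow_nonneg (rho_pos S hx').le _)

theorem rho_rpow_le_one (hκ : 0 ≤ κ) {x x' : Word d} (h : x ≠ x') : rho S x x' ^ κ ≤ 1 :=
  Real.rpow_le_one (rho_pos S h).le (rho_le_one S h) hκ

theorem tame_osc (hC : 0 ≤ C) (hκ : 0 ≤ κ) {x x' : Word d} (h : x ≠ x') {ψ : ℝ → ℝ}
    (hψ : ψ ∈ tame S k C κ x x') :
    ∀ t ∈ UI, ∀ u ∈ UI, |derivChain ψ k t - derivChain ψ k u| ≤ C := fun t ht u hu =>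
  (diffeosVar_osc hψ t ht u hu).trans (mul_le_of_le_one_right hC (rho_rpow_le_one hκ h))

theorem diffeos_abs_le {A A' : Set ℝ} {ψ : ℝ → ℝ} (hψ : ψ ∈ diffeos k A A') :
    ∀ x ∈ UI, |derivChain ψ 0 x| ≤ 1 := by
  intro x hx
  have := hψ.1 hx
  simp only [derivChain, iteratedDerivWithin_zero]
  rw [abs_of_nonneg this.1]; exact this.2

/-- Uniform bound on the derivatives of tame diffeomorphisms. -/
theorem exists_tame_bound (k : ℕ) {C κ : ℝ} (hC : 0 ≤ C) (hκ : 0 ≤ κ) (S : Word d → simp d) :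
    ∃ B, 1 ≤ B ∧ ∀ x x', x ≠ x' → ∀ ψ ∈ tame S k C κ x x', ∀ m ≤ k, ∀ t ∈ UI,
      |derivChain ψ m t| ≤ B := by
  obtain ⟨B, hB0, hB⟩ := exists_deriv_bound k
  refine ⟨C + B + 1, by linarith, fun x x' h ψ hψ m hm t ht => ?_⟩
  have := hB _ C (diffeos_chain hψ.1) (diffeos_abs_le hψ.1) (tame_osc hC hκ h hψ) m hm t ht
  linarith

/-- A tame map has first derivative at most `B`, so it stretches each interval and each gap by a
factor at most `B`. Applied to tame maps onto the partition of one fixed word `x₀`, this bounds all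
partitions from below. -/
theorem TameCondition.exists_lower_bound (H : TameCondition S k C κ) (hd : 2 ≤ d) (hk : 1 ≤ k)
    (hκ : 0 ≤ κ) : ∃ δ, 0 < δ ∧ ∀ x c, δ ≤ (S x).1 c := by
  obtain ⟨B, hB1, hB⟩ := exists_tame_bound k (H.pos hd).le hκ S
  have hcmp : ∀ x x', x ≠ x' → ∀ c, (S x').1 c ≤ B * (S x).1 c := by
    intro x x' h c
    obtain ⟨ψ, hψ⟩ := H.exists_tame (by omega) h
    have h1 := (diffeos_chain hψ.1).abs_sub_le (m := 0) (by omega) (hB x x' h ψ hψ 1 hk)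
      (coordStart_mem (S x).2 c) (coordStart_add_mem (S x).2 c)
    simp only [derivChain, iteratedDerivWithin_zero] at h1
    obtain ⟨h2, h3⟩ := map_coordStart (S x).2 (S x').2 hψ.1 c
    rw [h2, h3, add_sub_cancel_left, add_sub_cancel_left, abs_of_pos (simp_pos (S x').2 c),
      abs_of_pos (simp_pos (S x).2 c)] at h1
    exact h1
  let x₀ : Word d := fun _ => ⟨0, by omega⟩
  have : Nonempty (Coord d) := ⟨Sum.inl ⟨0, by omega⟩⟩
  obtain ⟨c₀, hc₀⟩ := Finite.exists_min (S x₀).1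
  have hpos := simp_pos (S x₀).2 c₀
  have hB0 : 0 < B := by linarith
  refine ⟨(S x₀).1 c₀ / B, by positivity, fun x c => ?_⟩
  by_cases h : x = x₀
  · subst h
    exact (div_le_self hpos.le hB1).trans (hc₀ c)
  · rw [div_le_iff₀ hB0, mul_comm]
    exact (hc₀ c).trans (hcmp x x₀ h c)

/-- If the derivative of `φ` oscillates by at most `e`, then `φ` almost preserves the ratios. -/
theorem coord_close {s s' : Coord d → ℝ} (hd : 0 < d) (hs : s ∈ simp d) (hs' : s' ∈ simp d)
    (hk : 1 ≤ k) {φ : ℝ → ℝ} (hφ : φ ∈ diffeos k (endPoints s) (endPoints s')) {e : ℝ}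
    (he : ∀ x ∈ UI, ∀ y ∈ UI, |derivChain φ 1 x - derivChain φ 1 y| ≤ e) (c : Coord d) :
    |s' c - s c| ≤ e * s c := by
  have h01 := map_zero_one hd hs hs' hφ
  -- Comparison with the identity, with which `φ` agrees at `0` and `1`: two zeros suffice to
  -- control the first derivative of the difference.
  have hch := ((diffeos_chain hφ).mono hk).sub (polyChain_isDerivChain 1 Polynomial.X)
  have key := hch.abs_le_of_finset (M := e) (Z := {0, 1}) (by
      intro z hz
      simp only [Finset.mem_insert, Finset.mem_singleton] at hz
      rcases hz with rfl | rfl <;>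
        simp [derivChain, polyChain, h01]) (by simp) (by
      intro x hx y hy
      simpa [polyChain] using he x hx y hy) le_rfl
  have h1 := hch.abs_sub_le (m := 0) one_pos key (coordStart_mem hs c) (coordStart_add_mem hs c)
  obtain ⟨h2, h3⟩ := map_coordStart hs hs' hφ c
  simp only [derivChain, iteratedDerivWithin_zero, polyChain, Function.iterate_zero, id,
    Polynomial.eval_X] at h1
  rw [h2, h3, add_sub_cancel_left, abs_of_pos (simp_pos hs c)] at h1
  convert h1 using 2
  ring

/-- All tame diffeomorphisms from `S x` to `S x'` have second derivative at most `e`. -/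
def Flat (S : Word d → simp d) (k : ℕ) (C κ e : ℝ) (x x' : Word d) : Prop :=
  ∀ φ ∈ tame S k C κ x x', ∀ t ∈ UI, |derivChain φ 2 t| ≤ e

theorem Flat.mono {e e' : ℝ} {x x' : Word d} (h : Flat S k C κ e x x') (he : e ≤ e') :
    Flat S k C κ e' x x' := fun φ hφ t ht => (h φ hφ t ht).trans he

/-- Renormalization multiplies second derivatives by `s ^ 2 / s'`, with `s` and `s'` the lengths of
the source and target intervals. The renormalized map is one tame map of the new pair, and by
`diffeosVar_close` every other one differs from it by the additive error only. -/
theorem TameCondition.flat_prepend (H : TameCondition S k C κ) (hk : 2 ≤ k) (hkd : k < 2 * d)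
    {x x' : Word d} (h : x ≠ x') {e : ℝ} (hf : Flat S k C κ e x x') (c : Fin d) :
    Flat S k C κ ((S x).1 (Sum.inl c) ^ 2 / (S x').1 (Sum.inl c) * e +
      2 * (C * rho S (prepend c x) (prepend c x') ^ κ)) (prepend c x) (prepend c x') := by
  intro φ hφ t ht
  obtain ⟨ψ, h1, h2⟩ := H x x' h c
  have h3 := diffeosVar_close hkd (S _).2 (S _).2 hφ h2 hk t ht
  rw [derivChain_renorm (S x).2 h1.1 c hk ht] at h3
  have h4 := hf ψ h1 _ (zoom_mem (leftEnd_nonneg (S x).2 c) (simp_pos (S x).2 (Sum.inl c)).le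
    (rightEnd_le_one (S x).2 c) ht)
  have h5 : |zoomChain (leftEnd (S x).1 c) ((S x).1 (Sum.inl c)) (leftEnd (S x').1 c)
      ((S x').1 (Sum.inl c)) (derivChain ψ) 2 t| ≤
      (S x).1 (Sum.inl c) ^ 2 / (S x').1 (Sum.inl c) * e := by
    simp only [zoomChain, OfNat.ofNat_ne_zero, if_false, sub_zero, abs_mul]
    have h6 := simp_pos (S x).2 (Sum.inl c)
    have h7 := simp_pos (S x').2 (Sum.inl c)
    rw [abs_of_pos (by positivity)]
    exact mul_le_mul_of_nonneg_left h4 (by positivity)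
  have h6 := abs_add_le (derivChain φ 2 t - zoomChain (leftEnd (S x).1 c)
    ((S x).1 (Sum.inl c)) (leftEnd (S x').1 c) ((S x').1 (Sum.inl c)) (derivChain ψ) 2 t)
    (zoomChain (leftEnd (S x).1 c) ((S x).1 (Sum.inl c)) (leftEnd (S x').1 c)
    ((S x').1 (Sum.inl c)) (derivChain ψ) 2 t)
  rw [sub_add_cancel] at h6
  linarith

/-- The factors `s ^ 2 / s'` multiply up to `Pr S l v ^ 2 / Pr S l v'`. The accumulated errors are
estimated by the crude factor `1 / δ` per letter, which is harmless because the lemma is applied to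
words `l` of one fixed length. -/
theorem TameCondition.flat_app (H : TameCondition S k C κ) (hk : 2 ≤ k) (hkd : k < 2 * d)
    {δ : ℝ} (hδ : 0 < δ) (hS : ∀ x c, δ ≤ (S x).1 c) {v v' : Word d} (h : v ≠ v') {e r : ℝ}
    (hr : ∀ l : List (Fin d), C * rho S (app l v) (app l v') ^ κ ≤ r)
    (hf : Flat S k C κ e v v') (l : List (Fin d)) :
    Flat S k C κ (e * (Pr S l v ^ 2 / Pr S l v') +
      2 * r * ∑ t ∈ Finset.range l.length, (1 / δ) ^ t) (app l v) (app l v') := by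
  induction l with
  | nil => simpa [Pr] using hf
  | cons c l ih =>
    refine (H.flat_prepend hk hkd (fun e => h (app_injective l e)) ih c).mono ?_
    have hr0 := hr (c :: l)
    rw [List.length_cons, geom_sum_succ]
    simp only [Pr, app_cons] at hr0 ⊢
    set s := (S (app l v)).1 (Sum.inl c)
    set s' := (S (app l v')).1 (Sum.inl c)
    have hs : 0 < s := simp_pos (S _).2 _
    have hs' : δ ≤ s' := hS _ _
    have hs1 : s ≤ 1 := ((S (app l v)).2.1 _).2.le
    have hP := Pr_pos S l v'
    have hq : s ^ 2 / s' ≤ 1 / δ :=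
      div_le_div₀ zero_le_one (pow_le_one₀ hs.le hs1) hδ hs'
    have hs'0 : 0 < s' := hδ.trans_le hs'
    have hr' : 0 ≤ r := by
      obtain ⟨ψ, hψ⟩ := H.exists_tame (by omega) (fun e => h (app_injective l e) :
        app l v ≠ app l v')
      have := (diffeosVar_osc hψ 0 (by simp) 0 (by simp)).trans (hr l)
      simpa using this
    have e1 : s ^ 2 / s' * (e * (Pr S l v ^ 2 / Pr S l v')) =
        e * ((s * Pr S l v) ^ 2 / (s' * Pr S l v')) := by
      field_simp
    have hG : 0 ≤ ∑ t ∈ Finset.range l.length, (1 / δ) ^ t :=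
      Finset.sum_nonneg fun _ _ => by positivity
    have e2 : s ^ 2 / s' * (2 * r * ∑ t ∈ Finset.range l.length, (1 / δ) ^ t) ≤
        1 / δ * (2 * r * ∑ t ∈ Finset.range l.length, (1 / δ) ^ t) :=
      mul_le_mul_of_nonneg_right hq (by positivity)
    calc _ = s ^ 2 / s' * (e * (Pr S l v ^ 2 / Pr S l v')) +
          s ^ 2 / s' * (2 * r * ∑ t ∈ Finset.range l.length, (1 / δ) ^ t) +
          2 * (C * rho S (prepend c (app l v)) (prepend c (app l v')) ^ κ) := by ring
      _ ≤ e * ((s * Pr S l v) ^ 2 / (s' * Pr S l v')) +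
          1 / δ * (2 * r * ∑ t ∈ Finset.range l.length, (1 / δ) ^ t) + 2 * r := by
        rw [e1]; linarith
      _ = _ := by ring

theorem rho_rpow_le {t : ℝ} (ht : ∀ x c, (S x).1 c ≤ t) (hκ : 0 ≤ κ) (l : List (Fin d))
    {v v' : Word d} (h : v ≠ v') : rho S (app l v) (app l v') ^ κ ≤ (t ^ κ) ^ l.length := by
  have ht0 : 0 ≤ t := (simp_pos (S v).2 (Sum.inl (v 0))).le.trans (ht v _)
  rw [Real.rpow_pow_comm ht0]
  refine Real.rpow_le_rpow (rho_pos S fun e => h (app_injective l e)).le ?_ hκ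
  exact rho_app_le S l h fun w => Pr_le_pow S ht l w

theorem Flat.coord_close (H : TameCondition S k C κ) (hk : 2 ≤ k) (hd : 0 < d) {e : ℝ}
    {x x' : Word d} (h : x ≠ x') (hf : Flat S k C κ e x x') (c : Coord d) :
    |(S x').1 c - (S x).1 c| ≤ e * (S x).1 c := by
  obtain ⟨ψ, hψ⟩ := H.exists_tame hd h
  refine CantorScaling.coord_close hd (S x).2 (S x').2 (by omega) hψ.1 (fun t ht u hu => ?_) c
  have he : 0 ≤ e := (abs_nonneg _).trans (hf ψ hψ 0 (by simp))
  exact ((diffeos_chain hψ.1).abs_sub_le (m := 1) (by omega) (hf ψ hψ) hu ht).trans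
    (mul_le_of_le_one_right he (abs_sub_le_one ht hu))

/-- Once the second derivatives are at most `η`, corresponding lengths satisfy `s' ≥ (1 - η) * s`,
so the factor `s ^ 2 / s'` is at most `t / (1 - η) ≤ q`. The condition `hr'` leaves enough room
below `μ` to absorb the new error at each letter, so the estimate propagates to words of any length.
-/
theorem TameCondition.flat_decay (H : TameCondition S k C κ) (hk : 2 ≤ k) (hkd : k < 2 * d)
    {t q η r μ : ℝ} (ht : ∀ x c, (S x).1 c ≤ t) (hη : 0 ≤ η) (hη1 : η < 1)
    (hq : t ≤ q * (1 - η)) {v v' : Word d} (h : v ≠ v') (hμ0 : 0 ≤ μ) (hμ1 : μ ≤ 1)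
    (hr : ∀ l : List (Fin d), 2 * (C * rho S (app l v) (app l v') ^ κ) ≤ r * μ ^ l.length)
    (hr' : q * η + r ≤ η * μ)
    (hf : Flat S k C κ η v v') (l : List (Fin d)) :
    Flat S k C κ (η * μ ^ l.length) (app l v) (app l v') := by
  induction l with
  | nil => simpa using hf
  | cons c l ih =>
    have hne : app l v ≠ app l v' := fun e => h (app_injective l e)
    refine (H.flat_prepend hk hkd hne ih c).mono ?_
    have hcl := Flat.coord_close H hk (by omega) hne ih (Sum.inl c)
    have hr0 := hr (c :: l)
    simp only [app_cons, List.length_cons] at hr0 ⊢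
    set s := (S (app l v)).1 (Sum.inl c)
    set s' := (S (app l v')).1 (Sum.inl c)
    have hs : 0 < s := simp_pos (S _).2 _
    have hs' : 0 < s' := simp_pos (S _).2 _
    have hst : s ≤ t := ht _ _
    have hM : 0 ≤ μ ^ l.length := by positivity
    have hM1 : μ ^ l.length ≤ 1 := pow_le_one₀ hμ0 hμ1
    have h1 : (1 - η) * s ≤ s' := by
      have h2 : η * μ ^ l.length * s ≤ η * s :=
        mul_le_mul_of_nonneg_right (mul_le_of_le_one_right hη hM1) hs.le
      rw [abs_le] at hcl
      linarith [hcl.1]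
    have hq0 : 0 ≤ q := by
      by_contra! hq0
      nlinarith
    have h3 : s ^ 2 / s' ≤ q := by
      rw [div_le_iff₀ hs']
      calc s ^ 2 ≤ t * s := by nlinarith
        _ ≤ q * (1 - η) * s := by gcongr
        _ ≤ q * s' := by nlinarith
    have hr1 : 0 ≤ r := by
      obtain ⟨ψ, hψ⟩ := H.exists_tame (by omega) h
      have := diffeosVar_osc hψ 0 (by simp) 0 (by simp)
      have h5 := hr []
      simp at this h5
      linarith
    have h4 : r * μ ^ (l.length + 1) ≤ r * μ ^ l.length := by
      rw [pow_succ, ← mul_assoc]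
      exact mul_le_of_le_one_right (by positivity) hμ1
    calc _ ≤ q * (η * μ ^ l.length) + r * μ ^ l.length := by
          refine add_le_add (mul_le_mul_of_nonneg_right h3 (by positivity)) (hr0.trans h4)
      _ = (q * η + r) * μ ^ l.length := by ring
      _ ≤ η * μ * μ ^ l.length := by gcongr
      _ = _ := by ring

end CantorScaling

/-! ### Decay of the scaling differences, distortion and approximating polynomials -/

namespace CantorScaling

variable {d k : ℕ} {C κ : ℝ} {S : Word d → simp d}

theorem coord_dist_le_one (x x' : Word d) (c : Coord d) : |(S x).1 c - (S x').1 c| ≤ 1 := by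
  have h1 := (S x).2.1 c
  have h2 := (S x').2.1 c
  rw [abs_le]; constructor <;> linarith [h1.1, h1.2, h2.1, h2.2]

/-- For `k ≥ 2` the condition bounds only the `k`-th derivative directly, and the factor `s ^ 2 /
s'` may exceed `1`. The remedy is to split the common word as `l₂ l₁ l₀`, read from the right. The
letters of `l₀` make `rho`, hence the errors, small. Along `l₁` the total factor `Pr v ^ 2 / Pr v'`
is at most `Pr v ≤ t ^ m` provided `Pr v ≤ Pr v'`, which may be arranged by exchanging the two
words. The second derivatives are then small enough for `flat_decay` along `l₂`. -/
theorem TameCondition.exists_decay_of_two_le (H : TameCondition S k C κ) (hd : 2 ≤ d)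
    (hk : 2 ≤ k) (hkd : k < 2 * d) (hκ : 0 < κ) :
    ∃ K μ : ℝ, 0 < μ ∧ μ < 1 ∧ ∀ (l : List (Fin d)) (v v' : Word d) (c : Coord d),
      |(S (app l v)).1 c - (S (app l v')).1 c| ≤ K * μ ^ l.length := by
  have hC := H.pos hd
  obtain ⟨δ, hδ, hS⟩ := H.exists_lower_bound hd (by omega) hκ.le
  obtain ⟨E, hE1, hE⟩ := exists_tame_bound k hC.le hκ.le S
  obtain ⟨t, htdef⟩ : ∃ t, t = 1 - δ := ⟨_, rfl⟩
  have ht : ∀ x c, (S x).1 c ≤ t := fun x c => htdef ▸ simp_le_one_sub hd (S x).2 (hS x) c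
  let x₀ : Word d := fun _ => ⟨0, by omega⟩
  have ht0 : 0 < t := (simp_pos (S x₀).2 (Sum.inl (x₀ 0))).trans_le (ht _ _)
  have ht1 : t < 1 := by linarith
  -- Chosen so that `q < 1` and `q * (1 - η) = t`. The rate `μ` below exceeds `q` by at least `(1 -
  -- q) / 2`, the margin for the errors.
  obtain ⟨q, hq⟩ : ∃ q, q = (1 + t) / 2 := ⟨_, rfl⟩
  obtain ⟨η, hη⟩ : ∃ η, η = (1 - t) / (1 + t) := ⟨_, rfl⟩
  have hη0 : 0 < η := by rw [hη]; exact div_pos (by linarith) (by linarith)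
  have hη1 : η < 1 := by rw [hη, div_lt_one (by linarith)]; linarith
  have htq : t ≤ q * (1 - η) := by
    apply le_of_eq
    rw [hq, hη]; field_simp; ring
  obtain ⟨ν, hν⟩ : ∃ ν, ν = t ^ κ := ⟨_, rfl⟩
  have hν0 : 0 < ν := hν ▸ Real.rpow_pos_of_pos ht0 _
  have hν1 : ν < 1 := hν ▸ Real.rpow_lt_one ht0.le ht1 hκ
  obtain ⟨μ, hμ⟩ : ∃ μ, μ = max ((1 + q) / 2) ν := ⟨_, rfl⟩
  have hqμ : (1 + q) / 2 ≤ μ := hμ ▸ le_max_left _ _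
  have hνμ : ν ≤ μ := hμ ▸ le_max_right _ _
  have hμ0 : 0 < μ := hν0.trans_le hνμ
  have hμ1 : μ < 1 := by rw [hμ]; exact max_lt (by linarith) hν1
  have hE0 : 0 < E := by linarith
  -- With `m` letters the initial bound `E` on second derivatives shrinks below `η / 2`. Only then
  -- is `n` chosen, so large that the errors accumulated over these `m` letters stay below `η / 2`
  -- and each later error fits into the margin.
  obtain ⟨m, hm⟩ := exists_pow_lt_of_lt_one (show 0 < η / 2 / E by positivity) ht1
  rw [lt_div_iff₀ hE0] at hm
  obtain ⟨G, hG⟩ : ∃ G, G = ∑ i ∈ Finset.range m, (1 / δ) ^ i := ⟨_, rfl⟩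
  have hG0 : 0 ≤ G := hG ▸ Finset.sum_nonneg fun _ _ => by positivity
  have hq1 : 0 < 1 - q := by linarith
  obtain ⟨n, hn⟩ := exists_pow_lt_of_lt_one
    (show 0 < η / (4 * C * G + 4 * C / (1 - q) + 1) by positivity) hν1
  rw [lt_div_iff₀ (by positivity)] at hn
  have hνn : 0 < ν ^ n := by positivity
  have hn1 : 2 * (C * ν ^ n) * G ≤ η / 2 := by
    have : 0 ≤ ν ^ n * (4 * C / (1 - q) + 1) := by positivity
    nlinarith
  have hn2 : 2 * (C * ν ^ n) ≤ η * ((1 - q) / 2) := by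
    have h1 : 0 ≤ ν ^ n * (4 * C * G + 1) := by positivity
    have h2 : ν ^ n * (4 * C / (1 - q)) ≤ η := by nlinarith
    rw [mul_div_assoc', div_le_iff₀ hq1] at h2
    linarith
  have aux : ∀ v v' : Word d, v ≠ v' → ∀ l₀ l₁ l₂ : List (Fin d), l₀.length = n →
      l₁.length = m → Pr S l₁ (app l₀ v) ≤ Pr S l₁ (app l₀ v') → ∀ c : Coord d,
      |(S (app l₂ (app l₁ (app l₀ v')))).1 c - (S (app l₂ (app l₁ (app l₀ v)))).1 c| ≤
        η * μ ^ l₂.length := by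
    intro v v' h l₀ l₁ l₂ h0 h1 hP c
    have hne : ∀ l, app l v ≠ app l v' := fun l e => h (app_injective l e)
    have hr : ∀ l : List (Fin d), C * rho S (app l v) (app l v') ^ κ ≤ C * ν ^ l.length :=
      fun l => mul_le_mul_of_nonneg_left (hν ▸ rho_rpow_le ht hκ.le l h) hC.le
    have f0 : Flat S k C κ E (app l₀ v) (app l₀ v') := fun φ hφ t ht =>
      hE _ _ (hne l₀) φ hφ 2 hk t ht
    have f1 := H.flat_app hk hkd hδ hS (hne l₀) (r := C * ν ^ n) (fun l => by
      rw [← app_append, ← app_append]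
      refine (hr _).trans (mul_le_mul_of_nonneg_left ?_ hC.le)
      exact pow_le_pow_of_le_one hν0.le hν1.le (by simp [h0])) f0 l₁
    have f2 : Flat S k C κ η (app l₁ (app l₀ v)) (app l₁ (app l₀ v')) := by
      refine f1.mono ?_
      rw [h1, ← hG]
      have hP1 := Pr_pos S l₁ (app l₀ v)
      have hP2 := Pr_pos S l₁ (app l₀ v')
      have : Pr S l₁ (app l₀ v) ^ 2 / Pr S l₁ (app l₀ v') ≤ t ^ m := by
        rw [div_le_iff₀ hP2, sq]
        refine mul_le_mul ?_ hP hP1.le (by positivity)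
        rw [← h1]
        exact Pr_le_pow S (fun x c => ht x _) l₁ _
      have := mul_le_mul_of_nonneg_left this hE0.le
      linarith
    have f3 := H.flat_decay hk hkd (r := 2 * (C * ν ^ n)) (μ := μ) ht hη0.le hη1 htq
      (fun e => hne l₀ (app_injective l₁ e)) hμ0.le hμ1.le (fun l => by
        rw [← app_append, ← app_append, ← app_append, ← app_append, mul_assoc]
        refine mul_le_mul_of_nonneg_left ((hr _).trans ?_) zero_le_two
        rw [mul_assoc]
        refine mul_le_mul_of_nonneg_left ?_ hC.le
        calc ν ^ (l ++ l₁ ++ l₀).length ≤ ν ^ (n + l.length) :=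
              pow_le_pow_of_le_one hν0.le hν1.le (by simp; omega)
          _ = ν ^ n * ν ^ l.length := pow_add _ _ _
          _ ≤ _ := by gcongr) (by nlinarith) f2 l₂
    have h4 := f3.coord_close H hk (by omega) (fun e => hne l₀ (app_injective l₁
      (app_injective l₂ e))) c
    refine h4.trans (mul_le_of_le_one_right (by positivity) ((S _).2.1 c).2.le)
  -- The constant pays for the `n + m` letters used before the decay sets in; for shorter words the
  -- asserted bound is at least `1`, hence trivial.
  refine ⟨(1 / μ) ^ (n + m), μ, hμ0, hμ1, fun l v v' c => ?_⟩
  by_cases hvv : v = v'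
  · subst hvv; simp; positivity
  rcases le_or_gt (n + m) l.length with hl | hl
  · have hpow : (1 / μ) ^ (n + m) * μ ^ l.length = μ ^ (l.length - (n + m)) := by
      rw [show μ ^ l.length = μ ^ (n + m) * μ ^ (l.length - (n + m)) by
        rw [← pow_add]; congr 1; omega, ← mul_assoc, ← mul_pow, one_div,
        inv_mul_cancel₀ hμ0.ne', one_pow, one_mul]
    set l₂ := l.take (l.length - (n + m)) with hl2
    set l₁ := (l.drop (l.length - (n + m))).take m with hl1
    set l₀ := (l.drop (l.length - (n + m))).drop m with hl0
    have e2 : l₂.length = l.length - (n + m) := by simp [hl2]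
    have e1 : l₁.length = m := by simp [hl1]; omega
    have e0 : l₀.length = n := by simp [hl0]; omega
    have el : ∀ v, app l v = app l₂ (app l₁ (app l₀ v)) := fun v => by
      rw [← app_append, ← app_append, hl2, hl1, hl0, List.append_assoc, List.take_append_drop,
        List.take_append_drop]
    rw [hpow, ← e2, el, el]
    have hw : η * μ ^ l₂.length ≤ μ ^ l₂.length := mul_le_of_le_one_left (by positivity) hη1.le
    rcases le_total (Pr S l₁ (app l₀ v)) (Pr S l₁ (app l₀ v')) with hP | hP
    · rw [abs_sub_comm]
      exact (aux v v' hvv l₀ l₁ l₂ e0 e1 hP c).trans hw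
    · exact (aux v' v (Ne.symm hvv) l₀ l₁ l₂ e0 e1 hP c).trans hw
  · refine (coord_dist_le_one _ _ c).trans ?_
    calc (1 : ℝ) = (1 / μ) ^ (n + m) * μ ^ (n + m) := by
          rw [← mul_pow, one_div, inv_mul_cancel₀ hμ0.ne', one_pow]
      _ ≤ _ := mul_le_mul_of_nonneg_left (pow_le_pow_of_le_one hμ0.le hμ1.le hl.le) (by positivity)

/-- For `k = 1` no iteration is needed: the oscillation of the first derivative is itself bounded by
`C * rho ^ κ`, which is exponentially small. -/
theorem TameCondition.exists_decay (H : TameCondition S k C κ) (hd : 2 ≤ d)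
    (hk : 1 ≤ k) (hkd : k < 2 * d) (hκ : 0 < κ) :
    ∃ K μ : ℝ, 0 < μ ∧ μ < 1 ∧ ∀ (l : List (Fin d)) (v v' : Word d) (c : Coord d),
      |(S (app l v)).1 c - (S (app l v')).1 c| ≤ K * μ ^ l.length := by
  rcases hk.lt_or_eq with hk | rfl
  · exact H.exists_decay_of_two_le hd hk hkd hκ
  have hC := H.pos hd
  obtain ⟨δ, hδ, hS⟩ := H.exists_lower_bound hd le_rfl hκ.le
  have ht : ∀ x c, (S x).1 c ≤ 1 - δ := fun x c => simp_le_one_sub hd (S x).2 (hS x) c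
  let x₀ : Word d := fun _ => ⟨0, by omega⟩
  have ht0 : 0 < 1 - δ := (simp_pos (S x₀).2 (Sum.inl (x₀ 0))).trans_le (ht _ _)
  refine ⟨C, (1 - δ) ^ κ, Real.rpow_pos_of_pos ht0 _, Real.rpow_lt_one ht0.le (by linarith) hκ,
    fun l v v' c => ?_⟩
  by_cases hvv : v = v'
  · subst hvv; simp; positivity
  have hne : app l v' ≠ app l v := fun e => hvv (app_injective l e).symm
  obtain ⟨ψ, hψ⟩ := H.exists_tame (by omega) hne
  have h1 := CantorScaling.coord_close (by omega) (S _).2 (S _).2 le_rfl hψ.1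
    (diffeosVar_osc hψ) c
  have h2 := rho_rpow_le ht hκ.le l (Ne.symm hvv)
  have h3 : 0 ≤ rho S (app l v') (app l v) ^ κ := Real.rpow_nonneg (rho_pos S hne).le _
  exact (h1.trans (mul_le_of_le_one_right (by positivity) ((S _).2.1 c).2.le)).trans
    (mul_le_mul_of_nonneg_left h2 hC.le)

theorem sum_pow_le {μ : ℝ} (hμ0 : 0 ≤ μ) (hμ1 : μ < 1) (n : ℕ) :
    ∑ t ∈ Finset.range n, μ ^ t ≤ (1 - μ)⁻¹ := by
  rw [← tsum_geometric_of_lt_one hμ0 hμ1]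
  exact (summable_geometric_of_lt_one hμ0 hμ1).sum_le_tsum _ fun _ _ => by positivity

/-- Exponential closeness of the ratios implies bounded distortion. -/
theorem exists_distortion {δ K μ : ℝ} (hδ : 0 < δ) (hS : ∀ x c, δ ≤ (S x).1 c) (hμ0 : 0 < μ)
    (hμ1 : μ < 1) (hK : ∀ (l : List (Fin d)) (v v' : Word d) (c : Coord d),
      |(S (app l v)).1 c - (S (app l v')).1 c| ≤ K * μ ^ l.length) :
    ∃ B, 1 ≤ B ∧ ∀ l w w', Pr S l w ≤ B * Pr S l w' := by
  rcases isEmpty_or_nonempty (Word d) with he | ⟨⟨w₀⟩⟩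
  · exact ⟨1, le_rfl, fun l w => he.elim w⟩
  have hK0 : 0 ≤ K := by simpa using hK [] w₀ w₀ (Sum.inl (w₀ 0))
  -- Corresponding factors of the two products have ratio at most `1 + K / δ * μ ^ n`, hence at most
  -- its exponential, where `n` is the number of letters that follow.
  have key : ∀ l w w', Pr S l w ≤
      Real.exp (K / δ * ∑ t ∈ Finset.range l.length, μ ^ t) * Pr S l w' := by
    intro l w w'
    induction l with
    | nil => simp [Pr]
    | cons c l ih =>
      simp only [Pr, List.length_cons]
      rw [Finset.sum_range_succ, mul_add, Real.exp_add]
      have h1 := hK l w w' (Sum.inl c)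
      have h2 := hS (app l w') (Sum.inl c)
      have hP := Pr_pos S l w
      have hP' := Pr_pos S l w'
      have h3 : (S (app l w)).1 (Sum.inl c) ≤
          Real.exp (K / δ * μ ^ l.length) * (S (app l w')).1 (Sum.inl c) := by
        have h4 := Real.add_one_le_exp (K / δ * μ ^ l.length)
        have h5 : K * μ ^ l.length ≤ K / δ * μ ^ l.length * (S (app l w')).1 (Sum.inl c) := by
          calc K * μ ^ l.length = K / δ * μ ^ l.length * δ := by field_simp
            _ ≤ _ := by gcongr
        have h6 := mul_le_mul_of_nonneg_right h4 (hδ.le.trans h2)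
        rw [abs_le] at h1
        linarith [h1.2]
      calc _ ≤ (Real.exp (K / δ * μ ^ l.length) * (S (app l w')).1 (Sum.inl c)) *
            (Real.exp (K / δ * ∑ t ∈ Finset.range l.length, μ ^ t) * Pr S l w') :=
            mul_le_mul h3 ih hP.le (by have := hδ.le.trans h2; positivity)
        _ = _ := by ring
  refine ⟨Real.exp (K / δ * (1 - μ)⁻¹), Real.one_le_exp (by
    have : 0 < 1 - μ := by linarith
    positivity), fun l w w' => (key l w w').trans ?_⟩
  gcongr
  · exact (Pr_pos S l w').le
  · exact sum_pow_le hμ0.le hμ1 _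

theorem zoomChain_sub (a s a' s' : ℝ) (f g : ℕ → ℝ → ℝ) (m : ℕ) (t : ℝ) :
    zoomChain a s a' s' f m t - zoomChain a s a' s' g m t =
      s ^ m / s' * (f m (a + s * t) - g m (a + s * t)) := by
  simp only [zoomChain]; ring

/-- Polynomials of degree at most `k` that are almost invariant under renormalization. -/
theorem TameCondition.exists_polynomials (H : TameCondition S k C κ) (hd : 2 ≤ d)
    (hk : 1 ≤ k) (hkd : k < 2 * d) (hκ : 0 < κ) :
    ∃ (Q : Word d → Word d → Polynomial ℝ) (B : ℝ), 0 ≤ B ∧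
      (∀ x x', (Q x x').natDegree ≤ k) ∧
      ∀ x x', x ≠ x' → ∀ m ≤ k, ∀ t ∈ UI,
        |polyChain (Q x x') m t| ≤ B ∧ ∀ c : Fin d,
          |polyChain (Q (prepend c x) (prepend c x')) m t -
            zoomChain (leftEnd (S x).1 c) ((S x).1 (Sum.inl c)) (leftEnd (S x').1 c)
              ((S x').1 (Sum.inl c)) (polyChain (Q x x')) m t| ≤
            B * rho S (prepend c x) (prepend c x') ^ κ := by
  classical
  have hC := H.pos hd
  obtain ⟨δ, hδ, hS⟩ := H.exists_lower_bound hd hk hκ.le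
  obtain ⟨E, hE1, hE⟩ := exists_tame_bound k hC.le hκ.le S
  choose! φ hφ using fun x x' (h : x ≠ x') => H.exists_tame (x := x) (x' := x') (by omega) h
  -- Tame maps live only on `[0,1]`. Their Taylor polynomials at `0` are equally good approximants,
  -- are defined on the whole line, and coincide with their own jets of order `k`.
  let Q : Word d → Word d → Polynomial ℝ := fun x x' => taylorPoly k (derivChain (φ x x'))
  have hQ : ∀ x x', x ≠ x' → ∀ m ≤ k, ∀ t ∈ UI,
      |derivChain (φ x x') m t - polyChain (Q x x') m t| ≤ C * rho S x x' ^ κ :=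
    fun x x' h m hm t ht => (diffeos_chain (hφ x x' h).1).taylor_close
      (diffeosVar_osc (hφ x x' h)) hm t ht
  -- At each of the two levels one error comes from the Taylor polynomial and two from exchanging
  -- tame maps. The parent-level errors are magnified by at most `1 / δ`, and a further `(1 / δ) ^
  -- κ` passes from the parent value of `rho` to that of the child.
  obtain ⟨D, hD⟩ : ∃ D, D = 3 * C * (1 / δ) * (1 / δ) ^ κ + 3 * C := ⟨_, rfl⟩
  have hD0 : 0 ≤ D := by rw [hD]; positivity
  refine ⟨Q, D + E + C, by positivity, fun x x' => natDegree_taylorPoly _ _,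
    fun x x' h m hm t ht => ⟨?_, fun c => ?_⟩⟩
  · have h1 := hQ x x' h m hm t ht
    have h2 := hE x x' h _ (hφ x x' h) m hm t ht
    have h3 := mul_le_of_le_one_right hC.le (rho_rpow_le_one (S := S) hκ.le h)
    rw [abs_le] at h1 h2 ⊢
    constructor <;> linarith
  · have hne := prepend_ne h c
    obtain ⟨ψ, h1, h2⟩ := H x x' h c
    have hs := simp_pos (S x).2 (Sum.inl c)
    have hs' := hS x' (Sum.inl c)
    set y := leftEnd (S x).1 c + (S x).1 (Sum.inl c) * t
    have hy : y ∈ UI := zoom_mem (leftEnd_nonneg (S x).2 c) hs.le (rightEnd_le_one (S x).2 c) ht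
    have e1 := hQ _ _ hne m hm t ht
    have e2 := diffeosVar_close hkd (S _).2 (S _).2 (hφ _ _ hne) h2 hm t ht
    rw [derivChain_renorm (S x).2 h1.1 c hm ht] at e2
    have e3 := diffeosVar_close hkd (S _).2 (S _).2 (hφ _ _ h) h1 hm y hy
    have e4 := hQ x x' h m hm y hy
    have e5 : |polyChain (Q x x') m y - derivChain ψ m y| ≤ 3 * (C * rho S x x' ^ κ) := by
      rw [abs_le] at e3 e4 ⊢
      constructor <;> linarith
    have e6 := zoomChain_sub (leftEnd (S x).1 c) ((S x).1 (Sum.inl c)) (leftEnd (S x').1 c)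
      ((S x').1 (Sum.inl c)) (polyChain (Q x x')) (derivChain ψ) m t
    have hfac : |(S x).1 (Sum.inl c) ^ m / (S x').1 (Sum.inl c)| ≤ 1 / δ := by
      rw [abs_of_nonneg (div_nonneg (pow_nonneg hs.le _) (hδ.le.trans hs'))]
      exact div_le_div₀ zero_le_one (pow_le_one₀ hs.le ((S x).2.1 _).2.le) hδ hs'
    have hρ : rho S x x' ^ κ ≤ (1 / δ) ^ κ * rho S (prepend c x) (prepend c x') ^ κ := by
      rw [← Real.mul_rpow (by positivity) (rho_pos S hne).le]
      refine Real.rpow_le_rpow (rho_pos S h).le ?_ hκ.le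
      have := rho_prepend S hS h c
      rw [one_div, ← div_eq_inv_mul, le_div_iff₀ hδ]
      linarith
    set R := rho S (prepend c x) (prepend c x') ^ κ
    have hR : 0 ≤ R := Real.rpow_nonneg (rho_pos S hne).le _
    have e7 : |zoomChain (leftEnd (S x).1 c) ((S x).1 (Sum.inl c)) (leftEnd (S x').1 c)
        ((S x').1 (Sum.inl c)) (polyChain (Q x x')) m t - zoomChain (leftEnd (S x).1 c)
        ((S x).1 (Sum.inl c)) (leftEnd (S x').1 c) ((S x').1 (Sum.inl c)) (derivChain ψ) m t| ≤
        1 / δ * (3 * (C * ((1 / δ) ^ κ * R))) := by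
      rw [e6, abs_mul]
      exact mul_le_mul hfac (e5.trans (by gcongr)) (abs_nonneg _) (by positivity)
    have e8 : (D + E + C) * R = 1 / δ * (3 * (C * ((1 / δ) ^ κ * R))) + 3 * (C * R) +
      (E + C) * R := by rw [hD]; ring
    have e9 : 0 ≤ (E + C) * R := by positivity
    rw [abs_le] at e1 e2 e7 ⊢
    constructor <;> linarith

end CantorScaling

/-! ### Cantor sets with prescribed ratio geometries -/

namespace CantorScaling

section Construction

variable {d : ℕ}

/-- The first `n` letters of `α` in reversed order. -/
def pre (α : Word d) : ℕ → List (Fin d)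
  | 0 => []
  | n + 1 => α n :: pre α n

@[simp] theorem pre_length (α : Word d) (n : ℕ) : (pre α n).length = n := by
  induction n with
  | zero => rfl
  | succ n ih => simp [pre, ih]

theorem pre_congr {α β : Word d} {n : ℕ} (h : ∀ i < n, α i = β i) : pre α n = pre β n := by
  induction n with
  | zero => rfl
  | succ n ih =>
    simp only [pre]
    rw [h n (by omega), ih fun i hi => h i (by omega)]

/-- Addresses are read from the finest level backwards: `c :: l` is a subinterval of `l`, whereas
the branch `i` sends the interval `l` to `l ++ [i]`. -/
theorem pre_prepend (c : Fin d) (α : Word d) (n : ℕ) :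
    pre (prepend c α) (n + 1) = pre α n ++ [c] := by
  induction n with
  | zero => rfl
  | succ n ih => rw [pre, ih]; rfl

/-- The infinite word whose first letters are those of `l` in reversed order. -/
def revApp : List (Fin d) → Word d → Word d
  | [], w => w
  | c :: l, w => revApp l (prepend c w)

theorem pre_revApp (l : List (Fin d)) (w : Word d) (n : ℕ) :
    pre (revApp l w) (l.length + n) = pre w n ++ l := by
  induction l generalizing w n with
  | nil => simp [revApp]
  | cons c l ih =>
    rw [List.length_cons, show l.length + 1 + n = l.length + (n + 1) by ring, revApp, ih,
      pre_prepend]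
    simp

theorem prepend_revApp (i : Fin d) (l : List (Fin d)) (w : Word d) :
    prepend i (revApp l w) = revApp (l ++ [i]) w := by
  induction l generalizing w with
  | nil => rfl
  | cons c l ih => simp only [revApp, List.cons_append]; exact ih _

theorem pre_eq_tk_iff {α j : Word d} {n : ℕ} :
    pre α n = tk j n ↔ ∀ i < n, α i = j (n - 1 - i) := by
  induction n generalizing j with
  | zero => simp [pre, tk]
  | succ n ih =>
    simp only [pre, tk, List.cons.injEq, ih]
    constructor
    · rintro ⟨h1, h2⟩ i hi
      rcases Nat.lt_succ_iff_lt_or_eq.1 hi with h | rfl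
      · rw [h2 i h]; congr 1; omega
      · rw [h1]; congr 1; omega
    · intro h
      refine ⟨by rw [h n (by omega)]; congr 1; omega, fun i hi => ?_⟩
      rw [h i (by omega)]; congr 1; omega

variable (T : List (Fin d) → Coord d → ℝ)

/-- Length of the interval with a given address. -/
def len : List (Fin d) → ℝ
  | [] => 1
  | c :: l => len l * T l (Sum.inl c)

/-- Left end point of the interval with a given address. -/
def lft : List (Fin d) → ℝ
  | [] => 0
  | c :: l => lft l + len T l * leftEnd (T l) c

/-- Right end point of the interval with a given address. -/
def rgt (l : List (Fin d)) : ℝ := lft T l + len T l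

/-- The point of the Cantor set with a given address. -/
noncomputable def cantorMap (α : Word d) : ℝ := ⨆ n, lft T (pre α n)

variable {T}

theorem rgt_cons (c : Fin d) (l : List (Fin d)) :
    rgt T (c :: l) = lft T l + len T l * rightEnd (T l) c := by
  simp only [rgt, lft, len, rightEnd]; ring

theorem lft_succ_sub_rgt (g : Fin (d - 1)) (l : List (Fin d)) :
    lft T (⟨g + 1, by omega⟩ :: l) - rgt T (⟨g, by omega⟩ :: l) =
      len T l * T l (Sum.inr g) := by
  rw [rgt_cons, lft, leftEnd_succ]; ring

variable (hT : ∀ l, T l ∈ simp d)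
include hT

theorem len_pos (l : List (Fin d)) : 0 < len T l := by
  induction l with
  | nil => exact one_pos
  | cons c l ih => exact mul_pos ih (simp_pos (hT l) _)

theorem lft_lt_rgt (l : List (Fin d)) : lft T l < rgt T l := lt_add_of_pos_right _ (len_pos hT l)

theorem lft_le_lft_cons (c : Fin d) (l : List (Fin d)) : lft T l ≤ lft T (c :: l) :=
  le_add_of_nonneg_right (mul_nonneg (len_pos hT l).le (leftEnd_nonneg (hT l) c))

theorem rgt_cons_le (c : Fin d) (l : List (Fin d)) : rgt T (c :: l) ≤ rgt T l := by
  rw [rgt_cons, rgt]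
  have := mul_le_of_le_one_right (len_pos hT l).le (rightEnd_le_one (hT l) c)
  linarith

theorem rgt_add_le {c c' : Fin d} (h : c < c') (l : List (Fin d)) :
    rgt T (c :: l) + len T l * T l (Sum.inr ⟨c, by omega⟩) ≤ lft T (c' :: l) := by
  rw [rgt_cons, lft]
  have := mul_le_mul_of_nonneg_left (rightEnd_add_le (hT l) h) (len_pos hT l).le
  linarith

theorem monotone_lft_pre (α : Word d) : Monotone fun n => lft T (pre α n) :=
  monotone_nat_of_le_succ fun n => lft_le_lft_cons hT (α n) (pre α n)

theorem antitone_rgt_pre (α : Word d) : Antitone fun n => rgt T (pre α n) :=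
  antitone_nat_of_succ_le fun n => rgt_cons_le hT (α n) (pre α n)

theorem lft_pre_le_rgt_pre (α : Word d) (m n : ℕ) : lft T (pre α m) ≤ rgt T (pre α n) :=
  ((monotone_lft_pre hT α (le_max_left m n)).trans (lft_lt_rgt hT _).le).trans
    (antitone_rgt_pre hT α (le_max_right m n))

theorem bddAbove_lft (α : Word d) : BddAbove (range fun n => lft T (pre α n)) :=
  ⟨rgt T (pre α 0), by rintro _ ⟨n, rfl⟩; exact lft_pre_le_rgt_pre hT α n 0⟩

theorem lft_le_cantorMap (α : Word d) (n : ℕ) : lft T (pre α n) ≤ cantorMap T α :=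
  le_ciSup (bddAbove_lft hT α) n

theorem cantorMap_le_rgt (α : Word d) (n : ℕ) : cantorMap T α ≤ rgt T (pre α n) :=
  ciSup_le fun m => lft_pre_le_rgt_pre hT α m n

theorem cantorMap_mem (α : Word d) : cantorMap T α ∈ UI := by
  have h1 := lft_le_cantorMap hT α 0
  have h2 := cantorMap_le_rgt hT α 0
  simp only [pre, rgt, lft, len, zero_add] at h1 h2
  exact ⟨h1, h2⟩

theorem tendsto_lft_pre (α : Word d) :
    Tendsto (fun n => lft T (pre α n)) atTop (𝓝 (cantorMap T α)) :=
  tendsto_atTop_ciSup (monotone_lft_pre hT α) (bddAbove_lft hT α)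

variable {t : ℝ} (ht : ∀ l c, T l c ≤ t) (ht1 : t < 1)
include ht

theorem len_cons_le (c : Fin d) (l : List (Fin d)) : len T (c :: l) ≤ t * len T l := by
  rw [len, mul_comm]; exact mul_le_mul_of_nonneg_right (ht _ _) (len_pos hT l).le

theorem len_le_pow (l : List (Fin d)) : len T l ≤ t ^ l.length := by
  induction l with
  | nil => simp [len]
  | cons c l ih =>
    have h0 : 0 ≤ t := (simp_pos (hT l) (Sum.inl c)).le.trans (ht _ _)
    rw [List.length_cons, pow_succ']
    exact (len_cons_le hT ht c l).trans (mul_le_mul_of_nonneg_left ih h0)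

include ht1

theorem tendsto_len_pre (α : Word d) : Tendsto (fun n => len T (pre α n)) atTop (𝓝 0) := by
  have h0 : 0 ≤ t := (simp_pos (hT []) (Sum.inl (α 0))).le.trans (ht _ _)
  refine squeeze_zero (fun n => (len_pos hT _).le) (fun n => len_le_pow hT ht _) ?_
  simpa using tendsto_pow_atTop_nhds_zero_of_lt_one h0 ht1

theorem tendsto_rgt_pre (α : Word d) :
    Tendsto (fun n => rgt T (pre α n)) atTop (𝓝 (cantorMap T α)) := by
  simpa [rgt] using (tendsto_lft_pre hT α).add (tendsto_len_pre hT ht ht1 α)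

omit ht ht1 in
-- The first subinterval starts at the left end of its parent, so the nested intervals all share the
-- left end point, which is thus a point of the Cantor set.
theorem cantorMap_revApp_zero (hd : 0 < d) (l : List (Fin d)) :
    cantorMap T (revApp l fun _ => ⟨0, hd⟩) = lft T l := by
  have h := (tendsto_lft_pre hT (revApp l fun _ => ⟨0, hd⟩)).comp
    (tendsto_add_atTop_nat l.length)
  refine tendsto_nhds_unique h (tendsto_const_nhds.congr fun n => ?_)
  simp only [Function.comp, add_comm n, pre_revApp]
  induction n with
  | zero => rfl
  | succ n ih => simp [pre, lft, leftEnd_zero, ← ih]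

theorem cantorMap_revApp_last (hd : 0 < d) (l : List (Fin d)) :
    cantorMap T (revApp l fun _ => ⟨d - 1, by omega⟩) = rgt T l := by
  have h := (tendsto_rgt_pre hT ht ht1 (revApp l fun _ => ⟨d - 1, by omega⟩)).comp
    (tendsto_add_atTop_nat l.length)
  refine tendsto_nhds_unique h (tendsto_const_nhds.congr fun n => ?_)
  simp only [Function.comp, add_comm n, pre_revApp]
  induction n with
  | zero => rfl
  | succ n ih =>
    simp only [pre, List.cons_append]
    rw [rgt_cons, rightEnd_last (hT _) _ (by simp; omega), mul_one, ih]; rfl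

omit ht ht1 in
-- Points that separate at level `m` have a gap of that level between them. With `cantorMap_dist_le`
-- and a lower bound on the ratios, their distance is comparable to the length of their last common
-- interval.
theorem cantorMap_sub_ge {α β : Word d} {m : ℕ} (h : ∀ i < m, α i = β i) (hm : α m < β m) :
    len T (pre α m) * T (pre α m) (Sum.inr ⟨α m, by omega⟩) ≤
      cantorMap T β - cantorMap T α := by
  have h1 := cantorMap_le_rgt hT α (m + 1)
  have h2 := lft_le_cantorMap hT β (m + 1)
  have h3 := rgt_add_le hT hm (pre α m)
  simp only [pre, ← pre_congr h] at h1 h2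
  linarith

omit ht ht1 in
theorem cantorMap_lt {α β : Word d} {m : ℕ} (h : ∀ i < m, α i = β i) (hm : α m < β m) :
    cantorMap T α < cantorMap T β :=
  sub_pos.1 ((mul_pos (len_pos hT _) (simp_pos (hT _) _)).trans_le (cantorMap_sub_ge hT h hm))

omit ht ht1 in
theorem cantorMap_dist_le {α β : Word d} {m : ℕ} (h : ∀ i < m, α i = β i) :
    |cantorMap T α - cantorMap T β| ≤ len T (pre α m) := by
  have h1 := cantorMap_le_rgt hT α m
  have h2 := lft_le_cantorMap hT β m
  have h3 := cantorMap_le_rgt hT β m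
  have h4 := lft_le_cantorMap hT α m
  simp only [rgt, ← pre_congr h] at h1 h2 h3
  rw [abs_le]; constructor <;> linarith

omit ht ht1 in
theorem cantorMap_injective : Function.Injective (cantorMap T) := by
  intro α β hαβ
  by_contra hne
  have h1 : ∀ i < PiNat.firstDiff α β, α i = β i := fun i hi => PiNat.apply_eq_of_lt_firstDiff hi
  rcases lt_or_gt_of_ne (PiNat.apply_firstDiff_ne hne) with h | h
  · exact (cantorMap_lt hT h1 h).ne hαβ
  · exact (cantorMap_lt hT (fun i hi => (h1 i hi).symm) h).ne hαβ.symm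

theorem cantorMap_continuous : Continuous (cantorMap T) := by
  rw [continuous_iff_continuousAt]
  intro α
  rw [ContinuousAt, Metric.tendsto_nhds]
  intro e he
  obtain ⟨n, hn⟩ := ((tendsto_len_pre hT ht ht1 α).eventually (gt_mem_nhds he)).exists
  have : ∀ᶠ β in 𝓝 α, ∀ i ∈ Finset.range n, β i = α i := by
    rw [Finset.eventually_all]
    intro i _
    have h := (continuous_apply (A := fun _ : ℕ => Fin d) i).continuousAt (x := α)
    have h5 : ∀ᶠ y in 𝓝 (α i), y = α i := by rw [nhds_discrete]; simp
    exact h.eventually h5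
  filter_upwards [this] with β hβ
  rw [dist_comm, Real.dist_eq]
  exact (cantorMap_dist_le hT fun i hi => (hβ i (Finset.mem_range.2 hi)).symm).trans_lt hn

theorem cantorMap_isOrderedEmbedding (hd : 0 < d) : IsOrderedEmbedding (cantorMap T) where
  isEmbedding := ((cantorMap_continuous hT ht ht1).isClosedEmbedding
    (cantorMap_injective hT)).isEmbedding
  order α β m h hm := by
    constructor
    · intro hlt
      by_contra hn
      exact (cantorMap_lt hT h (lt_of_le_of_ne (not_lt.1 hn) hm)).not_gt hlt
    · exact fun hlt => cantorMap_lt hT (fun i hi => (h i hi).symm) hlt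
  hull := by
    apply Subset.antisymm
    · refine convexHull_min ?_ (convex_Icc 0 1)
      rintro _ ⟨α, rfl⟩
      exact cantorMap_mem hT α
    · rw [← segment_eq_Icc zero_le_one]
      refine segment_subset_convexHull ?_ ?_
      · exact ⟨_, cantorMap_revApp_zero hT hd []⟩
      · exact ⟨_, (cantorMap_revApp_last hT ht ht1 hd []).trans (by simp [rgt, lft, len])⟩

omit ht ht1 in
theorem isLeast_cantorMap (hd : 0 < d) (l : List (Fin d)) :
    IsLeast (cantorMap T '' {α | pre α l.length = l}) (lft T l) := by
  refine ⟨⟨_, ?_, cantorMap_revApp_zero hT hd l⟩, ?_⟩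
  · exact pre_revApp l _ 0
  · rintro _ ⟨α, hα, rfl⟩
    have := lft_le_cantorMap hT α l.length
    rwa [show pre α l.length = l from hα] at this

theorem isGreatest_cantorMap (hd : 0 < d) (l : List (Fin d)) :
    IsGreatest (cantorMap T '' {α | pre α l.length = l}) (rgt T l) := by
  refine ⟨⟨_, ?_, cantorMap_revApp_last hT ht ht1 hd l⟩, ?_⟩
  · exact pre_revApp l _ 0
  · rintro _ ⟨α, hα, rfl⟩
    have := cantorMap_le_rgt hT α l.length
    rwa [show pre α l.length = l from hα] at this

omit hT ht ht1 in
theorem piece_eq (h : Word d → ℝ) (j : Word d) (n : ℕ) :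
    piece h j n = h '' {α | pre α (tk j n).length = tk j n} := by
  simp only [tk_length, pre_eq_tk_iff]; rfl

theorem levelScaling_cantorMap (hd : 0 < d) (j : Word d) (n : ℕ) :
    levelScaling (cantorMap T) j n = T (tk j n) := by
  have hI : ∀ j n, sInf (piece (cantorMap T) j n) = lft T (tk j n) := fun j n => by
    rw [piece_eq]; exact (isLeast_cantorMap hT hd _).csInf_eq
  have hS : ∀ j n, sSup (piece (cantorMap T) j n) = rgt T (tk j n) := fun j n => by
    rw [piece_eq]; exact (isGreatest_cantorMap hT ht ht1 hd _).csSup_eq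
  have htk : ∀ i, tk (prepend i j) (n + 1) = i :: tk j n := fun i => rfl
  have hne := (len_pos hT (tk j n)).ne'
  funext c
  rcases c with i | g
  · simp only [levelScaling, hullLength, hI, hS, htk]
    rw [rgt, rgt, add_sub_cancel_left, add_sub_cancel_left, len]
    field_simp
  · simp only [levelScaling, hullLength, hI, hS, htk]
    rw [lft_succ_sub_rgt, rgt, add_sub_cancel_left]
    field_simp

end Construction

end CantorScaling

/-! ### Extension of Whitney data from a closed subset to the line, and contraction. -/

/-! ### Jets and blending -/

namespace CantorScaling

/-- The jet at `y` of order `k`, differentiated `m` times and evaluated at `x`. -/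
noncomputable def jet (k : ℕ) (f : ℕ → ℝ → ℝ) (m : ℕ) (y x : ℝ) : ℝ :=
  ∑ r ∈ Finset.range (k + 1 - m), f (m + r) y * ((x - y) ^ r / r.factorial)

theorem jet_self {k m : ℕ} (f : ℕ → ℝ → ℝ) (hm : m ≤ k) (y : ℝ) : jet k f m y y = f m y := by
  unfold jet
  rw [show k + 1 - m = (k - m) + 1 by omega, Finset.sum_range_succ', Finset.sum_eq_zero]
  · simp
  · intro r _; simp

theorem jet_eq_zero {k m : ℕ} (f : ℕ → ℝ → ℝ) (hm : k < m) (y x : ℝ) : jet k f m y x = 0 := by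
  unfold jet
  rw [show k + 1 - m = 0 by omega]; simp

theorem jet_hasDerivAt (k : ℕ) (f : ℕ → ℝ → ℝ) (m : ℕ) (y x : ℝ) :
    HasDerivAt (jet k f m y) (jet k f (m + 1) y x) x := by
  rcases le_or_gt m k with hm | hm
  · have h : HasDerivAt (fun x => ∑ r ∈ Finset.range (k + 1 - m),
        f (m + r) y * ((x - y) ^ r / r.factorial))
        (∑ r ∈ Finset.range (k + 1 - m),
          f (m + r) y * ((r * (x - y) ^ (r - 1) * 1) / r.factorial)) x := by
      refine HasDerivAt.fun_sum fun r _ => ?_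
      exact ((((hasDerivAt_id x).sub_const y).pow r).div_const _).const_mul _
    refine h.congr_deriv ?_
    unfold jet
    rw [show k + 1 - m = (k + 1 - (m + 1)) + 1 by omega, Finset.sum_range_succ']
    simp only [Nat.cast_zero, zero_mul, zero_div, mul_zero, add_zero, mul_one]
    refine Finset.sum_congr rfl fun r _ => ?_
    rw [show m + (r + 1) = m + 1 + r by ring, Nat.factorial_succ]
    have : (r.factorial : ℝ) ≠ 0 := by exact_mod_cast r.factorial_ne_zero
    push_cast
    have : (r : ℝ) + 1 ≠ 0 := by positivity
    field_simp
  · have : jet k f m y = fun _ => 0 := funext fun x => jet_eq_zero f hm y x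
    rw [this, jet_eq_zero f (by omega)]
    exact hasDerivAt_const _ _

theorem jet_contDiff (k : ℕ) (f : ℕ → ℝ → ℝ) (m : ℕ) (y : ℝ) {n : WithTop ℕ∞} :
    ContDiff ℝ n (jet k f m y) := by
  unfold jet
  fun_prop

theorem iteratedDeriv_jet (k : ℕ) (f : ℕ → ℝ → ℝ) (m : ℕ) (y : ℝ) :
    iteratedDeriv m (jet k f 0 y) = jet k f m y := by
  induction m with
  | zero => simp
  | succ m ih =>
    rw [iteratedDeriv_succ, ih]
    exact funext fun x => (jet_hasDerivAt k f m y x).deriv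

/-- Global version of a chain of derivatives. -/
theorem contDiff_of_chain {k : ℕ} {G : ℕ → ℝ → ℝ}
    (hG : ∀ m < k, ∀ x, HasDerivAt (G m) (G (m + 1) x) x) (hc : Continuous (G k)) :
    ContDiff ℝ k (G 0) ∧ ∀ m ≤ k, iteratedDeriv m (G 0) = G m := by
  have h : ∀ m ≤ k, iteratedDeriv m (G 0) = G m := by
    intro m hm
    induction m with
    | zero => simp
    | succ m ih =>
      rw [iteratedDeriv_succ, ih (by omega)]
      exact funext fun x => (hG m (by omega) x).deriv
  refine ⟨contDiff_nat_iff_iteratedDeriv.2 ⟨fun m hm => ?_, fun m hm => ?_⟩, h⟩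
  · rw [h m hm]
    rcases hm.lt_or_eq with hm | rfl
    · exact continuous_iff_continuousAt.2 fun x => (hG m hm x).continuousAt
    · exact hc
  · rw [h m hm.le]
    exact fun x => (hG m hm x).differentiableAt

/-- The data `f 0, …, f k` on `K` satisfy Whitney's compatibility condition of class `C^{k+ε}`. -/
def WhitneyData (K : Set ℝ) (k : ℕ) (ε M : ℝ) (f : ℕ → ℝ → ℝ) : Prop :=
  ∀ x ∈ K, ∀ y ∈ K, ∀ m ≤ k, |f m x - jet k f m y x| ≤ M * |x - y| ^ ((k : ℝ) - m + ε)

theorem wexp_pos {k m : ℕ} {ε : ℝ} (hε : 0 < ε) (hm : m ≤ k) : 0 < (k : ℝ) - m + ε := by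
  have : (m : ℝ) ≤ k := by exact_mod_cast hm
  linarith

theorem mul_rpow_wexp_le {k m : ℕ} {ε c L : ℝ} (hc : 1 ≤ c) (hε1 : ε ≤ 1) (hL : 0 ≤ L) :
    (c * L) ^ ((k : ℝ) - m + ε) ≤ c ^ (k + 1) * L ^ ((k : ℝ) - m + ε) := by
  rw [Real.mul_rpow (by linarith) hL]
  refine mul_le_mul_of_nonneg_right ?_ (Real.rpow_nonneg hL _)
  rw [← Real.rpow_natCast c (k + 1)]
  refine Real.rpow_le_rpow_of_exponent_le hc ?_
  have : (0 : ℝ) ≤ m := by positivity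
  push_cast; linarith

/-- At the point `x` the difference of the two jets is exactly what the Whitney condition bounds,
for every order. Away from `x` one integrates the bound for the order `m + 1`, by descending
induction on `m`; each integration over a length at most `L` gains a factor `L`. -/
theorem WhitneyData.jet_close {K : Set ℝ} {k : ℕ} {ε M : ℝ} {f : ℕ → ℝ → ℝ}
    (hf : WhitneyData K k ε M f) (hM : 0 ≤ M) (hε : 0 < ε) (hε1 : ε ≤ 1) {x y : ℝ} (hx : x ∈ K)
    (hy : y ∈ K) {L : ℝ} (hL : 0 ≤ L) (hxy : |x - y| ≤ 2 * L) {m : ℕ} (hm : m ≤ k) :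
    ∀ z, |z - x| ≤ L → |jet k f m x z - jet k f m y z| ≤
      (k + 1) * (M * 2 ^ (k + 1)) * L ^ ((k : ℝ) - m + ε) := by
  have h0 : ∀ m ≤ k, |jet k f m x x - jet k f m y x| ≤
      M * 2 ^ (k + 1) * L ^ ((k : ℝ) - m + ε) := by
    intro m hm
    rw [jet_self f hm, mul_assoc]
    refine (hf x hx y hy m hm).trans (mul_le_mul_of_nonneg_left ?_ hM)
    exact (Real.rpow_le_rpow (abs_nonneg _) hxy (wexp_pos hε hm).le).trans
      (mul_rpow_wexp_le one_le_two hε1 hL)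
  have key : ∀ n, ∀ m ≤ k, k - m = n → ∀ z, |z - x| ≤ L → |jet k f m x z - jet k f m y z| ≤
      (n + 1) * (M * 2 ^ (k + 1)) * L ^ ((k : ℝ) - m + ε) := by
    intro n
    induction n with
    | zero =>
      intro m hm hn z hz
      obtain rfl : m = k := by omega
      have hc : ∀ y z, jet m f m y z = f m y := by
        intro y z
        unfold jet
        rw [show m + 1 - m = 1 by omega]
        simp
      have := h0 m le_rfl
      simp only [hc] at this ⊢
      simpa using this
    | succ n ih =>
      intro m hm hn z hz
      have ih := ih (m + 1) (by omega) (by omega)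
      have hd : ∀ w ∈ Icc (x - L) (x + L), HasDerivWithinAt
          (fun z => jet k f m x z - jet k f m y z)
          (jet k f (m + 1) x w - jet k f (m + 1) y w) (Icc (x - L) (x + L)) w := fun w _ =>
        ((jet_hasDerivAt k f m x w).sub (jet_hasDerivAt k f m y w)).hasDerivWithinAt
      have hb := Convex.norm_image_sub_le_of_norm_hasDerivWithin_le hd
        (C := (n + 1) * (M * 2 ^ (k + 1)) * L ^ ((k : ℝ) - (m + 1 : ℕ) + ε))
        (fun w hw => ih w (by rw [abs_le]; constructor <;> linarith [hw.1, hw.2]))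
        (convex_Icc _ _) (x := x) (y := z) ⟨by linarith, by linarith⟩
        (by rw [abs_le] at hz; constructor <;> linarith [hz.1, hz.2])
      rw [Real.norm_eq_abs, Real.norm_eq_abs] at hb
      have hpow : L ^ ((k : ℝ) - (m + 1 : ℕ) + ε) * L = L ^ ((k : ℝ) - m + ε) := by
        rw [← Real.rpow_add_one' hL]
        · congr 1; push_cast; ring
        · have := wexp_pos (ε := ε) hε hm
          push_cast; linarith
      have h1 : (n + 1) * (M * 2 ^ (k + 1)) * L ^ ((k : ℝ) - (m + 1 : ℕ) + ε) * |z - x| ≤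
          (n + 1) * (M * 2 ^ (k + 1)) * L ^ ((k : ℝ) - m + ε) := by
        rw [← hpow, ← mul_assoc ((n + 1) * (M * 2 ^ (k + 1)))]
        gcongr
      have h2 := h0 m hm
      have h3 := abs_add_le (jet k f m x z - jet k f m y z - (jet k f m x x - jet k f m y x))
        (jet k f m x x - jet k f m y x)
      rw [sub_add_cancel] at h3
      push_cast
      linarith
  intro z hz
  refine (key (k - m) m hm rfl z hz).trans ?_
  have : ((k - m : ℕ) : ℝ) ≤ k := by exact_mod_cast Nat.sub_le _ _
  have := Real.rpow_nonneg hL ((k : ℝ) - m + ε)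
  gcongr

section Nearest

variable (K : Set ℝ)

open Classical in
/-- The nearest point of `K` on the left (or the end point of `K`, if there is none). -/
noncomputable def leftPt (x : ℝ) : ℝ :=
  if (K ∩ Iic x).Nonempty then sSup (K ∩ Iic x) else sInf K

open Classical in
/-- The nearest point of `K` on the right (or the end point of `K`, if there is none). -/
noncomputable def rightPt (x : ℝ) : ℝ :=
  if (K ∩ Ici x).Nonempty then sInf (K ∩ Ici x) else sSup K

variable {K}

theorem pts_congr {x z : ℝ} (h : ∀ y ∈ K, y ∉ uIcc x z) :
    leftPt K x = leftPt K z ∧ rightPt K x = rightPt K z := by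
  have h1 : K ∩ Iic x = K ∩ Iic z := by
    ext y
    simp only [mem_inter_iff, mem_Iic, and_congr_right_iff]
    intro hy
    have := h y hy
    rw [mem_uIcc] at this
    push Not at this
    constructor
    · intro hyx; by_contra! hh; linarith [this.2 hh.le]
    · intro hyz; by_contra! hh; linarith [this.1 hh.le]
  have h2 : K ∩ Ici x = K ∩ Ici z := by
    ext y
    simp only [mem_inter_iff, mem_Ici, and_congr_right_iff]
    intro hy
    have := h y hy
    rw [mem_uIcc] at this
    push Not at this
    constructor
    · intro hyx; by_contra! hh; linarith [this.1 hyx]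
    · intro hyz; by_contra! hh; linarith [this.2 hyz]
  constructor
  · rw [leftPt, leftPt, h1]
  · rw [rightPt, rightPt, h2]

theorem pts_eventually {x : ℝ} (hK : IsClosed K) (hx : x ∉ K) :
    ∀ᶠ z in 𝓝 x, leftPt K z = leftPt K x ∧ rightPt K z = rightPt K x := by
  obtain ⟨r, hr, hball⟩ := Metric.isOpen_iff.1 hK.isOpen_compl x hx
  filter_upwards [Metric.ball_mem_nhds x hr] with z hz
  refine pts_congr fun y hy hyz => hball ?_ hy
  have : uIcc z x ⊆ Metric.ball x r :=
    (convex_ball x r).ordConnected.uIcc_subset hz (Metric.mem_ball_self hr)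
  exact this hyz

theorem pts_self {x : ℝ} (hx : x ∈ K) : leftPt K x = x ∧ rightPt K x = x := by
  have h1 : IsGreatest (K ∩ Iic x) x := ⟨⟨hx, mem_Iic.2 le_rfl⟩, fun y hy => hy.2⟩
  have h2 : IsLeast (K ∩ Ici x) x := ⟨⟨hx, mem_Ici.2 le_rfl⟩, fun y hy => hy.2⟩
  rw [leftPt, rightPt, if_pos h1.nonempty, if_pos h2.nonempty]
  exact ⟨h1.csSup_eq, h2.csInf_eq⟩

theorem leftPt_isGreatest {x : ℝ} (hK : IsClosed K) (h : (K ∩ Iic x).Nonempty) :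
    IsGreatest (K ∩ Iic x) (leftPt K x) := by
  have hb : BddAbove (K ∩ Iic x) := ⟨x, fun y hy => hy.2⟩
  rw [leftPt, if_pos h]
  exact ⟨(hK.inter isClosed_Iic).csSup_mem h hb, fun y hy => le_csSup hb hy⟩

theorem rightPt_isLeast {x : ℝ} (hK : IsClosed K) (h : (K ∩ Ici x).Nonempty) :
    IsLeast (K ∩ Ici x) (rightPt K x) := by
  have hb : BddBelow (K ∩ Ici x) := ⟨x, fun y hy => hy.2⟩
  rw [rightPt, if_pos h]
  exact ⟨(hK.inter isClosed_Ici).csInf_mem h hb, fun y hy => csInf_le hb hy⟩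

/-- Position of a point with respect to `K`: in `K` or in a bounded gap, or in an unbounded
complementary ray. -/
theorem pts_cases (hK : IsClosed K) (hne : K.Nonempty) (x : ℝ) :
    leftPt K x ∈ K ∧ rightPt K x ∈ K ∧
    ((leftPt K x ≤ x ∧ x ≤ rightPt K x ∧ ∀ y ∈ K, y ≤ leftPt K x ∨ rightPt K x ≤ y) ∨
      (leftPt K x = rightPt K x ∧ ∀ y ∈ K, |x - leftPt K x| ≤ |x - y|)) := by
  by_cases h1 : (K ∩ Iic x).Nonempty
  · have g1 := leftPt_isGreatest hK h1
    by_cases h2 : (K ∩ Ici x).Nonempty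
    · have g2 := rightPt_isLeast hK h2
      refine ⟨g1.1.1, g2.1.1, Or.inl ⟨g1.1.2, g2.1.2, fun y hy => ?_⟩⟩
      rcases le_total y x with h | h
      · exact Or.inl (g1.2 ⟨hy, h⟩)
      · exact Or.inr (g2.2 ⟨hy, h⟩)
    · have hall : ∀ y ∈ K, y ≤ x := fun y hy => by
        by_contra! hh
        exact h2 ⟨y, hy, hh.le⟩
      have e : K ∩ Iic x = K := inter_eq_left.2 hall
      have er : rightPt K x = leftPt K x := by rw [leftPt, rightPt, if_pos h1, if_neg h2, e]
      refine ⟨g1.1.1, er ▸ g1.1.1, Or.inr ⟨er.symm, fun y hy => ?_⟩⟩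
      have a1 := g1.2 ⟨hy, hall y hy⟩
      have a2 : leftPt K x ≤ x := g1.1.2
      rw [abs_of_nonneg (by linarith), abs_of_nonneg (by linarith [hall y hy])]
      linarith
  · have hall : ∀ y ∈ K, x ≤ y := fun y hy => by
      by_contra! hh
      exact h1 ⟨y, hy, hh.le⟩
    have e : K ∩ Ici x = K := inter_eq_left.2 hall
    have h2 : (K ∩ Ici x).Nonempty := e.symm ▸ hne
    have g2 := rightPt_isLeast hK h2
    have er : leftPt K x = rightPt K x := by rw [leftPt, rightPt, if_neg h1, if_pos h2, e]
    refine ⟨er ▸ g2.1.1, g2.1.1, Or.inr ⟨er, fun y hy => ?_⟩⟩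
    rw [er]
    have a1 := g2.2 ⟨hy, hall y hy⟩
    have a2 : x ≤ rightPt K x := g2.1.2
    rw [abs_of_nonpos (by linarith), abs_of_nonpos (by linarith [hall y hy])]
    linarith

end Nearest

/-- A smooth step: `0` left of `1/3` and `1` right of `2/3`. -/
noncomputable def step (t : ℝ) : ℝ := Real.smoothTransition (3 * t - 1)

theorem step_contDiff {n : ℕ∞} : ContDiff ℝ n step :=
  Real.smoothTransition.contDiff.comp (by fun_prop)

theorem step_zero {t : ℝ} (ht : t ≤ 1 / 3) : step t = 0 :=
  Real.smoothTransition.zero_of_nonpos (by linarith)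

theorem step_one {t : ℝ} (ht : 2 / 3 ≤ t) : step t = 1 :=
  Real.smoothTransition.one_of_one_le (by linarith)

theorem exists_step_bound (k : ℕ) :
    ∃ B, 1 ≤ B ∧ ∀ m ≤ k, ∀ t ∈ UI, |iteratedDeriv m step t| ≤ B := by
  have : ∀ m : ℕ, ∃ B, 0 ≤ B ∧ ∀ t ∈ UI, |iteratedDeriv m step t| ≤ B := by
    intro m
    obtain ⟨B, hB⟩ := isCompact_Icc.exists_bound_of_continuousOn (s := UI)
      (f := iteratedDeriv m step)
      ((step_contDiff (n := m)).continuous_iteratedDeriv m le_rfl).continuousOn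
    exact ⟨B, (norm_nonneg _).trans (hB 0 (by simp)), hB⟩
  choose B hB0 hB using this
  refine ⟨1 + ∑ m ∈ Finset.range (k + 1), B m, ?_, fun m hm t ht => ?_⟩
  · have := Finset.sum_nonneg fun m (_ : m ∈ Finset.range (k + 1)) => hB0 m
    linarith
  · have := Finset.single_le_sum (fun m _ => hB0 m)
      (Finset.mem_range.2 (show m < k + 1 by omega))
    linarith [hB m t ht]

/-- Interpolation between the jets at `a` and at `b`. -/
noncomputable def blend (k : ℕ) (f : ℕ → ℝ → ℝ) (a b z : ℝ) : ℝ :=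
  jet k f 0 a z + step ((b - a)⁻¹ * z + -(b - a)⁻¹ * a) * (jet k f 0 b z - jet k f 0 a z)

theorem blend_contDiff (k : ℕ) (f : ℕ → ℝ → ℝ) (a b : ℝ) {n : ℕ∞} :
    ContDiff ℝ n (blend k f a b) := by
  unfold blend
  have h1 := jet_contDiff k f 0 a (n := n)
  have h2 := jet_contDiff k f 0 b (n := n)
  have h3 : ContDiff ℝ n fun z => step ((b - a)⁻¹ * z + -(b - a)⁻¹ * a) :=
    step_contDiff.comp (by fun_prop)
  exact h1.add (h3.mul (h2.sub h1))

/-- Lets the same formula serve at points of `K` and in the unbounded rays, where the two nearest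
points coincide. -/
theorem blend_self (k : ℕ) (f : ℕ → ℝ → ℝ) (a : ℝ) : blend k f a a = jet k f 0 a := by
  funext z; simp [blend]

theorem iteratedDeriv_blend (k : ℕ) (f : ℕ → ℝ → ℝ) (a b : ℝ) (m : ℕ) (x : ℝ) :
    iteratedDeriv m (blend k f a b) x = jet k f m a x + ∑ i ∈ Finset.range (m + 1),
      (m.choose i : ℝ) * ((b - a)⁻¹ ^ i * iteratedDeriv i step ((b - a)⁻¹ * x + -(b - a)⁻¹ * a)) *
        (jet k f (m - i) b x - jet k f (m - i) a x) := by
  have h1 := jet_contDiff k f 0 a (n := m)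
  have h2 := jet_contDiff k f 0 b (n := m)
  have h3 : ContDiff ℝ m fun z => step ((b - a)⁻¹ * z + -(b - a)⁻¹ * a) :=
    (step_contDiff (n := m)).comp (by fun_prop)
  have e : blend k f a b = jet k f 0 a + (fun z => step ((b - a)⁻¹ * z + -(b - a)⁻¹ * a)) *
    (jet k f 0 b - jet k f 0 a) := rfl
  have h21 : ContDiff ℝ m (jet k f 0 b - jet k f 0 a) := h2.sub h1
  have h321 : ContDiff ℝ m ((fun z => step ((b - a)⁻¹ * z + -(b - a)⁻¹ * a)) *
    (jet k f 0 b - jet k f 0 a)) := h3.mul h21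
  rw [e, iteratedDeriv_add h1.contDiffAt h321.contDiffAt,
    iteratedDeriv_mul h3.contDiffAt h21.contDiffAt, iteratedDeriv_jet]
  congr 1
  refine Finset.sum_congr rfl fun i hi => ?_
  have hi' : i ≤ m := Nat.lt_succ_iff.1 (Finset.mem_range.1 hi)
  have h4 := jet_contDiff k f 0 a (n := (m - i : ℕ))
  have h5 := jet_contDiff k f 0 b (n := (m - i : ℕ))
  rw [iteratedDeriv_sub h5.contDiffAt h4.contDiffAt, iteratedDeriv_jet, iteratedDeriv_jet]
  congr 2
  have h6 : ContDiff ℝ i fun w => step (w + -(b - a)⁻¹ * a) :=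
    (step_contDiff (n := i)).comp (by fun_prop)
  have h7 := congrFun (iteratedDeriv_comp_const_mul h6 (b - a)⁻¹) x
  rw [h7]
  simp only [iteratedDeriv_comp_add_const]

end CantorScaling

/-! ### Whitney's extension theorem on the line -/

namespace CantorScaling

variable {K : Set ℝ} {k : ℕ} {ε M : ℝ} {f : ℕ → ℝ → ℝ}

theorem step_arg_mem {a b x : ℝ} (hab : a < b) (hx : x ∈ Icc a b) :
    (b - a)⁻¹ * x + -(b - a)⁻¹ * a ∈ UI := by
  have h : 0 < b - a := sub_pos.2 hab
  rw [show (b - a)⁻¹ * x + -(b - a)⁻¹ * a = (x - a) / (b - a) by field_simp; ring]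
  exact ⟨div_nonneg (by linarith [hx.1]) h.le, (div_le_one h).2 (by linarith [hx.2])⟩

/-- In the Leibniz formula each derivative that falls on the step function costs `(b - a)⁻¹`, and
the correspondingly lower order of the jet difference gains it back. The order `k + 1`, where the
jet is zero and the exponent is `ε - 1`, is included for the Hölder bound inside a gap. -/
theorem WhitneyData.exists_blend_close (hf : WhitneyData K k ε M f) (hM : 0 ≤ M) (hε : 0 < ε)
    (hε1 : ε ≤ 1) : ∃ C, 0 ≤ C ∧ ∀ a ∈ K, ∀ b ∈ K, a < b → ∀ x ∈ Icc a b, ∀ m ≤ k + 1,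
      |iteratedDeriv m (blend k f a b) x - jet k f m a x| ≤ C * (b - a) ^ ((k : ℝ) - m + ε) := by
  obtain ⟨B, hB1, hB⟩ := exists_step_bound (k + 1)
  obtain ⟨J, hJ⟩ : ∃ J, J = (k + 1) * (M * 2 ^ (k + 1)) := ⟨_, rfl⟩
  have hJ0 : 0 ≤ J := hJ ▸ by positivity
  refine ⟨(k + 2) * (2 ^ (k + 1) * B * J), by positivity, fun a ha b hb hab x hx m hm => ?_⟩
  have hl : 0 < b - a := sub_pos.2 hab
  rw [iteratedDeriv_blend, add_sub_cancel_left]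
  refine (Finset.abs_sum_le_sum_abs _ _).trans ?_
  have hterm : ∀ i ∈ Finset.range (m + 1), |(m.choose i : ℝ) *
      ((b - a)⁻¹ ^ i * iteratedDeriv i step ((b - a)⁻¹ * x + -(b - a)⁻¹ * a)) *
        (jet k f (m - i) b x - jet k f (m - i) a x)| ≤
      2 ^ (k + 1) * B * J * (b - a) ^ ((k : ℝ) - m + ε) := by
    intro i hi
    have hi : i ≤ m := Nat.lt_succ_iff.1 (Finset.mem_range.1 hi)
    have h1 : (m.choose i : ℝ) ≤ 2 ^ (k + 1) := by
      have : m.choose i ≤ 2 ^ (k + 1) :=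
        (Nat.choose_le_two_pow m i).trans (Nat.pow_le_pow_right two_pos hm)
      exact_mod_cast this
    have h2 := hB i (by omega) _ (step_arg_mem hab hx)
    have h3 : |jet k f (m - i) b x - jet k f (m - i) a x| ≤
        J * (b - a) ^ ((k : ℝ) - (m - i : ℕ) + ε) := by
      rcases le_or_gt (m - i) k with hmi | hmi
      · rw [hJ]
        refine hf.jet_close hM hε hε1 hb ha hl.le ?_ hmi x ?_
        · rw [abs_of_pos hl]; linarith
        · rw [abs_le]; constructor <;> linarith [hx.1, hx.2]
      · rw [jet_eq_zero f hmi, jet_eq_zero f hmi, sub_zero, abs_zero]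
        have := Real.rpow_nonneg hl.le ((k : ℝ) - (m - i : ℕ) + ε)
        positivity
    have h4 : (b - a)⁻¹ ^ i * (b - a) ^ ((k : ℝ) - (m - i : ℕ) + ε) =
        (b - a) ^ ((k : ℝ) - m + ε) := by
      rw [inv_pow, ← Real.rpow_natCast, ← Real.rpow_neg hl.le, ← Real.rpow_add hl]
      congr 1
      push_cast [hi]; ring
    rw [abs_mul, abs_mul, abs_mul, abs_of_nonneg (by positivity : (0 : ℝ) ≤ m.choose i),
      abs_of_nonneg (by positivity : 0 ≤ (b - a)⁻¹ ^ i)]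
    calc _ ≤ 2 ^ (k + 1) * ((b - a)⁻¹ ^ i * B) * (J * (b - a) ^ ((k : ℝ) - (m - i : ℕ) + ε)) := by
          gcongr
      _ = 2 ^ (k + 1) * B * J * ((b - a)⁻¹ ^ i * (b - a) ^ ((k : ℝ) - (m - i : ℕ) + ε)) := by ring
      _ = _ := by rw [h4]
  refine (Finset.sum_le_sum hterm).trans ?_
  rw [Finset.sum_const, Finset.card_range, nsmul_eq_mul, mul_assoc (k + 2 : ℝ)]
  have : ((m + 1 : ℕ) : ℝ) ≤ k + 2 := by exact_mod_cast (show m + 1 ≤ k + 2 by omega)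
  have h5 := Real.rpow_nonneg hl.le ((k : ℝ) - m + ε)
  exact mul_le_mul_of_nonneg_right this (by positivity)

/-- Close to `a` a bound in powers of `b - a` would be too weak, since `x - a` may be far smaller.
This is why the step function is constant near both ends. -/
theorem iteratedDeriv_blend_left {a b x : ℝ} (hab : a < b) (hx : x - a < (b - a) / 3) (m : ℕ) :
    iteratedDeriv m (blend k f a b) x = jet k f m a x := by
  have h : 0 < b - a := sub_pos.2 hab
  rw [← iteratedDeriv_jet]
  refine Filter.EventuallyEq.iteratedDeriv_eq m ?_
  filter_upwards [gt_mem_nhds (show x < a + (b - a) / 3 by linarith)] with z hz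
  rw [blend, step_zero, zero_mul, add_zero]
  rw [show (b - a)⁻¹ * z + -(b - a)⁻¹ * a = (z - a) / (b - a) by field_simp; ring,
    div_le_iff₀ h]
  linarith

theorem iteratedDeriv_blend_right {a b x : ℝ} (hab : a < b) (hx : b - x < (b - a) / 3) (m : ℕ) :
    iteratedDeriv m (blend k f a b) x = jet k f m b x := by
  have h : 0 < b - a := sub_pos.2 hab
  rw [← iteratedDeriv_jet]
  refine Filter.EventuallyEq.iteratedDeriv_eq m ?_
  filter_upwards [lt_mem_nhds (show b - (b - a) / 3 < x by linarith)] with z hz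
  rw [blend, step_one, one_mul]
  · ring
  rw [show (b - a)⁻¹ * z + -(b - a)⁻¹ * a = (z - a) / (b - a) by field_simp; ring,
    le_div_iff₀ h]
  linarith

/-- The derivatives of the extension: blended jets at the two nearest points. -/
noncomputable def whitneyDeriv (K : Set ℝ) (k : ℕ) (f : ℕ → ℝ → ℝ) (m : ℕ) (x : ℝ) : ℝ :=
  iteratedDeriv m (blend k f (leftPt K x) (rightPt K x)) x

/-- In the outer thirds of a gap, and in the rays, the extension is a single jet at a point no
farther than `y`, so `jet_close` applies. In the middle third the gap has length at most `3 * |x -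
y|`, so a bound in powers of that length suffices. -/
theorem WhitneyData.exists_whitneyDeriv_close (hf : WhitneyData K k ε M f) (hM : 0 ≤ M)
    (hε : 0 < ε) (hε1 : ε ≤ 1) (hK : IsClosed K) (hne : K.Nonempty) :
    ∃ C, 0 ≤ C ∧ ∀ x, ∀ y ∈ K, ∀ m ≤ k,
      |whitneyDeriv K k f m x - jet k f m y x| ≤ C * |x - y| ^ ((k : ℝ) - m + ε) := by
  obtain ⟨C, hC0, hC⟩ := hf.exists_blend_close hM hε hε1
  obtain ⟨J, hJ⟩ : ∃ J, J = (k + 1) * (M * 2 ^ (k + 1)) := ⟨_, rfl⟩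
  have hJ0 : 0 ≤ J := hJ ▸ by positivity
  have hpw : (1 : ℝ) ≤ 3 ^ (k + 1) := one_le_pow₀ (by norm_num)
  refine ⟨(C + J) * 3 ^ (k + 1), by positivity, fun x y hy m hm => ?_⟩
  have hR := Real.rpow_nonneg (abs_nonneg (x - y)) ((k : ℝ) - m + ε)
  have near : ∀ a ∈ K, |x - a| ≤ |x - y| → |jet k f m a x - jet k f m y x| ≤
      (C + J) * 3 ^ (k + 1) * |x - y| ^ ((k : ℝ) - m + ε) := by
    intro a ha hxa
    have h1 := hf.jet_close hM hε hε1 ha hy (abs_nonneg (x - y)) (by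
      have := abs_sub_le a x y
      rw [abs_sub_comm a x] at this
      linarith) hm x hxa
    refine h1.trans (mul_le_mul_of_nonneg_right ?_ hR)
    rw [← hJ]
    nlinarith
  obtain ⟨ha, hb, hcase⟩ := pts_cases hK hne x
  unfold whitneyDeriv
  set a := leftPt K x
  set b := rightPt K x
  by_cases hab : a = b
  · rw [← hab, blend_self, iteratedDeriv_jet]
    refine near a ha ?_
    rcases hcase with ⟨h1, h2, -⟩ | ⟨-, h⟩
    · rw [show x = a by linarith]; simp
    · exact h y hy
  · obtain ⟨h1, h2, h3⟩ : a ≤ x ∧ x ≤ b ∧ ∀ y ∈ K, y ≤ a ∨ b ≤ y := by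
      rcases hcase with h | h
      · exact h
      · exact absurd h.1 hab
    have hab : a < b := lt_of_le_of_ne (h1.trans h2) hab
    by_cases c1 : x - a < (b - a) / 3
    · rw [iteratedDeriv_blend_left hab c1]
      refine near a ha ?_
      rw [abs_of_nonneg (by linarith)]
      rcases h3 y hy with h | h
      · rw [abs_of_nonneg (by linarith)]; linarith
      · rw [abs_of_nonpos (by linarith)]; linarith
    by_cases c2 : b - x < (b - a) / 3
    · rw [iteratedDeriv_blend_right hab c2]
      refine near b hb ?_
      rw [abs_of_nonpos (by linarith)]
      rcases h3 y hy with h | h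
      · rw [abs_of_nonneg (by linarith)]; linarith
      · rw [abs_of_nonpos (by linarith)]; linarith
    have hl : b - a ≤ 3 * |x - y| := by
      rcases h3 y hy with h | h
      · rw [abs_of_nonneg (by linarith)]; linarith
      · rw [abs_of_nonpos (by linarith)]; linarith
    have e1 := hC a ha b hb hab x ⟨h1, h2⟩ m (by omega)
    have e2 := hf.jet_close hM hε hε1 ha hy (L := 3 * |x - y|) (by positivity) (by
      have := abs_sub_le a x y
      rw [abs_sub_comm a x, abs_of_nonneg (show 0 ≤ x - a by linarith)] at this
      linarith [abs_nonneg (x - y)]) hm x (by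
        rw [abs_of_nonneg (show 0 ≤ x - a by linarith)]; linarith)
    rw [← hJ] at e2
    have e3 : (b - a) ^ ((k : ℝ) - m + ε) ≤ 3 ^ (k + 1) * |x - y| ^ ((k : ℝ) - m + ε) :=
      (Real.rpow_le_rpow (by linarith) hl (wexp_pos hε hm).le).trans
        (mul_rpow_wexp_le (by norm_num) hε1 (abs_nonneg _))
    have e4 : (3 * |x - y|) ^ ((k : ℝ) - m + ε) ≤ 3 ^ (k + 1) * |x - y| ^ ((k : ℝ) - m + ε) :=
      mul_rpow_wexp_le (by norm_num) hε1 (abs_nonneg _)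
    have e5 := mul_le_mul_of_nonneg_left e3 hC0
    have e6 := mul_le_mul_of_nonneg_left e4 hJ0
    have e7 := abs_sub_le (iteratedDeriv m (blend k f a b) x) (jet k f m a x) (jet k f m y x)
    linarith

theorem hasDerivAt_zero_of_rpow_le {g : ℝ → ℝ} {y C p : ℝ} (hp : 1 < p)
    (hg : ∀ z, |g z| ≤ C * |z - y| ^ p) : HasDerivAt g 0 y := by
  have hy : g y = 0 := by
    have := hg y
    rw [sub_self, abs_zero, Real.zero_rpow (by linarith), mul_zero] at this
    exact abs_nonpos_iff.1 this
  rw [hasDerivAt_iff_tendsto]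
  have hlim : Tendsto (fun z => C * |z - y| ^ (p - 1)) (𝓝 y) (𝓝 0) := by
    have hc : Continuous fun z => C * |z - y| ^ (p - 1) := by
      refine continuous_const.mul (Continuous.rpow_const (by fun_prop) fun z => Or.inr (by linarith))
    have := hc.tendsto y
    rwa [sub_self, abs_zero, Real.zero_rpow (by linarith), mul_zero] at this
  refine squeeze_zero (fun z => by positivity) (fun z => ?_) hlim
  rw [hy, smul_zero, sub_zero, sub_zero, Real.norm_eq_abs, Real.norm_eq_abs]
  rcases eq_or_ne z y with rfl | hz
  · rw [hy]
    simp [Real.zero_rpow (show p - 1 ≠ 0 by linarith)]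
  · have hpos : 0 < |z - y| := abs_pos.2 (sub_ne_zero.2 hz)
    rw [inv_mul_le_iff₀ hpos, mul_left_comm, ← Real.rpow_one_add' hpos.le (by linarith)]
    simpa using hg z

theorem whitneyDeriv_eventuallyEq (hK : IsClosed K) {x : ℝ} (hx : x ∉ K) (m : ℕ) :
    whitneyDeriv K k f m =ᶠ[𝓝 x]
      iteratedDeriv m (blend k f (leftPt K x) (rightPt K x)) := by
  filter_upwards [pts_eventually hK hx] with z hz
  rw [whitneyDeriv, hz.1, hz.2]

theorem whitneyDeriv_mem {x : ℝ} (hx : x ∈ K) {m : ℕ} (hm : m ≤ k) :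
    whitneyDeriv K k f m x = f m x := by
  obtain ⟨h1, h2⟩ := pts_self hx
  rw [whitneyDeriv, h1, h2, blend_self, iteratedDeriv_jet, jet_self f hm]

/-- Whitney's extension theorem on the line in the class `C^{k+ε}`. -/
theorem WhitneyData.exists_extension (hf : WhitneyData K k ε M f) (hM : 0 ≤ M)
    (hε : 0 < ε) (hε1 : ε ≤ 1) (hK : IsClosed K) (hne : K.Nonempty) :
    ∃ F : ℝ → ℝ, IsCkHolder k ε F ∧ (∀ x ∈ K, ∀ m ≤ k, iteratedDeriv m F x = f m x) ∧
      (∀ x ∉ K, ∀ n : ℕ, ContDiffAt ℝ n F x) ∧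
      ∀ x ∉ K, leftPt K x = rightPt K x → iteratedDeriv (k + 1) F x = 0 := by
  obtain ⟨C, hC0, hC⟩ := hf.exists_whitneyDeriv_close hM hε hε1 hK hne
  obtain ⟨C', hC0', hC'⟩ := hf.exists_blend_close hM hε hε1
  let G := whitneyDeriv K k f
  -- At a point `x` of `K` the function `G m` differs from the jet at `x` by a power of `|z - x|`
  -- greater than one, hence has the derivative of the jet. Off `K` it is locally the derivative of
  -- one smooth blend.
  have hchain : ∀ m < k, ∀ x, HasDerivAt (G m) (G (m + 1) x) x := by
    intro m hm x
    by_cases hx : x ∈ K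
    · have hp : 1 < (k : ℝ) - m + ε := by
        have : (m : ℝ) + 1 ≤ k := by exact_mod_cast hm
        linarith
      have h1 := hasDerivAt_zero_of_rpow_le hp fun z => hC z x hx m hm.le
      have h2 := h1.add (jet_hasDerivAt k f m x x)
      rw [jet_self f hm, zero_add, ← whitneyDeriv_mem (f := f) (m := m + 1) hx hm] at h2
      refine h2.congr_of_eventuallyEq (Eventually.of_forall fun z => ?_)
      simp [G]
    · have h1 : HasDerivAt (iteratedDeriv m (blend k f (leftPt K x) (rightPt K x)))
          (G (m + 1) x) x := by
        have := ((blend_contDiff k f (leftPt K x) (rightPt K x) (n := (m + 1 : ℕ))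
          ).differentiable_iteratedDeriv m (by exact_mod_cast Nat.lt_succ_self m)) x
        simpa [G, whitneyDeriv, iteratedDeriv_succ] using this.hasDerivAt
      exact h1.congr_of_eventuallyEq (whitneyDeriv_eventuallyEq hK hx m)
  have hnear : ∀ x, ∀ y ∈ K, |G k x - G k y| ≤ C * |x - y| ^ ε := by
    intro x y hy
    have := hC x y hy k le_rfl
    rw [sub_self, zero_add] at this
    have hj : jet k f k y x = G k y := by
      rw [show G k y = f k y from whitneyDeriv_mem hy le_rfl]
      unfold jet
      rw [show k + 1 - k = 1 by omega]; simp
    rwa [hj] at this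
  -- Either a point of `K` lies between `x` and `z`, and both are compared with it, or they lie in
  -- one complementary interval. In a bounded gap of length `l` the mean value bound `C' * l ^ (ε -
  -- 1) * |x - z|` is at most `C' * |x - z| ^ ε`, since `|x - z| ≤ l` and `ε ≤ 1`.
  have hhol : ∀ x z, |G k x - G k z| ≤ (2 * C + C') * |x - z| ^ ε := by
    intro x z
    have hR := Real.rpow_nonneg (abs_nonneg (x - z)) ε
    by_cases h : ∃ y ∈ K, y ∈ uIcc x z
    · obtain ⟨y, hy, hyx⟩ := h
      have h1 := hnear x y hy
      have h2 := hnear z y hy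
      have h3 : |x - y| ≤ |x - z| := by
        rw [abs_sub_comm x y, abs_sub_comm x z]; exact abs_sub_left_of_mem_uIcc hyx
      have h4 : |z - y| ≤ |x - z| := by
        rcases mem_uIcc.1 hyx with ⟨h5, h6⟩ | ⟨h5, h6⟩ <;> rw [abs_le] <;> constructor <;>
          linarith [neg_abs_le (x - z), le_abs_self (x - z)]
      have h5 := Real.rpow_le_rpow (abs_nonneg _) h3 hε.le
      have h6 := Real.rpow_le_rpow (abs_nonneg _) h4 hε.le
      have h7 := abs_sub_le (G k x) (G k y) (G k z)
      rw [abs_sub_comm (G k y)] at h7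
      nlinarith
    · push Not at h
      obtain ⟨ea, eb⟩ := pts_congr h
      have hxz : ∀ w ∈ uIcc x z, leftPt K w = leftPt K x ∧ rightPt K w = rightPt K x := by
        intro w hw
        have := pts_congr (K := K) (x := x) (z := w) fun y hy hyw => h y hy
          (uIcc_subset_uIcc_left hw hyw)
        exact ⟨this.1.symm, this.2.symm⟩
      obtain ⟨ha, hb, hcase⟩ := pts_cases hK hne x
      have hGz : G k z = iteratedDeriv k (blend k f (leftPt K x) (rightPt K x)) z := by
        simp only [G, whitneyDeriv]; rw [← ea, ← eb]
      have hGx : G k x = iteratedDeriv k (blend k f (leftPt K x) (rightPt K x)) x := rfl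
      by_cases hab : leftPt K x = rightPt K x
      · rw [hGz, hGx, ← hab, blend_self, iteratedDeriv_jet]
        have hj : ∀ x y, jet k f k y x = f k y := by
          intro x y
          unfold jet
          rw [show k + 1 - k = 1 by omega]; simp
        rw [hj, hj, sub_self, abs_zero]
        positivity
      · have hlt : leftPt K x < rightPt K x := by
          rcases hcase with h | h
          · exact lt_of_le_of_ne (h.1.trans h.2.1) hab
          · exact absurd h.1 hab
        have hsub : uIcc x z ⊆ Icc (leftPt K x) (rightPt K x) := by
          intro w hw
          obtain ⟨e1, e2⟩ := hxz w hw
          obtain ⟨-, -, hc⟩ := pts_cases hK hne w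
          rw [e1, e2] at hc
          rcases hc with h | h
          · exact ⟨h.1, h.2.1⟩
          · exact absurd h.1 hab
        have hd : ∀ w ∈ uIcc x z, HasDerivWithinAt
            (iteratedDeriv k (blend k f (leftPt K x) (rightPt K x)))
            (iteratedDeriv (k + 1) (blend k f (leftPt K x) (rightPt K x)) w) (uIcc x z) w := by
          intro w _
          have := ((blend_contDiff k f (leftPt K x) (rightPt K x) (n := (k + 1 : ℕ))
            ).differentiable_iteratedDeriv k (by exact_mod_cast Nat.lt_succ_self k)) w
          rw [iteratedDeriv_succ]
          exact this.hasDerivAt.hasDerivWithinAt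
        set l := rightPt K x - leftPt K x with hl
        have hl0 : 0 < l := sub_pos.2 hlt
        have hbd := Convex.norm_image_sub_le_of_norm_hasDerivWithin_le hd
          (C := C' * l ^ (ε - 1)) (fun w hw => by
            have := hC' _ ha _ hb hlt w (hsub hw) (k + 1) le_rfl
            rw [jet_eq_zero f (Nat.lt_succ_self k), sub_zero] at this
            rw [Real.norm_eq_abs]
            convert this using 3
            push_cast; ring) (convex_uIcc _ _) right_mem_uIcc left_mem_uIcc
        rw [hGz, hGx]
        rw [Real.norm_eq_abs, Real.norm_eq_abs] at hbd
        refine hbd.trans ?_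
        rcases eq_or_ne x z with rfl | hne'
        · simp; positivity
        have hpos : 0 < |x - z| := abs_pos.2 (sub_ne_zero.2 hne')
        have hle : |x - z| ≤ l := by
          have h1 := hsub left_mem_uIcc
          have h2 := hsub right_mem_uIcc
          rw [abs_le]; constructor <;> linarith [h1.1, h1.2, h2.1, h2.2]
        have h1 : l ^ (ε - 1) ≤ |x - z| ^ (ε - 1) :=
          Real.rpow_le_rpow_of_nonpos hpos hle (by linarith)
        have h2 : |x - z| ^ (ε - 1) * |x - z| = |x - z| ^ ε := by
          rw [← Real.rpow_add_one hpos.ne']; congr 1; ring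
        calc C' * l ^ (ε - 1) * |x - z| ≤ C' * |x - z| ^ (ε - 1) * |x - z| := by gcongr
          _ = C' * |x - z| ^ ε := by rw [mul_assoc, h2]
          _ ≤ _ := by nlinarith
  have hcont : Continuous (G k) := by
    rw [continuous_iff_continuousAt]
    intro x
    rw [ContinuousAt, tendsto_iff_norm_sub_tendsto_zero]
    have hc : Continuous fun z => (2 * C + C') * |z - x| ^ ε :=
      continuous_const.mul (Continuous.rpow_const (by fun_prop) fun z => Or.inr hε.le)
    have := hc.tendsto x
    rw [sub_self, abs_zero, Real.zero_rpow hε.ne', mul_zero] at this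
    exact squeeze_zero (fun z => norm_nonneg _) (fun z => hhol z x) this
  obtain ⟨h1, h2⟩ := contDiff_of_chain hchain hcont
  -- Off `K` the extension is locally one blend, and in a ray a polynomial of degree at most `k`.
  -- The later modification relies on both facts.
  have hloc : ∀ x ∉ K, G 0 =ᶠ[𝓝 x] blend k f (leftPt K x) (rightPt K x) := by
    intro x hx
    simpa using whitneyDeriv_eventuallyEq (f := f) (k := k) hK hx 0
  refine ⟨G 0, ⟨h1, 2 * C + C', fun x y => ?_⟩, fun x hx m hm => ?_, fun x hx n => ?_,
    fun x hx hab => ?_⟩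
  · rw [h2 k le_rfl]; exact hhol x y
  · rw [h2 m hm]; exact whitneyDeriv_mem hx hm
  · exact ((blend_contDiff k f _ _ (n := n)).contDiffAt).congr_of_eventuallyEq (hloc x hx)
  · rw [(hloc x hx).iteratedDeriv_eq, ← hab, blend_self, iteratedDeriv_jet,
      jet_eq_zero f (Nat.lt_succ_self k)]

end CantorScaling

/-! ### Modification to a contraction off a compact set -/

namespace CantorScaling

theorem step_mem (t : ℝ) : step t ∈ UI :=
  ⟨Real.smoothTransition.nonneg _, Real.smoothTransition.le_one _⟩

/-- Weight of the modification at `x`, for `x` in the gap `(p, q)` or in a ray (`p = q`): it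
vanishes near the end points, and everywhere in the gaps shorter than `2 r`. -/
noncomputable def gapWeight (r r' p q x : ℝ) : ℝ :=
  if p = q then step ((x - p) / r') + step ((p - x) / r')
  else if q - p < 2 * r then 0 else step ((x - p) / r') * step ((q - x) / r')

section GapWeight

variable {r r' p q x : ℝ}

theorem gapWeight_contDiff (r r' p q : ℝ) {n : ℕ∞} : ContDiff ℝ n (gapWeight r r' p q) := by
  have h1 : ∀ p, ContDiff ℝ n fun x => step ((x - p) / r') := fun p =>
    step_contDiff.comp (by fun_prop)
  have h2 : ∀ p, ContDiff ℝ n fun x => step ((p - x) / r') := fun p =>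
    step_contDiff.comp (by fun_prop)
  by_cases h : p = q
  · simp only [funext fun x => show gapWeight r r' p q x = _ from if_pos h]
    exact (h1 p).add (h2 p)
  · by_cases h' : q - p < 2 * r
    · simp only [funext fun x => show gapWeight r r' p q x = _ from
        (if_neg h).trans (if_pos h')]
      exact contDiff_const
    · simp only [funext fun x => show gapWeight r r' p q x = _ from
        (if_neg h).trans (if_neg h')]
      exact (h1 p).mul (h2 q)

theorem gapWeight_mem (hr' : 0 < r') : gapWeight r r' p q x ∈ UI := by
  have h1 := step_mem ((x - p) / r')
  have h2 := step_mem ((p - x) / r')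
  have h3 := step_mem ((q - x) / r')
  unfold gapWeight
  split_ifs
  · rcases le_total x p with h | h
    · rw [step_zero (t := (x - p) / r') ((div_nonpos_of_nonpos_of_nonneg (by linarith)
        hr'.le).trans (by norm_num)), zero_add]
      exact h2
    · rw [step_zero (t := (p - x) / r') ((div_nonpos_of_nonpos_of_nonneg (by linarith)
        hr'.le).trans (by norm_num)), add_zero]
      exact h1
  · simp
  · exact ⟨mul_nonneg h1.1 h3.1, mul_le_one₀ h1.2 h3.1 h3.2⟩

theorem step_div_eq_zero (hr' : 0 < r') {t : ℝ} (ht : |t| ≤ r' / 3) : step (t / r') = 0 := by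
  apply step_zero
  rw [div_le_iff₀ hr']
  linarith [le_abs_self t]

theorem gapWeight_left (hr' : 0 < r') (h : |x - p| ≤ r' / 3) : gapWeight r r' p q x = 0 := by
  unfold gapWeight
  rw [step_div_eq_zero hr' h, step_div_eq_zero hr' (t := p - x) (by rwa [abs_sub_comm])]
  simp

theorem gapWeight_right (hr' : 0 < r') (h : |x - q| ≤ r' / 3) : gapWeight r r' p q x = 0 := by
  by_cases hpq : p = q
  · subst hpq; exact gapWeight_left hr' h
  unfold gapWeight
  rw [step_div_eq_zero hr' (t := q - x) (by rwa [abs_sub_comm]), if_neg hpq]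
  simp

theorem gapWeight_ray (hr' : 0 < r') (h : r' ≤ |x - p|) : gapWeight r r' p p x = 1 := by
  unfold gapWeight
  rw [if_pos rfl]
  rcases le_total x p with h1 | h1
  · rw [abs_of_nonpos (by linarith)] at h
    rw [step_zero (t := (x - p) / r') ((div_nonpos_of_nonpos_of_nonneg (by linarith)
        hr'.le).trans (by norm_num)), zero_add]
    apply step_one
    rw [le_div_iff₀ hr']; linarith
  · rw [abs_of_nonneg (by linarith)] at h
    rw [step_zero (t := (p - x) / r') ((div_nonpos_of_nonpos_of_nonneg (by linarith)
        hr'.le).trans (by norm_num)), add_zero]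
    apply step_one
    rw [le_div_iff₀ hr']; linarith

theorem gapWeight_middle (hr' : 0 < r') (hpq : p ≠ q) (hl : 2 * r ≤ q - p)
    (h1 : p + r' ≤ x) (h2 : x ≤ q - r') : gapWeight r r' p q x = 1 := by
  unfold gapWeight
  rw [if_neg hpq, if_neg (not_lt.2 hl), step_one, step_one, one_mul]
  · rw [le_div_iff₀ hr']; linarith
  · rw [le_div_iff₀ hr']; linarith

theorem near_of_gapWeight_ne_one (hr' : 0 < r') (hrr : r' < r)
    (hcase : p = q ∨ p < q ∧ p ≤ x ∧ x ≤ q)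
    (h : gapWeight r r' p q x ≠ 1) : |x - p| < r ∨ |x - q| < r := by
  rcases hcase with rfl | ⟨hpq, h1, h2⟩
  · left
    by_contra! hh
    exact h (gapWeight_ray hr' (hrr.le.trans hh))
  · rw [abs_of_nonneg (by linarith), abs_of_nonpos (by linarith)]
    by_contra! hh
    exact h (gapWeight_middle hr' hpq.ne (by linarith) (by linarith) (by linarith))

end GapWeight

/-- The function is Lipschitz, which is enough at distances up to `1`. It is constant on each side
of a bounded interval, hence its differences are bounded, which is enough at larger distances. -/
theorem holder_of_deriv_support {h h' : ℝ → ℝ} {R ε : ℝ} (hd : ∀ x, HasDerivAt h (h' x) x)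
    (hc : Continuous h') (h0 : ∀ x, R < |x| → h' x = 0) (hε : 0 < ε) (hε1 : ε ≤ 1) :
    ∃ C, 0 ≤ C ∧ ∀ x y, |h x - h y| ≤ C * |x - y| ^ ε := by
  have hR : ∃ R', 0 ≤ R' ∧ ∀ x, R' ≤ |x| → h' x = 0 :=
    ⟨|R| + 1, by positivity, fun x hx => h0 x (by linarith [le_abs_self R])⟩
  obtain ⟨R, hR0, h0⟩ := hR
  obtain ⟨B, hB⟩ := isCompact_Icc.exists_bound_of_continuousOn (s := Icc (-R) R)
    hc.continuousOn
  have hB0 : 0 ≤ B := (norm_nonneg _).trans (hB 0 ⟨by linarith, hR0⟩)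
  have hB' : ∀ x, ‖h' x‖ ≤ B := by
    intro x
    rcases le_total R |x| with hx | hx
    · rw [h0 x hx, norm_zero]; exact hB0
    · exact hB x (abs_le.1 hx)
  have hlip : ∀ x y, |h x - h y| ≤ B * |x - y| := fun x y =>
    Convex.norm_image_sub_le_of_norm_hasDerivWithin_le (fun x _ => (hd x).hasDerivWithinAt)
      (fun x _ => hB' x) convex_univ (mem_univ y) (mem_univ x)
  have hright : ∀ x, R ≤ x → h x = h R := by
    intro x hx
    have := Convex.norm_image_sub_le_of_norm_hasDerivWithin_le (s := Ici R) (C := 0)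
      (fun x _ => (hd x).hasDerivWithinAt)
      (fun x hx => by rw [h0 x (le_trans hx (le_abs_self x)), norm_zero]) (convex_Ici R)
      (mem_Ici.2 le_rfl) (mem_Ici.2 hx)
    rw [zero_mul] at this
    exact sub_eq_zero.1 (norm_le_zero_iff.1 this)
  have hleft : ∀ x, x ≤ -R → h x = h (-R) := by
    intro x hx
    have := Convex.norm_image_sub_le_of_norm_hasDerivWithin_le (s := Iic (-R)) (C := 0)
      (fun x _ => (hd x).hasDerivWithinAt)
      (fun x hx => by
        have hx : x ≤ -R := hx
        rw [h0 x (by linarith [neg_le_abs x]), norm_zero]) (convex_Iic (-R))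
      (mem_Iic.2 le_rfl) (mem_Iic.2 hx)
    rw [zero_mul] at this
    exact sub_eq_zero.1 (norm_le_zero_iff.1 this)
  have hclamp : ∀ x, ∃ y, |y| ≤ R ∧ h x = h y := by
    intro x
    rcases le_total x (-R) with hx | hx
    · exact ⟨-R, by rw [abs_neg, abs_of_nonneg hR0], hleft x hx⟩
    rcases le_total R x with hx' | hx'
    · exact ⟨R, (abs_of_nonneg hR0).le, hright x hx'⟩
    · exact ⟨x, abs_le.2 ⟨hx, hx'⟩, rfl⟩
  refine ⟨B * (1 + 2 * R), by positivity, fun x y => ?_⟩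
  rcases le_total |x - y| 1 with hxy | hxy
  · have : |x - y| ≤ |x - y| ^ ε := by
      conv_lhs => rw [← Real.rpow_one |x - y|]
      rcases (abs_nonneg (x - y)).eq_or_lt with h | h
      · rw [← h, Real.zero_rpow one_ne_zero, Real.zero_rpow hε.ne']
      · exact Real.rpow_le_rpow_of_exponent_ge h hxy hε1
    refine (hlip x y).trans ?_
    have h2 : B * |x - y| ≤ B * |x - y| ^ ε := by gcongr
    have h3 : 0 ≤ B * (2 * R) * |x - y| ^ ε := by positivity
    linarith
  · obtain ⟨x', hx', ex⟩ := hclamp x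
    obtain ⟨y', hy', ey⟩ := hclamp y
    have h1 : 1 ≤ |x - y| ^ ε := Real.one_le_rpow hxy hε.le
    have h2 : |x' - y'| ≤ 2 * R := (abs_sub x' y').trans (by linarith)
    rw [ex, ey]
    calc |h x' - h y'| ≤ B * (2 * R) := (hlip x' y').trans (by gcongr)
      _ ≤ B * (1 + 2 * R) * 1 := by nlinarith
      _ ≤ _ := by gcongr

section Modification

variable {K : Set ℝ} {k : ℕ} {ε : ℝ} {F : ℝ → ℝ}

/-- Target slope in the gap `(p, q)`: the average of `F'` with the weight of the modification. -/
noncomputable def gapSlope (F : ℝ → ℝ) (r r' p q : ℝ) : ℝ :=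
  if p = q then 1 / 2
  else (∫ t in p..q, gapWeight r r' p q t * deriv F t) / ∫ t in p..q, gapWeight r r' p q t

/-- Change of the derivative in the gap `(p, q)`. -/
noncomputable def gapChange (F : ℝ → ℝ) (r r' p q x : ℝ) : ℝ :=
  gapWeight r r' p q x * (gapSlope F r r' p q - deriv F x)

theorem gapChange_continuous (hF : Continuous (deriv F)) (r r' p q : ℝ) :
    Continuous (gapChange F r r' p q) :=
  (gapWeight_contDiff r r' p q (n := 0)).continuous.mul (continuous_const.sub hF)

theorem integral_gapWeight_ge {r r' p q : ℝ} (hr' : 0 < r') (hrr : r' < r) (hpq : p < q)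
    (hl : 2 * r ≤ q - p) : q - p - 2 * r' ≤ ∫ t in p..q, gapWeight r r' p q t := by
  have hc := (gapWeight_contDiff r r' p q (n := 0)).continuous
  have h1 : ∫ t in (p + r')..(q - r'), gapWeight r r' p q t = q - p - 2 * r' := by
    have : ∫ t in (p + r')..(q - r'), gapWeight r r' p q t = ∫ _ in (p + r')..(q - r'), (1 : ℝ) := by
      refine intervalIntegral.integral_congr fun t ht => ?_
      rw [uIcc_of_le (by linarith)] at ht
      exact gapWeight_middle hr' hpq.ne hl ht.1 ht.2
    rw [this, intervalIntegral.integral_const, smul_eq_mul, mul_one]; ring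
  rw [← h1]
  exact intervalIntegral.integral_mono_interval (by linarith) (by linarith) (by linarith)
    (Eventually.of_forall fun t => (gapWeight_mem hr').1) (hc.intervalIntegrable _ _)

/-- This is the purpose of the weighted average `gapSlope`: the total change over a gap is zero, so
the modified function keeps its values at both ends. -/
theorem integral_gapChange {r r' p q : ℝ} (hF : Continuous (deriv F)) (hr' : 0 < r')
    (hrr : r' < r) (hpq : p ≤ q) : ∫ t in p..q, gapChange F r r' p q t = 0 := by
  rcases hpq.eq_or_lt with rfl | hlt
  · simp
  have hc := (gapWeight_contDiff r r' p q (n := 0)).continuous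
  by_cases hl : 2 * r ≤ q - p
  · have hI := integral_gapWeight_ge hr' hrr hlt hl
    have hI0 : (∫ t in p..q, gapWeight r r' p q t) ≠ 0 := by
      have : 0 < q - p - 2 * r' := by linarith
      exact (this.trans_le hI).ne'
    have e : ∀ t, gapChange F r r' p q t = gapSlope F r r' p q * gapWeight r r' p q t -
        gapWeight r r' p q t * deriv F t := fun t => by unfold gapChange; ring
    have hm : Continuous fun t => gapWeight r r' p q t * deriv F t := hc.mul hF
    simp only [e]
    rw [intervalIntegral.integral_sub ((hc.const_mul _).intervalIntegrable _ _)
      (hm.intervalIntegrable _ _), intervalIntegral.integral_const_mul, gapSlope,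
      if_neg hlt.ne, div_mul_cancel₀ _ hI0, sub_self]
  · have : ∀ t, gapChange F r r' p q t = 0 := fun t => by
      unfold gapChange gapWeight
      rw [if_neg hlt.ne, if_pos (not_le.1 hl), zero_mul]
    simp [this]

/-- The weight is `1` except on a set of total length at most `2 * r'`, where `F'` lies in `(0,1)`.
So numerator and denominator differ from `F q - F p` and `q - p` by at most `2 * r'`, a small
fraction of `q - p` by the choice of `r'`. -/
theorem gapSlope_mem {r r' p q a b : ℝ} (hFd : Differentiable ℝ F) (hF : Continuous (deriv F))
    (ha : 0 < a) (hb : b < 1) (hr' : 0 < r') (hrr : r' < r)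
    (hra : r' ≤ r * (a / 4)) (hrb : r' ≤ r * ((1 - b) / 4)) (hpq : p < q) (hl : 2 * r ≤ q - p)
    (hnear : ∀ x ∈ Icc p q, gapWeight r r' p q x ≠ 1 → deriv F x ∈ Ioo 0 1)
    (h1 : a * (q - p) ≤ F q - F p) (h2 : F q - F p ≤ b * (q - p)) :
    gapSlope F r r' p q ∈ Icc (a / 2) ((1 + b) / 2) := by
  have hc := (gapWeight_contDiff r r' p q (n := 0)).continuous
  have hI := integral_gapWeight_ge hr' hrr hpq hl
  have hFTC : ∫ t in p..q, deriv F t = F q - F p :=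
    intervalIntegral.integral_eq_sub_of_hasDerivAt (fun x _ => (hFd x).hasDerivAt)
      (hF.intervalIntegrable _ _)
  have hsplit : ∫ t in p..q, gapWeight r r' p q t * deriv F t =
      (F q - F p) - ∫ t in p..q, (1 - gapWeight r r' p q t) * deriv F t := by
    have hm : Continuous fun t => (1 - gapWeight r r' p q t) * deriv F t :=
      (continuous_const.sub hc).mul hF
    rw [← hFTC, ← intervalIntegral.integral_sub (hF.intervalIntegrable _ _)
      (hm.intervalIntegrable _ _)]
    refine intervalIntegral.integral_congr fun t _ => ?_
    ring
  have hone : ∫ t in p..q, (1 - gapWeight r r' p q t) =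
      (q - p) - ∫ t in p..q, gapWeight r r' p q t := by
    rw [intervalIntegral.integral_sub (continuous_const.intervalIntegrable _ _)
      (hc.intervalIntegrable _ _), intervalIntegral.integral_const, smul_eq_mul, mul_one]
  have hpt : ∀ x ∈ Icc p q, 0 ≤ (1 - gapWeight r r' p q x) * deriv F x ∧
      (1 - gapWeight r r' p q x) * deriv F x ≤ 1 - gapWeight r r' p q x := by
    intro x hx
    have hw := gapWeight_mem (r := r) (p := p) (q := q) (x := x) hr'
    by_cases h : gapWeight r r' p q x = 1
    · rw [h]; simp
    · have := hnear x hx h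
      exact ⟨mul_nonneg (by linarith [hw.2]) this.1.le,
        mul_le_of_le_one_right (by linarith [hw.2]) this.2.le⟩
  have hlow : 0 ≤ ∫ t in p..q, (1 - gapWeight r r' p q t) * deriv F t :=
    intervalIntegral.integral_nonneg hpq.le fun x hx => (hpt x hx).1
  have hup : ∫ t in p..q, (1 - gapWeight r r' p q t) * deriv F t ≤
      ∫ t in p..q, (1 - gapWeight r r' p q t) :=
    intervalIntegral.integral_mono_on hpq.le
      (((continuous_const.sub hc).mul hF).intervalIntegrable _ _)
      ((continuous_const.sub hc).intervalIntegrable _ _) fun x hx => (hpt x hx).2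
  have hI1 : ∫ t in p..q, gapWeight r r' p q t ≤ q - p := by
    have := hlow.trans hup
    linarith
  have hIpos : 0 < ∫ t in p..q, gapWeight r r' p q t := by linarith
  rw [gapSlope, if_neg hpq.ne, hsplit]
  set I := ∫ t in p..q, gapWeight r r' p q t
  set W := ∫ t in p..q, (1 - gapWeight r r' p q t) * deriv F t
  have hl0 : 0 < q - p := by linarith
  have hab : a ≤ b := by
    by_contra! h
    nlinarith
  have e1 : 2 * r' ≤ (q - p) * (a / 4) := by nlinarith
  have e2 : 2 * r' ≤ (q - p) * ((1 - b) / 4) := by nlinarith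
  constructor
  · rw [le_div_iff₀ hIpos]
    have : a / 2 * I ≤ a / 2 * (q - p) := by gcongr
    nlinarith
  · rw [div_le_iff₀ hIpos]
    have h3 : (1 + b) / 2 * ((q - p) - (q - p) * ((1 - b) / 4)) ≤ (1 + b) / 2 * I := by
      have : 0 ≤ (1 + b) / 2 := by linarith
      refine mul_le_mul_of_nonneg_left ?_ this
      linarith
    have h4 : b * (q - p) ≤ (1 + b) / 2 * ((q - p) - (q - p) * ((1 - b) / 4)) := by
      have : 0 ≤ (q - p) * ((1 - b) * (3 - b)) :=
        mul_nonneg hl0.le (mul_nonneg (by linarith) (by linarith))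
      nlinarith
    linarith

/-- A `C^{k+ε}` function which is an increasing contraction of a compact set `K` at all scales can
be modified off `K` to an increasing contraction of the line. -/
theorem exists_contraction (hF : IsCkHolder k ε F) (hk : 1 ≤ k) (hε : 0 < ε) (hε1 : ε ≤ 1)
    (hK : IsCompact K) (hne : K.Nonempty) (hsm : ∀ x ∉ K, ∀ n : ℕ, ContDiffAt ℝ n F x)
    (hray : ∀ x ∉ K, leftPt K x = rightPt K x → iteratedDeriv (k + 1) F x = 0)
    {a b : ℝ} (ha : 0 < a) (hb : b < 1) (hderiv : ∀ x ∈ K, deriv F x ∈ Icc a b)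
    (hgap : ∀ x ∈ K, ∀ y ∈ K, x < y → (∀ z ∈ K, z ≤ x ∨ y ≤ z) →
      a * (y - x) ≤ F y - F x ∧ F y - F x ≤ b * (y - x)) :
    ∃ G : ℝ → ℝ, IsCkHolder k ε G ∧ (∃ c, ContractingWith c G) ∧ (∀ x, 0 < deriv G x) ∧
      ∀ x ∈ K, G x = F x := by
  have hFd : Differentiable ℝ F := hF.1.differentiable (by
    have : k ≠ 0 := by omega
    exact_mod_cast this)
  have hFc : Continuous (deriv F) := hF.1.continuous_deriv (by exact_mod_cast hk)
  have hab : a ≤ b := by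
    obtain ⟨x, hx⟩ := hne
    exact (hderiv x hx).1.trans (hderiv x hx).2
  -- By compactness `F'` is already good within distance `r` of `K`. Gaps shorter than `2 * r`
  -- therefore need no change.
  obtain ⟨r, hr, hrK⟩ := hK.exists_thickening_subset_open
    (isOpen_Ioo.preimage hFc : IsOpen (deriv F ⁻¹' Ioo (a / 2) ((1 + b) / 2)))
    (fun x hx => ⟨by linarith [(hderiv x hx).1], by linarith [(hderiv x hx).2]⟩)
  have hnear : ∀ x, ∀ y ∈ K, |x - y| < r → deriv F x ∈ Ioo (a / 2) ((1 + b) / 2) := by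
    intro x y hy hxy
    exact hrK (Metric.mem_thickening_iff.2 ⟨y, hy, by rwa [Real.dist_eq]⟩)
  -- Small against `r` times both `a` and `1 - b`, so that the two estimates required by
  -- `gapSlope_mem` hold at once.
  obtain ⟨r', hr'def⟩ : ∃ r', r' = r * (a * (1 - b) / 4) := ⟨_, rfl⟩
  have hb1 : 0 < 1 - b := by linarith
  have hr' : 0 < r' := by rw [hr'def]; positivity
  have hra : r' ≤ r * (a / 4) := by
    rw [hr'def]
    refine mul_le_mul_of_nonneg_left ?_ hr.le
    nlinarith
  have hrb : r' ≤ r * ((1 - b) / 4) := by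
    rw [hr'def]
    refine mul_le_mul_of_nonneg_left ?_ hr.le
    nlinarith
  have hrr : r' < r := by nlinarith
  let P := leftPt K
  let Q := rightPt K
  have hcase : ∀ x, P x ∈ K ∧ Q x ∈ K ∧ (P x = Q x ∨ P x < Q x ∧ P x ≤ x ∧ x ≤ Q x ∧
      ∀ y ∈ K, y ≤ P x ∨ Q x ≤ y) := by
    intro x
    obtain ⟨h1, h2, h⟩ := pts_cases hK.isClosed hne x
    refine ⟨h1, h2, ?_⟩
    rcases h with ⟨h3, h4, h5⟩ | ⟨h3, -⟩
    · rcases (h3.trans h4).eq_or_lt with h | h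
      · exact Or.inl h
      · exact Or.inr ⟨h, h3, h4, h5⟩
    · exact Or.inl h3
  let B : ℝ → ℝ := fun x => ∫ t in (P x)..x, gapChange F r r' (P x) (Q x) t
  let B' : ℝ → ℝ := fun x => gapChange F r r' (P x) (Q x) x
  -- Near the left end of a gap, or of a ray, the weight vanishes from the base point on. Near the
  -- right end the weight vanishes from there to the end, and the total integral over the gap is
  -- zero.
  have hzero : ∀ x, ∀ y ∈ K, |x - y| ≤ r' / 3 → B x = 0 ∧ B' x = 0 := by
    intro x y hy hxy
    have hc : |x - P x| ≤ r' / 3 ∨ P x < Q x ∧ P x ≤ x ∧ x ≤ Q x ∧ |x - Q x| ≤ r' / 3 := by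
      obtain ⟨-, -, h⟩ := pts_cases hK.isClosed hne x
      rcases h with ⟨h1, h2, h3⟩ | ⟨-, h⟩
      · rcases h3 y hy with h | h
        · left
          refine le_trans ?_ hxy
          rw [abs_of_nonneg (by linarith), abs_of_nonneg (by linarith)]; linarith
        · rcases (h1.trans h2).eq_or_lt with h4 | h4
          · left
            have : x = P x := le_antisymm (h2.trans h4.symm.le) h1
            rw [← this, sub_self, abs_zero]; positivity
          · right
            refine ⟨h4, h1, h2, le_trans ?_ hxy⟩
            rw [abs_of_nonpos (by linarith), abs_of_nonpos (by linarith)]; linarith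
      · exact Or.inl ((h y hy).trans hxy)
    rcases hc with hc | ⟨hPQ, hc1, hc2, hc⟩
    · refine ⟨?_, by simp only [B', gapChange, gapWeight_left hr' hc, zero_mul]⟩
      have : ∫ t in (P x)..x, gapChange F r r' (P x) (Q x) t = ∫ _ in (P x)..x, (0 : ℝ) := by
        refine intervalIntegral.integral_congr fun t ht => ?_
        have : |t - P x| ≤ r' / 3 := (abs_sub_left_of_mem_uIcc ht).trans hc
        simp only [gapChange, gapWeight_left hr' this, zero_mul]
      simpa [B] using this
    · refine ⟨?_, by simp only [B', gapChange, gapWeight_right hr' hc, zero_mul]⟩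
      have h1 : ∫ t in x..(Q x), gapChange F r r' (P x) (Q x) t = ∫ _ in x..(Q x), (0 : ℝ) := by
        refine intervalIntegral.integral_congr fun t ht => ?_
        rw [uIcc_of_le hc2] at ht
        have : |t - Q x| ≤ r' / 3 := by
          refine le_trans ?_ hc
          rw [abs_of_nonpos (by linarith [ht.2]), abs_of_nonpos (by linarith)]
          linarith [ht.1]
        simp only [gapChange, gapWeight_right hr' this, zero_mul]
      have h2 := integral_gapChange (r := r) (r' := r') hFc hr' hrr hPQ.le
      have hcg := gapChange_continuous hFc r r' (P x) (Q x)
      rw [← intervalIntegral.integral_add_adjacent_intervals (hcg.intervalIntegrable _ x)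
        (hcg.intervalIntegrable x _), h1, intervalIntegral.integral_zero, add_zero] at h2
      exact h2
  have hev0 : ∀ x ∈ K, ∀ᶠ z in 𝓝 x, B z = 0 ∧ B' z = 0 := by
    intro x hx
    filter_upwards [Metric.ball_mem_nhds x (show 0 < r' / 3 by positivity)] with z hz
    exact hzero z x hx (by rw [← Real.dist_eq]; exact hz.le)
  have hloc : ∀ x ∉ K, ∀ᶠ z in 𝓝 x, B z = ∫ t in (P x)..z, gapChange F r r' (P x) (Q x) t ∧
      B' z = gapChange F r r' (P x) (Q x) z := by
    intro x hx
    filter_upwards [pts_eventually hK.isClosed hx] with z hz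
    simp only [B, B', P, Q, hz.1, hz.2, and_self]
  have hBd : ∀ x, HasDerivAt B (B' x) x := by
    intro x
    by_cases hx : x ∈ K
    · rw [(hev0 x hx).self_of_nhds.2]
      exact (hasDerivAt_const x 0).congr_of_eventuallyEq ((hev0 x hx).mono fun z hz => hz.1)
    · rw [(hloc x hx).self_of_nhds.2]
      have hcg := gapChange_continuous hFc r r' (P x) (Q x)
      exact ((hcg.integral_hasStrictDerivAt _ x).hasDerivAt).congr_of_eventuallyEq
        ((hloc x hx).mono fun z hz => hz.1)
  have hB'sm : ContDiff ℝ k B' := by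
    rw [contDiff_iff_contDiffAt]
    intro x
    by_cases hx : x ∈ K
    · exact (contDiffAt_const (c := (0 : ℝ))).congr_of_eventuallyEq
        ((hev0 x hx).mono fun z hz => hz.2)
    · have h1 : ContDiffAt ℝ k (deriv F) x :=
        (hsm x hx (k + 1)).derivWithin (by push_cast; exact le_rfl)
      have h2 : ContDiffAt ℝ k (gapWeight r r' (P x) (Q x)) x :=
        (gapWeight_contDiff r r' (P x) (Q x) (n := k)).contDiffAt
      exact (h2.mul (contDiffAt_const.sub h1)).congr_of_eventuallyEq
        ((hloc x hx).mono fun z hz => hz.2)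
  have hderivB : deriv B = B' := funext fun x => (hBd x).deriv
  have hBsm : ContDiff ℝ (k + 1 : ℕ) B := by
    push_cast
    rw [contDiff_succ_iff_deriv]
    refine ⟨fun x => (hBd x).differentiableAt, fun h => ?_, hderivB ▸ hB'sm⟩
    exact absurd h (by exact_mod_cast WithTop.natCast_ne_top k)
  obtain ⟨R, hR⟩ : ∃ R, ∀ y ∈ K, |y| ≤ R := by
    obtain ⟨R, hR⟩ := hK.isBounded.exists_norm_le
    exact ⟨R, hR⟩
  -- Far out the weight is `1` and `B' = 1 / 2 - F'`, while the derivative of `F` of order `k + 1`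
  -- vanishes in the rays. So `B` inherits a global Hölder bound from `holder_of_deriv_support`.
  have hfar : ∀ x, R + r' < |x| → iteratedDeriv k B' x = 0 := by
    intro x hx
    have hdist : ∀ y ∈ K, ∀ z, R + r' < |z| → r' ≤ |z - y| := by
      intro y hy z hz
      have := abs_sub_abs_le_abs_sub z y
      linarith [hR y hy]
    have hPQ : ∀ z, R + r' < |z| → P z = Q z := by
      intro z hz
      obtain ⟨h1, h2, h | ⟨-, h3, h4, -⟩⟩ := hcase z
      · exact h
      · have := hR _ h1
        have := hR _ h2
        rw [abs_le] at *
        have : |z| ≤ R := abs_le.2 ⟨by linarith, by linarith⟩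
        linarith
    have hxK : x ∉ K := fun h => by linarith [hR x h]
    have hopen : ∀ᶠ z in 𝓝 x, R + r' < |z| := (continuous_abs.tendsto x).eventually (lt_mem_nhds hx)
    have e : B' =ᶠ[𝓝 x] fun z => 1 / 2 - deriv F z := by
      filter_upwards [hopen] with z hz
      have h1 := hPQ z hz
      simp only [B', gapChange, ← h1, gapSlope, if_true]
      rw [gapWeight_ray hr' (hdist _ (hcase z).1 z hz), one_mul]
    rw [e.iteratedDeriv_eq, iteratedDeriv_const_sub (by omega), iteratedDeriv_neg,
      ← iteratedDeriv_succ', hray x hxK (hPQ x hx), neg_zero]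
  obtain ⟨C, hC0, hC⟩ := holder_of_deriv_support (h := iteratedDeriv k B)
    (h' := iteratedDeriv k B') (R := R + r') (ε := ε) (fun x => by
      rw [← hderivB, ← iteratedDeriv_succ', iteratedDeriv_succ]
      exact ((hBsm.differentiable_iteratedDeriv k
        (by exact_mod_cast Nat.lt_succ_self k)) x).hasDerivAt)
    (hB'sm.continuous_iteratedDeriv k le_rfl) hfar hε hε1
  obtain ⟨C', hC'⟩ := hF.2
  have hBk : ContDiff ℝ k B := hBsm.of_le (by exact_mod_cast Nat.le_succ k)
  have hGd : ∀ x, HasDerivAt (F + B) (deriv F x + B' x) x := fun x =>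
    (hFd x).hasDerivAt.add (hBd x)
  -- The new derivative is a convex combination of `F'` and the slope of the gap. Where the weight
  -- is not `1` the point is near `K` and `F'` is good; where it is not `0` the gap is long, or a
  -- ray, and the slope is good.
  have hrange : ∀ x, deriv F x + B' x ∈ Icc (a / 2) ((1 + b) / 2) := by
    intro x
    obtain ⟨h1, h2, h⟩ := hcase x
    have hw := gapWeight_mem (r := r) (p := P x) (q := Q x) (x := x) hr'
    have hFx : gapWeight r r' (P x) (Q x) x ≠ 1 → deriv F x ∈ Ioo (a / 2) ((1 + b) / 2) := by
      intro hne1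
      rcases near_of_gapWeight_ne_one hr' hrr (h.imp_right fun h => ⟨h.1, h.2.1, h.2.2.1⟩) hne1
        with h | h
      · exact hnear x _ h1 h
      · exact hnear x _ h2 h
    have hs : gapWeight r r' (P x) (Q x) x ≠ 0 →
        gapSlope F r r' (P x) (Q x) ∈ Icc (a / 2) ((1 + b) / 2) := by
      intro hne0
      rcases h with h | ⟨h3, h4, h5, h6⟩
      · rw [gapSlope, if_pos h]; constructor <;> linarith
      · have hl : 2 * r ≤ Q x - P x := by
          by_contra! hl
          exact hne0 (by rw [gapWeight, if_neg h3.ne, if_pos hl])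
        obtain ⟨g1, g2⟩ := hgap _ h1 _ h2 h3 h6
        refine gapSlope_mem hFd hFc ha hb hr' hrr hra hrb h3 hl (fun z hz hz1 => ?_) g1 g2
        have : deriv F z ∈ Ioo (a / 2) ((1 + b) / 2) := by
          rcases near_of_gapWeight_ne_one hr' hrr (Or.inr ⟨h3, hz⟩) hz1 with h | h
          · exact hnear z _ h1 h
          · exact hnear z _ h2 h
        exact ⟨by linarith [this.1], by linarith [this.2]⟩
    have e : deriv F x + B' x = (1 - gapWeight r r' (P x) (Q x) x) * deriv F x +
        gapWeight r r' (P x) (Q x) x * gapSlope F r r' (P x) (Q x) := by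
      simp only [B', gapChange]; ring
    rw [e]
    by_cases w0 : gapWeight r r' (P x) (Q x) x = 0
    · have := hFx (by rw [w0]; exact zero_ne_one)
      rw [w0]
      simp only [sub_zero, one_mul, zero_mul, add_zero]
      exact ⟨this.1.le, this.2.le⟩
    by_cases w1 : gapWeight r r' (P x) (Q x) x = 1
    · rw [w1]; simpa using hs w0
    have hA := hFx w1
    exact convex_Icc (a / 2) ((1 + b) / 2) ⟨hA.1.le, hA.2.le⟩ (hs w0) (by linarith [hw.2]) hw.1
      (by ring)
  refine ⟨F + B, ⟨hF.1.add hBk, C' + C, fun x y => ?_⟩, ?_, fun x => ?_, fun x hx => ?_⟩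
  · rw [iteratedDeriv_add hF.1.contDiffAt hBk.contDiffAt,
      iteratedDeriv_add hF.1.contDiffAt hBk.contDiffAt, add_mul]
    have e : iteratedDeriv k F x + iteratedDeriv k B x -
        (iteratedDeriv k F y + iteratedDeriv k B y) =
        (iteratedDeriv k F x - iteratedDeriv k F y) +
        (iteratedDeriv k B x - iteratedDeriv k B y) := by ring
    rw [e]
    exact (abs_add_le _ _).trans (add_le_add (hC' x y) (hC x y))
  · have hc0 : 0 ≤ (1 + b) / 2 := by linarith
    refine ⟨((1 + b) / 2).toNNReal, ?_, ?_⟩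
    · rw [Real.toNNReal_lt_one]; linarith
    · refine lipschitzWith_of_nnnorm_deriv_le (fun x => (hGd x).differentiableAt) fun x => ?_
      rw [(hGd x).deriv, ← NNReal.coe_le_coe, Real.coe_toNNReal _ hc0, coe_nnnorm,
        Real.norm_eq_abs, abs_of_nonneg (by linarith [(hrange x).1])]
      exact (hrange x).2
  · rw [(hGd x).deriv]; linarith [(hrange x).1]
  · have := (hev0 x hx).self_of_nhds.1
    simp [this]

end Modification

end CantorScaling

/-! ### Jets on a Cantor set -/

namespace CantorScaling

/-- A chain of derivatives that vanishes beyond the order `k` agrees with its jets. -/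
theorem eq_jet_of_chain {k : ℕ} {U : ℕ → ℝ → ℝ} (hU : ∀ m y, HasDerivAt (U m) (U (m + 1) y) y)
    (h0 : ∀ m, k < m → U m = 0) (m : ℕ) (y x : ℝ) : U m x = jet k U m y x := by
  have key : ∀ n, ∀ m, k + 1 - m = n → ∀ x, U m x = jet k U m y x := by
    intro n
    induction n with
    | zero =>
      intro m hm x
      rw [h0 m (by omega), jet_eq_zero U (by omega)]; rfl
    | succ n ih =>
      intro m hm x
      have hd : ∀ x, HasDerivAt (fun x => U m x - jet k U m y x) 0 x := fun x =>
        ((hU m x).sub (jet_hasDerivAt k U m y x)).congr_deriv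
          (by rw [ih (m + 1) (by omega), sub_self])
      have := is_const_of_deriv_eq_zero (fun x => (hd x).differentiableAt)
        (fun x => (hd x).deriv) x y
      simp only [jet_self U (show m ≤ k by omega), sub_self] at this
      linarith
  exact key _ m rfl x

section Jets

variable {d k : ℕ} {T : List (Fin d) → Coord d → ℝ} {t δ ε : ℝ}

theorem pow_le_len (hδ : 0 ≤ δ) (hTδ : ∀ l c, δ ≤ T l c) (l : List (Fin d)) :
    δ ^ l.length ≤ len T l := by
  induction l with
  | nil => simp [len]
  | cons c l ih =>
    rw [List.length_cons, pow_succ, len]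
    exact mul_le_mul ih (hTδ _ _) hδ ((by positivity : (0 : ℝ) ≤ δ ^ l.length).trans ih)

theorem len_pre_add_le (hT : ∀ l, T l ∈ simp d) (ht : ∀ l c, T l c ≤ t) (α : Word d) (n j : ℕ) :
    len T (pre α (n + j)) ≤ t ^ j * len T (pre α n) := by
  induction j with
  | zero => simp
  | succ j ih =>
    have h0 : 0 ≤ t := (simp_pos (hT []) (Sum.inl (α 0))).le.trans (ht _ _)
    rw [pow_succ', mul_assoc]
    exact (len_cons_le hT ht _ _).trans (mul_le_mul_of_nonneg_left ih h0)

theorem len_le_one (hT : ∀ l, T l ∈ simp d) (l : List (Fin d)) : len T l ≤ 1 := by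
  have := len_le_pow hT (t := 1) (fun l c => ((hT l).1 c).2.le) l
  simpa using this

/-- Along the nested intervals around a point successive approximants differ by terms of a geometric
series, since lengths shrink by `t` at each level and every exponent is at least `ε`. The tail of
the series is a multiple of its first term. -/
theorem exists_limit_jets (hT : ∀ l, T l ∈ simp d) (ht : ∀ l c, T l c ≤ t) (ht1 : t < 1)
    (hε : 0 < ε) {C : ℝ} (hC : 0 ≤ C) {N : ℕ} {U : List (Fin d) → ℕ → ℝ → ℝ}
    (hUC : ∀ l c, N ≤ l.length → ∀ m ≤ k, ∀ y ∈ Icc (lft T (c :: l)) (rgt T (c :: l)),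
      |U (c :: l) m y - U l m y| ≤ C * len T (c :: l) ^ ((k : ℝ) - m + ε)) :
    ∃ (f : ℕ → ℝ → ℝ) (C' : ℝ), 0 ≤ C' ∧ ∀ (α : Word d), ∀ m ≤ k, ∀ n ≥ N,
      |f m (cantorMap T α) - U (pre α n) m (cantorMap T α)| ≤
        C' * len T (pre α n) ^ ((k : ℝ) - m + ε) := by
  rcases isEmpty_or_nonempty (Fin d) with hemp | ⟨⟨c₀⟩⟩
  · exact ⟨fun _ _ => 0, 0, le_rfl, fun α => hemp.elim (α 0)⟩
  have ht0 : 0 < t := (simp_pos (hT []) (Sum.inl c₀)).trans_le (ht _ _)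
  have hr1 : t ^ ε < 1 := Real.rpow_lt_one ht0.le ht1 hε
  have step : ∀ (α : Word d), ∀ m ≤ k, ∀ n ≥ N, ∀ j,
      dist (U (pre α (n + j)) m (cantorMap T α)) (U (pre α (n + (j + 1))) m (cantorMap T α)) ≤
        C * len T (pre α n) ^ ((k : ℝ) - m + ε) * (t ^ ε) ^ j := by
    intro α m hm n hn j
    rw [dist_comm, Real.dist_eq, mul_assoc]
    refine (hUC (pre α (n + j)) (α (n + j)) (by rw [pre_length]; omega) m hm _
      ⟨lft_le_cantorMap hT α (n + j + 1), cantorMap_le_rgt hT α (n + j + 1)⟩).trans ?_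
    refine mul_le_mul_of_nonneg_left ?_ hC
    have hp := wexp_pos hε hm
    have h1 : len T (α (n + j) :: pre α (n + j)) ≤ t ^ j * len T (pre α n) :=
      (len_cons_le hT ht _ _).trans ((mul_le_of_le_one_left (len_pos hT _).le ht1.le).trans
        (len_pre_add_le hT ht α n j))
    refine (Real.rpow_le_rpow (len_pos hT _).le h1 hp.le).trans ?_
    rw [Real.mul_rpow (by positivity) (len_pos hT _).le, mul_comm]
    refine mul_le_mul_of_nonneg_left ?_ (Real.rpow_nonneg (len_pos hT _).le _)
    rw [← Real.rpow_natCast t, ← Real.rpow_natCast (t ^ ε), ← Real.rpow_mul ht0.le,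
      ← Real.rpow_mul ht0.le]
    refine Real.rpow_le_rpow_of_exponent_ge ht0 ht1.le ?_
    have : (m : ℝ) ≤ k := by exact_mod_cast hm
    have : (0 : ℝ) ≤ j := by positivity
    nlinarith
  have hlim : ∀ (α : Word d) (m : ℕ), ∃ a, m ≤ k →
      Tendsto (fun j => U (pre α (N + j)) m (cantorMap T α)) atTop (𝓝 a) := by
    intro α m
    by_cases hm : m ≤ k
    · obtain ⟨a, ha⟩ := cauchySeq_tendsto_of_complete
        (cauchySeq_of_le_geometric _ _ hr1 (step α m hm N le_rfl))
      exact ⟨a, fun _ => ha⟩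
    · exact ⟨0, fun h => absurd h hm⟩
  choose g hg using hlim
  refine ⟨fun m => Function.extend (cantorMap T) (fun α => g α m) 0, C / (1 - t ^ ε),
    div_nonneg hC (by linarith), fun α m hm n hn => ?_⟩
  simp only [(cantorMap_injective hT).extend_apply]
  have hlim' : Tendsto (fun j => U (pre α (n + j)) m (cantorMap T α)) atTop (𝓝 (g α m)) := by
    refine ((hg α m hm).comp (tendsto_add_atTop_nat (n - N))).congr fun j => ?_
    simp only [Function.comp]
    rw [show N + (j + (n - N)) = n + j by omega]
  have := dist_le_of_le_geometric_of_tendsto _ _ hr1 (step α m hm n hn) hlim' 0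
  rw [dist_comm, Real.dist_eq, pow_zero, mul_one] at this
  simpa [mul_div_right_comm] using this

/-- Let `x` and `y` separate at level `n ≥ N`. The approximant `U` on their common interval equals
its own jet, so the data at `x` and the jet at `y` are both compared with it, and the errors are
powers of a length comparable to `|x - y|`. If `n < N`, then `|x - y|` is bounded below and
boundedness of the data suffices. -/
theorem exists_whitneyData (hT : ∀ l, T l ∈ simp d) (ht : ∀ l c, T l c ≤ t) (ht1 : t < 1)
    (hδ : 0 < δ) (hTδ : ∀ l c, δ ≤ T l c)
    (hε : 0 < ε) (hε1 : ε ≤ 1) {C : ℝ} (hC : 0 ≤ C) {N : ℕ} {U : List (Fin d) → ℕ → ℝ → ℝ}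
    (hU : ∀ l m y, HasDerivAt (U l m) (U l (m + 1) y) y) (hU0 : ∀ l m, k < m → U l m = 0)
    (hUC : ∀ l c, N ≤ l.length → ∀ m ≤ k, ∀ y ∈ Icc (lft T (c :: l)) (rgt T (c :: l)),
      |U (c :: l) m y - U l m y| ≤ C * len T (c :: l) ^ ((k : ℝ) - m + ε)) :
    ∃ (f : ℕ → ℝ → ℝ) (M : ℝ), 0 ≤ M ∧ WhitneyData (range (cantorMap T)) k ε M f ∧
      ∀ (α : Word d), ∀ m ≤ k, ∀ n ≥ N,
      |f m (cantorMap T α) - U (pre α n) m (cantorMap T α)| ≤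
        M * len T (pre α n) ^ ((k : ℝ) - m + ε) := by
  rcases isEmpty_or_nonempty (Fin d) with hemp | ⟨⟨c₀⟩⟩
  · refine ⟨fun _ _ => 0, 0, le_rfl, ?_, fun α => hemp.elim (α 0)⟩
    rintro _ ⟨α, rfl⟩
    exact hemp.elim (α 0)
  obtain ⟨f, C', hC', hf⟩ := exists_limit_jets hT ht ht1 hε hC hUC
  have hδ1 : δ < 1 := (hTδ [] (Sum.inl c₀)).trans_lt ((hT []).1 _).2
  have hbound : ∃ A, 0 ≤ A ∧ ∀ (α : Word d), ∀ m ≤ k, |f m (cantorMap T α)| ≤ A := by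
    have h1 : ∀ l m, ∃ A, ∀ y ∈ UI, |U l m y| ≤ A := fun l m =>
      isCompact_Icc.exists_bound_of_continuousOn
        (fun y _ => (hU l m y).continuousAt.continuousWithinAt)
    choose A hA using h1
    have hfin : (⋃ m ∈ Finset.range (k + 1), (fun l => A l m) ''
        {l : List (Fin d) | l.length = N}).Finite :=
      (Finset.range (k + 1)).finite_toSet.biUnion fun m _ => (List.finite_length_eq _ _).image _
    obtain ⟨A₀, hA₀⟩ := hfin.bddAbove
    refine ⟨|A₀| + C', by positivity, fun α m hm => ?_⟩
    have h2 := hf α m hm N le_rfl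
    have h3 : |U (pre α N) m (cantorMap T α)| ≤ A₀ :=
      (hA _ m _ (cantorMap_mem hT α)).trans (hA₀ (mem_iUnion₂.2
        ⟨m, Finset.mem_range.2 (by omega), mem_image_of_mem _ (pre_length α N)⟩))
    have h4 : C' * len T (pre α N) ^ ((k : ℝ) - m + ε) ≤ C' :=
      mul_le_of_le_one_right hC' (Real.rpow_le_one (len_pos hT _).le (len_le_one hT _)
        (wexp_pos hε hm).le)
    have h5 := abs_add_le (f m (cantorMap T α) - U (pre α N) m (cantorMap T α))
      (U (pre α N) m (cantorMap T α))
    rw [sub_add_cancel] at h5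
    linarith [le_abs_self A₀]
  obtain ⟨A, hA0, hA⟩ := hbound
  have hfact : ∀ r : ℕ, (1 : ℝ) ≤ r.factorial := fun r => by
    exact_mod_cast r.factorial_pos
  have hdivf : ∀ (a : ℝ) (r : ℕ), 0 ≤ a → a / r.factorial ≤ a := fun a r ha =>
    div_le_self ha (hfact r)
  -- Serves both cases: it dominates `1 / δ`, which compares lengths with distances, and `E * |x -
  -- y| ≥ 1` for points that separate before level `N`.
  obtain ⟨E, hE⟩ : ∃ E, E = 1 / (δ * δ ^ N) := ⟨_, rfl⟩
  have hη : 0 < δ * δ ^ N := by positivity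
  have hη1 : δ * δ ^ N ≤ 1 := mul_le_one₀ hδ1.le (by positivity) (pow_le_one₀ hδ.le hδ1.le)
  have hE1 : 1 ≤ E := by rw [hE, le_div_iff₀ hη]; linarith
  have hEδ : 1 / δ ≤ E := by
    rw [hE]
    exact one_div_le_one_div_of_le hη (mul_le_of_le_one_right hδ.le (pow_le_one₀ hδ.le hδ1.le))
  obtain ⟨M, hM⟩ : ∃ M, M = (k + 2) * (A + C') * E ^ (k + 1) := ⟨_, rfl⟩
  have hM0 : C' ≤ M := by
    have h1 : (1 : ℝ) ≤ E ^ (k + 1) := one_le_pow₀ hE1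
    have h2 : C' ≤ (k + 2) * (A + C') := by
      have : (0 : ℝ) ≤ k := by positivity
      nlinarith
    rw [hM]
    exact h2.trans (le_mul_of_one_le_right (hC'.trans h2) h1)
  refine ⟨f, M, hC'.trans hM0, ?_, fun α m hm n hn => (hf α m hm n hn).trans
    (mul_le_mul_of_nonneg_right hM0 (Real.rpow_nonneg (len_pos hT _).le _))⟩
  rintro _ ⟨α, rfl⟩ _ ⟨β, rfl⟩ m hm
  by_cases hαβ : α = β
  · subst hαβ
    rw [jet_self f hm, sub_self, abs_zero, sub_self, abs_zero]
    exact mul_nonneg (hC'.trans hM0) (Real.rpow_nonneg le_rfl _)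
  obtain ⟨n, hn⟩ : ∃ n, n = PiNat.firstDiff α β := ⟨_, rfl⟩
  have heq : ∀ i < n, α i = β i := fun i hi => PiNat.apply_eq_of_lt_firstDiff (hn ▸ hi)
  have hneq : α n ≠ β n := hn ▸ PiNat.apply_firstDiff_ne hαβ
  have hpre : pre α n = pre β n := pre_congr heq
  obtain ⟨x, hx⟩ : ∃ x, x = cantorMap T α := ⟨_, rfl⟩
  obtain ⟨y, hy⟩ : ∃ y, y = cantorMap T β := ⟨_, rfl⟩
  have hle : |x - y| ≤ len T (pre α n) := hx ▸ hy ▸ cantorMap_dist_le hT heq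
  have hge : δ * len T (pre α n) ≤ |x - y| := by
    rw [mul_comm]
    rcases lt_or_gt_of_ne hneq with h | h
    · refine (mul_le_mul_of_nonneg_left (hTδ _ _) (len_pos hT _).le).trans
        ((cantorMap_sub_ge hT heq h).trans ?_)
      rw [← hx, ← hy, abs_sub_comm]; exact le_abs_self _
    · rw [hpre]
      refine (mul_le_mul_of_nonneg_left (hTδ _ _) (len_pos hT _).le).trans
        ((cantorMap_sub_ge hT (fun i hi => (heq i hi).symm) h).trans ?_)
      rw [← hx, ← hy]; exact le_abs_self _
  rw [← hx, ← hy]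
  have hp := wexp_pos (k := k) hε hm
  have hscale : ∀ c L : ℝ, 1 ≤ c → c ≤ E → 0 ≤ L → L ≤ c * |x - y| →
      L ^ ((k : ℝ) - m + ε) ≤ E ^ (k + 1) * |x - y| ^ ((k : ℝ) - m + ε) := by
    intro c L hc hcE hL hLc
    refine (Real.rpow_le_rpow hL hLc hp.le).trans
      ((mul_rpow_wexp_le hc hε1 (abs_nonneg _)).trans ?_)
    gcongr
  have hsum : ∀ B : ℕ → ℝ, ∀ G, 0 ≤ G → (∀ r ∈ Finset.range (k + 1 - m), |B r| ≤ G) →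
      |∑ r ∈ Finset.range (k + 1 - m), B r| ≤ (k + 1) * G := by
    intro B G hG hB
    refine (Finset.abs_sum_le_sum_abs _ _).trans ((Finset.sum_le_card_nsmul _ _ _ hB).trans ?_)
    rw [nsmul_eq_mul, Finset.card_range]
    refine mul_le_mul_of_nonneg_right ?_ hG
    have : ((k + 1 - m : ℕ) : ℝ) ≤ ((k + 1 : ℕ) : ℝ) := by exact_mod_cast Nat.sub_le _ _
    push_cast at this
    exact this
  rcases lt_or_ge n N with hnN | hnN
  · have hlow : 1 ≤ E * |x - y| := by
      rw [hE, one_div, ← div_eq_inv_mul, le_div_iff₀ hη, one_mul]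
      refine le_trans ?_ hge
      refine mul_le_mul_of_nonneg_left ?_ hδ.le
      have := pow_le_len hδ.le hTδ (pre α n)
      rw [pre_length] at this
      exact (pow_le_pow_of_le_one hδ.le hδ1.le hnN.le).trans this
    have hle1 : |x - y| ≤ 1 := hle.trans (len_le_one hT _)
    have h1 : |f m x - jet k f m y x| ≤ (k + 2) * (A + C') := by
      have h2 : |jet k f m y x| ≤ (k + 1) * A := by
        refine hsum _ A hA0 fun r hr => ?_
        rw [Finset.mem_range] at hr
        rw [abs_mul, abs_div, abs_pow, abs_of_nonneg (by positivity : (0 : ℝ) ≤ r.factorial)]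
        have h3 : |x - y| ^ r / r.factorial ≤ 1 :=
          (hdivf _ r (by positivity)).trans (pow_le_one₀ (abs_nonneg _) hle1)
        exact (mul_le_of_le_one_right (abs_nonneg _) h3).trans (hy ▸ hA β (m + r) (by omega))
      have h4 : |f m x| ≤ A := hx ▸ hA α m hm
      have h5 := abs_sub (f m x) (jet k f m y x)
      have : (0 : ℝ) ≤ (k + 2) * C' := by positivity
      linarith
    have h6 := hscale E 1 hE1 le_rfl zero_le_one hlow
    rw [Real.one_rpow] at h6
    refine h1.trans ?_
    rw [hM, mul_assoc]
    exact le_mul_of_one_le_right (by positivity) h6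
  · have hl0 := len_pos hT (pre α n)
    have hG0 : 0 ≤ C' * len T (pre α n) ^ ((k : ℝ) - m + ε) :=
      mul_nonneg hC' (Real.rpow_nonneg hl0.le _)
    have h1 : |f m x - jet k f m y x| ≤
        (k + 2) * (C' * len T (pre α n) ^ ((k : ℝ) - m + ε)) := by
      have h2 := hf α m hm n hnN
      rw [← hx, eq_jet_of_chain (hU _) (hU0 _) m y x] at h2
      have h3 : |jet k (U (pre α n)) m y x - jet k f m y x| ≤
          (k + 1) * (C' * len T (pre α n) ^ ((k : ℝ) - m + ε)) := by
        unfold jet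
        rw [← Finset.sum_sub_distrib]
        refine hsum _ _ hG0 fun r hr => ?_
        rw [Finset.mem_range] at hr
        rw [← sub_mul, abs_mul, abs_div, abs_pow,
          abs_of_nonneg (by positivity : (0 : ℝ) ≤ r.factorial), abs_sub_comm]
        have h4 := hf β (m + r) (by omega) n hnN
        rw [← hy, ← hpre] at h4
        have h5 : |x - y| ^ r / r.factorial ≤ len T (pre α n) ^ r :=
          (hdivf _ r (by positivity)).trans (pow_le_pow_left₀ (abs_nonneg _) hle r)
        refine (mul_le_mul h4 h5 (by positivity) ((abs_nonneg _).trans h4)).trans_eq ?_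
        rw [mul_assoc, ← Real.rpow_natCast, ← Real.rpow_add hl0]
        congr 2
        push_cast; ring
      have h6 := abs_sub_le (f m x) (jet k (U (pre α n)) m y x) (jet k f m y x)
      linarith
    have h7 := hscale (1 / δ) (len T (pre α n)) (by rw [le_div_iff₀ hδ]; linarith) hEδ hl0.le
      (by rw [one_div, ← div_eq_inv_mul, le_div_iff₀ hδ]; linarith)
    refine h1.trans ?_
    have h8 : C' * len T (pre α n) ^ ((k : ℝ) - m + ε) ≤
        (A + C') * (E ^ (k + 1) * |x - y| ^ ((k : ℝ) - m + ε)) := by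
      refine mul_le_mul (by linarith) h7 (Real.rpow_nonneg hl0.le _) (by linarith)
    calc _ ≤ ((k : ℝ) + 2) * ((A + C') * (E ^ (k + 1) * |x - y| ^ ((k : ℝ) - m + ε))) := by
          gcongr
      _ = _ := by rw [hM]; ring

end Jets

end CantorScaling

/-! ### The model Cantor set of a scaling function -/

namespace CantorScaling

section Model

variable {d : ℕ}

/-- Ratio geometries at finite levels that approximate `S`: uniform up to the level `N`, then given
by `S` at a continuation of the address by the word `w`. -/
noncomputable def model (S : Word d → simp d) (w : Word d) (N : ℕ) (l : List (Fin d)) :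
    Coord d → ℝ :=
  if l.length < N then fun _ => (2 * d - 1 : ℝ)⁻¹ else (S (app l w)).1

theorem model_of_lt {S : Word d → simp d} {w : Word d} {N : ℕ} {l : List (Fin d)}
    (h : l.length < N) (c : Coord d) : model S w N l c = (2 * d - 1 : ℝ)⁻¹ := by
  rw [model, if_pos h]

theorem model_of_le {S : Word d → simp d} {w : Word d} {N : ℕ} {l : List (Fin d)}
    (h : N ≤ l.length) : model S w N l = (S (app l w)).1 := by
  rw [model, if_neg h.not_gt]

theorem sum_const_coord (hd : 2 ≤ d) (x : ℝ) : ∑ _c : Coord d, x = (2 * d - 1) * x := by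
  rw [Finset.sum_const, Finset.card_univ, Fintype.card_sum, Fintype.card_fin, Fintype.card_fin,
    nsmul_eq_mul]
  congr 1
  have h : d + (d - 1) + 1 = 2 * d := by omega
  have : ((d + (d - 1) : ℕ) : ℝ) + 1 = 2 * d := by exact_mod_cast h
  linarith

theorem three_le_of_two_le (hd : 2 ≤ d) : (3 : ℝ) ≤ 2 * d - 1 := by
  have : (2 : ℝ) ≤ d := by exact_mod_cast hd
  linarith

theorem model_mem (S : Word d → simp d) (w : Word d) (N : ℕ) (hd : 2 ≤ d) (l : List (Fin d)) :
    model S w N l ∈ simp d := by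
  unfold model
  split_ifs
  · have h3 := three_le_of_two_le hd
    refine ⟨fun _ => ⟨by positivity, inv_lt_one_of_one_lt₀ (by linarith)⟩, ?_⟩
    rw [sum_const_coord hd, mul_inv_cancel₀ (by linarith)]
  · exact (S _).2

variable {S : Word d → simp d} {δ : ℝ}

theorem le_inv_of_le_coord (hS : ∀ x c, δ ≤ (S x).1 c) (hd : 2 ≤ d) : δ ≤ (2 * d - 1 : ℝ)⁻¹ := by
  have h3 := three_le_of_two_le hd
  let x : Word d := fun _ => ⟨0, by omega⟩
  have h := Finset.sum_le_sum (fun c (_ : c ∈ Finset.univ) => hS x c)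
  rw [sum_const_coord hd, (S x).2.2] at h
  rwa [← one_div, le_div_iff₀ (by linarith), mul_comm]

theorem model_lower (hS : ∀ x c, δ ≤ (S x).1 c) (hd : 2 ≤ d) (w : Word d) (N : ℕ)
    (l : List (Fin d)) (c : Coord d) : δ ≤ model S w N l c := by
  unfold model
  split_ifs
  · exact le_inv_of_le_coord hS hd
  · exact hS _ _

/-- The quotients are the slopes that the branch `i` must have. Below level `N` all ratios are
equal, so the slope is constant. At level `N` the product telescopes to a single coordinate of `S`,
which lies in `[δ, 1 - δ]`. From then on the decay changes the slope by a total of at most `δ / 2`,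
for `N` large. Altering the first `N` levels does not affect the limit geometry. -/
theorem exists_ratio_bounds (hd : 2 ≤ d) (hδ : 0 < δ) (hS : ∀ x c, δ ≤ (S x).1 c) {K μ : ℝ}
    (hμ0 : 0 < μ) (hμ1 : μ < 1) (hK : ∀ (l : List (Fin d)) (v v' : Word d) (c : Coord d),
      |(S (app l v)).1 c - (S (app l v')).1 c| ≤ K * μ ^ l.length) (w : Word d) :
    ∃ N, ∀ (i : Fin d) (l : List (Fin d)) (c : Coord d),
      len (model S w N) (l ++ [i]) * model S w N (l ++ [i]) c /
        (len (model S w N) l * model S w N l c) ∈ Icc (δ / 2) (1 - δ / 2) := by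
  have hK0 : 0 ≤ K := by simpa using hK [] w w (Sum.inl ⟨0, by omega⟩)
  obtain ⟨A, hA⟩ : ∃ A, A = K / δ / (1 - μ) := ⟨_, rfl⟩
  have hμ2 : 0 < 1 - μ := by linarith
  have hA0 : 0 ≤ A := by rw [hA]; positivity
  obtain ⟨n, hn⟩ := exists_pow_lt_of_lt_one (show 0 < δ / 2 / (A + 1) by positivity) hμ1
  rw [lt_div_iff₀ (by positivity)] at hn
  obtain ⟨N, hN⟩ : ∃ N, N = n + 1 := ⟨_, rfl⟩
  have hAN : A * μ ^ N ≤ δ / 2 := by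
    have h1 : μ ^ N ≤ μ ^ n := pow_le_pow_of_le_one hμ0.le hμ1.le (by omega)
    have h2 : 0 ≤ μ ^ n := by positivity
    nlinarith
  have hδ3 : δ ≤ 1 / 3 := by
    have h1 := le_inv_of_le_coord hS hd
    have h2 := three_le_of_two_le hd
    refine h1.trans ?_
    rw [← one_div]
    exact one_div_le_one_div_of_le (by norm_num) h2
  refine ⟨N, fun i => ?_⟩
  have hT := model_mem S w N hd
  have hTδ := model_lower hS hd w N
  obtain ⟨T, hTdef⟩ : ∃ T, T = model S w N := ⟨_, rfl⟩
  obtain ⟨u, hu⟩ : ∃ u, u = (2 * d - 1 : ℝ)⁻¹ := ⟨_, rfl⟩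
  have hTu : ∀ l c, l.length < N → T l c = u := fun l c h => by rw [hTdef, hu, model_of_lt h]
  have hTS : ∀ l, N ≤ l.length → T l = (S (app l w)).1 := fun l h => by
    rw [hTdef, model_of_le h]
  rw [← hTdef] at hT hTδ ⊢
  have hδu : δ ≤ u := hu ▸ le_inv_of_le_coord hS hd
  have hu3 : u ≤ 1 / 3 := by
    have h2 := three_le_of_two_le hd
    rw [hu, ← one_div]
    exact one_div_le_one_div_of_le (by norm_num) h2
  -- For `n ≥ N` this is the sum of the errors `K / δ * μ ^ i` over `N ≤ i < n`.
  let G : ℕ → ℝ := fun n => A * (μ ^ N - μ ^ n)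
  have hG0 : G N = 0 := by simp [G]
  have hGle : ∀ n, G n ≤ δ / 2 := fun n => by
    have : 0 ≤ A * μ ^ n := by positivity
    simp only [G, mul_sub]; linarith
  have hGs : ∀ n, G (n + 1) = G n + K / δ * μ ^ n := fun n => by
    simp only [G, hA, pow_succ]; field_simp; ring
  let claim : ℕ → ℝ → Prop := fun n r =>
    (n < N → r = u) ∧ (N ≤ n → r ∈ Icc (δ - G n) (1 - δ + G n))
  have hstep : ∀ l c, claim l.length (len T (l ++ [i]) / len T l) →
      claim (l.length + 1) (len T (l ++ [i]) * T (l ++ [i]) c / (len T l * T l c)) := by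
    intro l c ⟨h1, h2⟩
    have hl : (l ++ [i]).length = l.length + 1 := by simp
    have hTpos := simp_pos (hT l) c
    rw [mul_div_mul_comm]
    refine ⟨fun h => ?_, fun h => ?_⟩
    · rw [h1 (by omega), hTu _ _ (by omega), hTu _ _ (by omega), div_self (by linarith), mul_one]
    · rcases h.lt_or_eq with h | h
      · have hmem := h2 (by omega)
        have hd' : |T (l ++ [i]) c - T l c| ≤ K * μ ^ l.length := by
          rw [hTS _ (by omega), hTS _ (by omega), app_append]
          exact hK _ _ _ _
        obtain ⟨r, hr⟩ : ∃ r, r = len T (l ++ [i]) / len T l := ⟨_, rfl⟩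
        rw [← hr] at hmem ⊢
        have hG := hGle l.length
        have hr0 : 0 ≤ r := by linarith [hmem.1]
        have hr1 : r ≤ 1 := by linarith [hmem.2]
        have e : r * (T (l ++ [i]) c / T l c) - r = r * ((T (l ++ [i]) c - T l c) / T l c) := by
          field_simp
        have hb : |r * (T (l ++ [i]) c / T l c) - r| ≤ K / δ * μ ^ l.length := by
          rw [e, abs_mul, abs_of_nonneg hr0]
          refine (mul_le_of_le_one_left (abs_nonneg _) hr1).trans ?_
          rw [abs_div, abs_of_pos hTpos, div_mul_eq_mul_div]
          exact div_le_div₀ (by positivity) hd' hδ (hTδ _ _)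
        rw [abs_le] at hb
        rw [hGs]
        constructor <;> linarith [hmem.1, hmem.2]
      · rw [h1 (by omega), hTu l c (by omega), mul_div_cancel₀ _ (by linarith), hTS _ (by omega),
          ← h, hG0]
        exact ⟨by linarith [hS (app (l ++ [i]) w) c],
          by linarith [simp_le_one_sub hd (S _).2 (hS (app (l ++ [i]) w)) c]⟩
  have hall : ∀ l, claim l.length (len T (l ++ [i]) / len T l) := by
    intro l
    induction l with
    | nil =>
      refine ⟨fun _ => ?_, fun h => absurd h (by simp; omega)⟩
      simp only [List.nil_append, len, one_mul, div_one]
      exact hTu _ _ (by simp; omega)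
    | cons c l ih => exact hstep l (Sum.inl c) ih
  intro l c
  obtain ⟨h1, h2⟩ := hstep l c (hall l)
  rcases lt_or_ge (l.length + 1) N with h | h
  · rw [h1 h]; constructor <;> linarith
  · have hG := hGle (l.length + 1)
    exact ⟨by linarith [(h2 h).1], by linarith [(h2 h).2]⟩

/-- With bounded distortion this bounds `rho` by interval lengths. The first `N` levels, where the
model ignores `S`, cost at most the factor `δ ^ N`. -/
theorem Pr_le_len (hd : 2 ≤ d) (hδ : 0 < δ) (hS : ∀ x c, δ ≤ (S x).1 c) (w : Word d) (N : ℕ)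
    (l : List (Fin d)) : δ ^ N * Pr S l w ≤ len (model S w N) l := by
  have hδ1 : δ ≤ 1 := (hS w (Sum.inl (w 0))).trans ((S w).2.1 _).2.le
  induction l with
  | nil => simpa [Pr, len] using pow_le_one₀ hδ.le hδ1
  | cons c l ih =>
    rcases lt_or_ge l.length N with h | h
    · refine (mul_le_of_le_one_right (by positivity) (Pr_le_one S _ _)).trans ?_
      refine le_trans ?_ (pow_le_len hδ.le (model_lower hS hd w N) (c :: l))
      exact pow_le_pow_of_le_one hδ.le hδ1 (by simpa using h)
    · rw [Pr, len, model_of_le h, mul_comm, mul_assoc, mul_comm, mul_comm (Pr S l w)]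
      exact mul_le_mul_of_nonneg_right ih (simp_pos (S _).2 _).le

theorem tendsto_model {K μ : ℝ} (hμ0 : 0 < μ) (hμ1 : μ < 1)
    (hK : ∀ (l : List (Fin d)) (v v' : Word d) (c : Coord d),
      |(S (app l v)).1 c - (S (app l v')).1 c| ≤ K * μ ^ l.length) (w : Word d) (N : ℕ)
    (j : Word d) : Tendsto (fun n => model S w N (tk j n)) atTop (𝓝 (S j).1) := by
  rw [tendsto_pi_nhds]
  intro c
  rw [tendsto_iff_dist_tendsto_zero]
  have h0 : Tendsto (fun n => K * μ ^ n) atTop (𝓝 0) := by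
    simpa using (tendsto_pow_atTop_nhds_zero_of_lt_one hμ0.le hμ1).const_mul K
  refine squeeze_zero' (Eventually.of_forall fun _ => dist_nonneg) ?_ h0
  filter_upwards [eventually_ge_atTop N] with n hn
  rw [Real.dist_eq, model_of_le (by rwa [tk_length])]
  have := hK (tk j n) w (fun m => j (n + m)) c
  rwa [app_tk, tk_length] at this

end Model

end CantorScaling

/-! ### Embeddings with a given scaling function -/

namespace CantorScaling

/-- The chain of `y ↦ a' + s' g ((y - a) / s)`. -/
noncomputable def placedChain (a s a' s' : ℝ) (g : ℕ → ℝ → ℝ) (m : ℕ) (y : ℝ) : ℝ :=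
  s' / s ^ m * g m ((y - a) / s) + if m = 0 then a' else 0

theorem placedChain_hasDerivAt {a s a' s' : ℝ} {g : ℕ → ℝ → ℝ}
    (hg : ∀ m x, HasDerivAt (g m) (g (m + 1) x) x) (m : ℕ) (y : ℝ) :
    HasDerivAt (placedChain a s a' s' g m) (placedChain a s a' s' g (m + 1) y) y := by
  have h1 : HasDerivAt (fun y => (y - a) / s) (1 / s) y :=
    ((hasDerivAt_id y).sub_const a).div_const s
  have h2 := ((hg m _).comp y h1).const_mul (s' / s ^ m)
  refine (h2.add_const (if m = 0 then a' else 0)).congr_deriv ?_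
  simp only [placedChain, Nat.succ_ne_zero, if_false, add_zero, pow_succ, ← div_div]
  ring

/-- Turns almost invariance of polynomials under renormalization into closeness of the maps placed
on an interval and on its subinterval. -/
theorem placedChain_sub {a s a' s' b c b' c' : ℝ} (hs : s ≠ 0) (hc : c ≠ 0) (hc' : c' ≠ 0)
    (g g₁ : ℕ → ℝ → ℝ) (m : ℕ) (y : ℝ) :
    placedChain (a + s * b) (s * c) (a' + s' * b') (s' * c') g₁ m y -
        placedChain a s a' s' g m y =
      s' * c' / (s * c) ^ m * (g₁ m ((y - (a + s * b)) / (s * c)) -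
        zoomChain b c b' c' g m ((y - (a + s * b)) / (s * c))) := by
  have e : b + c * ((y - (a + s * b)) / (s * c)) = (y - a) / s := by field_simp; ring
  simp only [placedChain, zoomChain, e]
  by_cases hm : m = 0
  · subst hm
    simp only [if_true, pow_zero]
    field_simp; ring
  · simp only [hm, if_false, mul_pow]
    field_simp; ring

variable {d k : ℕ} {C ε : ℝ} {S : Word d → simp d}

/-- The scaling function of the model Cantor set is `S` by `tendsto_model`. What remains is, for
each `i`, a contraction of class `C^{k+ε}` inducing `prepend i`. -/
theorem TameCondition.exists_embedding (H : TameCondition S k C ((k : ℝ) + ε - 1)) (hd : 2 ≤ d)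
    (hk : 1 ≤ k) (hkd : k < 2 * d) (hε : 0 < ε) (hε1 : ε ≤ 1) :
    ∃ h : Word d → ℝ, IsSmoothEmbedding k ε h ∧ IsScalingFunction h S := by
  have hk1 : (1 : ℝ) ≤ k := by exact_mod_cast hk
  have hκ : 0 < (k : ℝ) + ε - 1 := by linarith
  have hd0 : 0 < d := by omega
  obtain ⟨δ, hδ, hS⟩ := H.exists_lower_bound hd hk hκ.le
  obtain ⟨K, μ, hμ0, hμ1, hK⟩ := H.exists_decay hd hk hkd hκ
  obtain ⟨B₁, hB₁, hdist⟩ := exists_distortion hδ hS hμ0 hμ1 hK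
  obtain ⟨Q, B, hB, hQdeg, hQ⟩ := H.exists_polynomials hd hk hkd hκ
  -- The word `0111…` is chosen because `w ≠ prepend i w` for every letter `i`: the two differ at
  -- position `1`. So the tame condition applies to this pair after any prefix.
  let w : Word d := fun n => if n = 0 then ⟨0, by omega⟩ else ⟨1, by omega⟩
  obtain ⟨N, hN⟩ := exists_ratio_bounds hd hδ hS hμ0 hμ1 hK w
  have hT := model_mem S w N hd
  have hTδ := model_lower hS hd w N
  have hTlim := tendsto_model (S := S) hμ0 hμ1 hK w N
  have hPr := Pr_le_len hd hδ hS w N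
  have hTS : ∀ l, N ≤ l.length → model S w N l = (S (app l w)).1 := fun l => model_of_le
  obtain ⟨T, hTdef⟩ : ∃ T, T = model S w N := ⟨_, rfl⟩
  rw [← hTdef] at hN hT hTδ hTlim hPr hTS
  have ht : ∀ l c, T l c ≤ 1 - δ := fun l => simp_le_one_sub hd (hT l) (hTδ l)
  have ht1 : 1 - δ < 1 := by linarith
  have hlen := len_pos hT
  refine ⟨cantorMap T, ⟨cantorMap_isOrderedEmbedding hT ht ht1 hd0, fun i => ?_⟩, fun j => ?_⟩
  swap
  · exact (hTlim j).congr fun n => (levelScaling_cantorMap hT ht ht1 hd0 j n).symm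
  have hw : w ≠ prepend i w := fun h => by simpa [w] using congrFun h 1
  have hr : ∀ l, len T (l ++ [i]) ≤ len T l := by
    intro l
    cases l with
    | nil => exact len_le_one hT _
    | cons c l =>
      have := (hN i l (Sum.inl c)).2
      rw [div_le_iff₀ (mul_pos (hlen l) (simp_pos (hT l) _))] at this
      refine this.trans (mul_le_of_le_one_left (hlen (c :: l)).le (by linarith))
  obtain ⟨P, hP⟩ : ∃ P : List (Fin d) → Polynomial ℝ,
    P = fun l => Q (app l w) (app l (prepend i w)) := ⟨_, rfl⟩
  have hne : ∀ l, app l w ≠ app l (prepend i w) := fun l h => hw (app_injective l h)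
  -- The interval `l` has the geometry `S (app l w)` and its image `l ++ [i]` has the geometry `S
  -- (app l (prepend i w))`; the polynomial of this pair is rescaled to a map between the two
  -- intervals.
  obtain ⟨U, hU⟩ : ∃ U : List (Fin d) → ℕ → ℝ → ℝ, U = fun l =>
    placedChain (lft T l) (len T l) (lft T (l ++ [i])) (len T (l ++ [i])) (polyChain (P l)) :=
    ⟨_, rfl⟩
  have hUd : ∀ l m y, HasDerivAt (U l m) (U l (m + 1) y) y := fun l m y =>
    hU ▸ placedChain_hasDerivAt (polyChain_hasDerivAt (P l)) m y
  have hU0 : ∀ l m, k < m → U l m = 0 := by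
    intro l m hm
    funext y
    have : (P l).natDegree < m := hP ▸ (hQdeg _ _).trans_lt hm
    simp only [hU, placedChain, polyChain_eq_zero this, if_neg (show m ≠ 0 by omega)]
    simp
  have hunit : ∀ l, ∀ y ∈ Icc (lft T l) (rgt T l), (y - lft T l) / len T l ∈ UI := by
    intro l y hy
    refine ⟨div_nonneg (by linarith [hy.1]) (hlen l).le, ?_⟩
    rw [div_le_one (hlen l)]
    have := hy.2
    rw [rgt] at this
    linarith
  obtain ⟨D, hD⟩ : ∃ D, D = B₁ / δ ^ N := ⟨_, rfl⟩
  have hD0 : 0 ≤ D := by rw [hD]; positivity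
  have hrho : ∀ l, rho S (app l w) (app l (prepend i w)) ≤ D * len T l := by
    intro l
    refine rho_app_le S l hw fun v => (hdist l v w).trans ?_
    rw [hD, div_mul_eq_mul_div, le_div_iff₀ (by positivity), mul_assoc, mul_comm (Pr S l w)]
    exact mul_le_mul_of_nonneg_left (hPr l) (by linarith)
  -- With `L` the length of `c :: l`, rescaling contributes at most `L / L ^ m` and almost
  -- invariance contributes `rho ^ κ ≤ (D * L) ^ κ`; the exponents add up to `k - m + ε`.
  have hUC : ∀ l c, N ≤ l.length → ∀ m ≤ k, ∀ y ∈ Icc (lft T (c :: l)) (rgt T (c :: l)),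
      |U (c :: l) m y - U l m y| ≤
        B * D ^ ((k : ℝ) + ε - 1) * len T (c :: l) ^ ((k : ℝ) - m + ε) := by
    intro l c hl m hm y hy
    have h1 := (hQ (app l w) (app l (prepend i w)) (hne l) m hm _ (hunit _ y hy)).2 c
    have e1 : (S (app l w)).1 = T l := (hTS l hl).symm
    have e2 : (S (app l (prepend i w))).1 = T (l ++ [i]) := by
      rw [hTS _ (by simp; omega), app_append]; rfl
    rw [e1, e2] at h1
    have h2 := placedChain_sub (a := lft T l) (a' := lft T (l ++ [i])) (b := leftEnd (T l) c)
      (b' := leftEnd (T (l ++ [i])) c) (s' := len T (l ++ [i])) (hlen l).ne'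
      (simp_pos (hT l) (Sum.inl c)).ne'
      (simp_pos (hT (l ++ [i])) (Sum.inl c)).ne' (polyChain (P l)) (polyChain (P (c :: l))) m y
    have e3 : U (c :: l) m y - U l m y = len T (c :: (l ++ [i])) / len T (c :: l) ^ m *
        (polyChain (P (c :: l)) m ((y - lft T (c :: l)) / len T (c :: l)) -
          zoomChain (leftEnd (T l) c) (T l (Sum.inl c)) (leftEnd (T (l ++ [i])) c)
            (T (l ++ [i]) (Sum.inl c)) (polyChain (P l)) m
            ((y - lft T (c :: l)) / len T (c :: l))) := by
      rw [hU]; exact h2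
    have hl0 := hlen (c :: l)
    rw [e3, abs_mul, abs_of_nonneg (div_nonneg (hlen _).le (pow_nonneg hl0.le _))]
    have h3 : |polyChain (P (c :: l)) m ((y - lft T (c :: l)) / len T (c :: l)) -
          zoomChain (leftEnd (T l) c) (T l (Sum.inl c)) (leftEnd (T (l ++ [i])) c)
            (T (l ++ [i]) (Sum.inl c)) (polyChain (P l)) m
            ((y - lft T (c :: l)) / len T (c :: l))| ≤
        B * (D * len T (c :: l)) ^ ((k : ℝ) + ε - 1) := by
      rw [hP]
      refine h1.trans (mul_le_mul_of_nonneg_left ?_ hB)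
      refine Real.rpow_le_rpow ?_ (hrho (c :: l)) hκ.le
      exact (rho_pos S (hne (c :: l))).le
    have h4 : len T (c :: (l ++ [i])) ≤ len T (c :: l) := hr (c :: l)
    refine (mul_le_mul (div_le_div_of_nonneg_right h4 (pow_nonneg hl0.le m)) h3 (abs_nonneg _)
      (div_nonneg hl0.le (pow_nonneg hl0.le _))).trans_eq ?_
    rw [Real.mul_rpow hD0 hl0.le, show (k : ℝ) - m + ε = ((k : ℝ) + ε - 1) + 1 - m by ring]
    generalize (k : ℝ) + ε - 1 = κ
    rw [Real.rpow_sub hl0, Real.rpow_add hl0, Real.rpow_one, Real.rpow_natCast]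
    ring
  obtain ⟨f, M, hM, hf, hfU⟩ := exists_whitneyData hT ht ht1 hδ hTδ hε hε1
    (mul_nonneg hB (Real.rpow_nonneg hD0 _)) hUd hU0 hUC
  have hKc : IsCompact (range (cantorMap T)) := isCompact_range (cantorMap_continuous hT ht ht1)
  have hKne : (range (cantorMap T)).Nonempty := ⟨_, w, rfl⟩
  obtain ⟨F, hF, hFf, hFsm, hFray⟩ := hf.exists_extension hM hε hε1 hKc.isClosed hKne
  have hFd : Differentiable ℝ F := hF.1.differentiable (by
    have : k ≠ 0 := by omega
    exact_mod_cast this)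
  have hFc : Continuous (deriv F) := hF.1.continuous_deriv (by exact_mod_cast hk)
  -- The value of `U (pre α n)` at the point lies within `B` times the length of the interval `pre α
  -- n` of the left end of the image interval, and these left ends converge to the image point.
  have hFh : ∀ α, F (cantorMap T α) = cantorMap T (prepend i α) := by
    intro α
    have hl0 := tendsto_len_pre hT ht ht1 α
    have h1 : F (cantorMap T α) = f 0 (cantorMap T α) := by
      rw [← hFf _ ⟨α, rfl⟩ 0 (by omega), iteratedDeriv_zero]
    rw [h1]
    have h2 : Tendsto (fun n => U (pre α n) 0 (cantorMap T α)) atTop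
        (𝓝 (f 0 (cantorMap T α))) := by
      rw [tendsto_iff_dist_tendsto_zero]
      have hp := wexp_pos (k := k) hε (Nat.zero_le k)
      have h3 : Tendsto (fun n => M * len T (pre α n) ^ ((k : ℝ) - (0 : ℕ) + ε)) atTop
          (𝓝 0) := by
        have := (hl0.rpow_const (Or.inr hp.le)).const_mul M
        rwa [Real.zero_rpow hp.ne', mul_zero] at this
      refine squeeze_zero' (Eventually.of_forall fun _ => dist_nonneg) ?_ h3
      filter_upwards [eventually_ge_atTop N] with n hn
      rw [dist_comm, Real.dist_eq]
      exact hfU α 0 (by omega) n hn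
    have h4 : Tendsto (fun n => lft T (pre α n ++ [i])) atTop
        (𝓝 (cantorMap T (prepend i α))) := by
      have := (tendsto_lft_pre hT (prepend i α)).comp (tendsto_add_atTop_nat 1)
      refine this.congr fun n => ?_
      simp only [Function.comp, pre_prepend]
    have h5 : Tendsto (fun n => U (pre α n) 0 (cantorMap T α) - lft T (pre α n ++ [i])) atTop
        (𝓝 0) := by
      refine squeeze_zero_norm (fun n => ?_) (by simpa using hl0.const_mul B)
      have hy := hunit (pre α n) _ ⟨lft_le_cantorMap hT α n, cantorMap_le_rgt hT α n⟩
      have h6 := (hQ _ _ (hne (pre α n)) 0 (by omega) _ hy).1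
      have e : U (pre α n) 0 (cantorMap T α) - lft T (pre α n ++ [i]) = len T (pre α n ++ [i]) *
          polyChain (P (pre α n)) 0
            ((cantorMap T α - lft T (pre α n)) / len T (pre α n)) := by
        simp [hU, placedChain]
      rw [e, hP, Real.norm_eq_abs, abs_mul, abs_of_pos (hlen _), mul_comm B]
      exact mul_le_mul (hr _) h6 (abs_nonneg _) (hlen _).le
    have h7 := h5.add h4
    simp only [sub_add_cancel, zero_add] at h7
    exact tendsto_nhds_unique h2 h7
  have hFl : ∀ l, lft T l ∈ range (cantorMap T) ∧ F (lft T l) = lft T (l ++ [i]) := by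
    intro l
    have h := cantorMap_revApp_zero hT hd0 l
    refine ⟨⟨_, h⟩, ?_⟩
    rw [← h, hFh, prepend_revApp, cantorMap_revApp_zero hT hd0]
  have hFr : ∀ l, rgt T l ∈ range (cantorMap T) ∧ F (rgt T l) = rgt T (l ++ [i]) := by
    intro l
    have h := cantorMap_revApp_last hT ht ht1 hd0 l
    refine ⟨⟨_, h⟩, ?_⟩
    rw [← h, hFh, prepend_revApp, cantorMap_revApp_last hT ht ht1 hd0]
  -- The derivative at a point of the Cantor set is a limit of slopes over the construction
  -- intervals around it, which `hN` controls.
  have hderiv : ∀ x ∈ range (cantorMap T), deriv F x ∈ Icc (δ / 2) (1 - δ / 2) := by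
    rintro _ ⟨α, rfl⟩
    have hξ : ∀ n, ∃ ξ ∈ Ioo (lft T (pre α (n + 1))) (rgt T (pre α (n + 1))),
        deriv F ξ ∈ Icc (δ / 2) (1 - δ / 2) := by
      intro n
      obtain ⟨ξ, hξ, he⟩ := exists_deriv_eq_slope F (lft_lt_rgt hT (pre α (n + 1)))
        hFd.continuous.continuousOn hFd.differentiableOn
      refine ⟨ξ, hξ, ?_⟩
      rw [he, (hFl _).2, (hFr _).2, rgt, rgt, add_sub_cancel_left, add_sub_cancel_left]
      exact hN i (pre α n) (Sum.inl (α n))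
    choose ξ hξ1 hξ2 using hξ
    have h1 : Tendsto ξ atTop (𝓝 (cantorMap T α)) :=
      tendsto_of_tendsto_of_tendsto_of_le_of_le
        ((tendsto_lft_pre hT α).comp (tendsto_add_atTop_nat 1))
        ((tendsto_rgt_pre hT ht ht1 α).comp (tendsto_add_atTop_nat 1))
        (fun n => (hξ1 n).1.le) (fun n => (hξ1 n).2.le)
    exact isClosed_Icc.mem_of_tendsto ((hFc.tendsto _).comp h1) (Eventually.of_forall hξ2)
  -- A gap of the Cantor set is a gap of the construction: otherwise an end point of a construction
  -- interval would lie strictly inside it. Its slope is controlled by `hN` at a gap coordinate.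
  have hgap : ∀ x ∈ range (cantorMap T), ∀ y ∈ range (cantorMap T), x < y →
      (∀ z ∈ range (cantorMap T), z ≤ x ∨ y ≤ z) →
      δ / 2 * (y - x) ≤ F y - F x ∧ F y - F x ≤ (1 - δ / 2) * (y - x) := by
    rintro _ ⟨α, rfl⟩ _ ⟨β, rfl⟩ hxy hz
    have hαβ : α ≠ β := fun h => hxy.ne (by rw [h])
    obtain ⟨n, hn⟩ : ∃ n, n = PiNat.firstDiff α β := ⟨_, rfl⟩
    have heq : ∀ i < n, α i = β i := fun i hi => PiNat.apply_eq_of_lt_firstDiff (hn ▸ hi)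
    have hlt : α n < β n := by
      rcases lt_or_gt_of_ne (hn ▸ PiNat.apply_firstDiff_ne hαβ : α n ≠ β n) with h | h
      · exact h
      · exact absurd (cantorMap_lt hT (fun i hi => (heq i hi).symm) h) hxy.not_gt
    have hlt' : (α n : ℕ) + 1 ≤ β n := hlt
    have hβd := (β n).2
    let g : Fin (d - 1) := ⟨α n, by omega⟩
    let c' : Fin d := ⟨g + 1, by omega⟩
    have hcc' : α n < c' := Nat.lt_succ_self _
    have e1 : cantorMap T α = rgt T (α n :: pre α n) := by
      have h1 := cantorMap_le_rgt hT α (n + 1)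
      refine le_antisymm h1 ?_
      rcases hz _ (hFr (α n :: pre α n)).1 with h | h
      · exact h
      · have h2 := lft_le_cantorMap hT β (n + 1)
        simp only [pre, ← pre_congr heq] at h2
        have h3 := rgt_add_le hT hlt (pre α n)
        have h4 := mul_pos (hlen (pre α n)) (simp_pos (hT (pre α n)) (Sum.inr g))
        exact absurd h (by linarith)
    have e2 : cantorMap T β = lft T (c' :: pre α n) := by
      have h1 := lft_le_cantorMap hT β (n + 1)
      simp only [pre, ← pre_congr heq] at h1
      have h2 : lft T (c' :: pre α n) ≤ lft T (β n :: pre α n) := by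
        simp only [lft]
        have := mul_le_mul_of_nonneg_left (leftEnd_mono (hT (pre α n)) (show c' ≤ β n from hlt'))
          (hlen (pre α n)).le
        linarith
      refine le_antisymm ?_ (h2.trans h1)
      rcases hz _ (hFl (c' :: pre α n)).1 with h | h
      · have h3 := rgt_add_le hT hcc' (pre α n)
        have h4 := mul_pos (hlen (pre α n)) (simp_pos (hT (pre α n)) (Sum.inr g))
        exact absurd h (by rw [e1]; linarith)
      · exact h
    have h1 := lft_succ_sub_rgt (T := T) g (pre α n)
    have h2 := lft_succ_sub_rgt (T := T) g (pre α n ++ [i])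
    have h3 := hN i (pre α n) (Sum.inr g)
    have hpos := mul_pos (hlen (pre α n)) (simp_pos (hT (pre α n)) (Sum.inr g))
    rw [e1, e2, (hFl _).2, (hFr _).2]
    have e3 : lft T (c' :: pre α n) - rgt T (α n :: pre α n) =
      len T (pre α n) * T (pre α n) (Sum.inr g) := h1
    have e4 : lft T (c' :: pre α n ++ [i]) - rgt T (α n :: pre α n ++ [i]) =
      len T (pre α n ++ [i]) * T (pre α n ++ [i]) (Sum.inr g) := h2
    rw [e3, e4, ← le_div_iff₀ hpos, ← div_le_iff₀ hpos]
    exact h3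
  obtain ⟨G, hG, hGc, hGd, hGF⟩ := exists_contraction hF hk hε hε1 hKc hKne hFsm hFray
    (by positivity) (by linarith) hderiv hgap
  exact ⟨G, fun α => (hGF _ ⟨α, rfl⟩).trans (hFh α), hG, hGc, hGd⟩

end CantorScaling

/-! ### From an embedding to the tame condition. -/

/-! ### Hölder bounds -/

namespace CantorScaling

/-- On the unit interval, `f` and its first `r` derivatives are bounded by `M` and the `r`-th
derivative is `ε`-Hölder with constant `M`. -/
def HolderBound (ε : ℝ) : ℕ → ℝ → (ℝ → ℝ) → Prop
  | 0, M, f => (∀ x ∈ UI, |f x| ≤ M) ∧ ∀ x ∈ UI, ∀ y ∈ UI, |f x - f y| ≤ M * |x - y| ^ ε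
  | r + 1, M, f => (∀ x ∈ UI, |f x| ≤ M) ∧
      ∃ f' : ℝ → ℝ, (∀ x ∈ UI, HasDerivWithinAt f (f' x) UI x) ∧ HolderBound ε r M f'

namespace HolderBound

variable {ε M N : ℝ} {r : ℕ} {f g : ℝ → ℝ}

theorem abs_le (hf : HolderBound ε r M f) : ∀ x ∈ UI, |f x| ≤ M := by
  cases r <;> exact hf.1

theorem nonneg (hf : HolderBound ε r M f) : 0 ≤ M :=
  (abs_nonneg _).trans (hf.abs_le 0 ⟨le_rfl, zero_le_one⟩)

theorem mono (hf : HolderBound ε r M f) (h : M ≤ N) : HolderBound ε r N f := by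
  induction r generalizing f with
  | zero =>
    exact ⟨fun x hx => (hf.1 x hx).trans h, fun x hx y hy => (hf.2 x hx y hy).trans
      (mul_le_mul_of_nonneg_right h (Real.rpow_nonneg (abs_nonneg _) _))⟩
  | succ r ih =>
    obtain ⟨h1, f', h2, h3⟩ := hf
    exact ⟨fun x hx => (h1 x hx).trans h, f', h2, ih h3⟩

theorem congr (hf : HolderBound ε r M f) (h : EqOn g f UI) : HolderBound ε r M g := by
  cases r with
  | zero =>
    refine ⟨fun x hx => ?_, fun x hx y hy => ?_⟩
    · rw [h hx]; exact hf.1 x hx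
    · rw [h hx, h hy]; exact hf.2 x hx y hy
  | succ r =>
    obtain ⟨h1, f', h2, h3⟩ := hf
    refine ⟨fun x hx => ?_, f', fun x hx => (h2 x hx).congr h (h hx), h3⟩
    rw [h hx]; exact h1 x hx

theorem abs_sub_le_of_deriv {f' : ℝ → ℝ} (hf : ∀ x ∈ UI, HasDerivWithinAt f (f' x) UI x)
    (hM : ∀ x ∈ UI, |f' x| ≤ M) {x y : ℝ} (hx : x ∈ UI) (hy : y ∈ UI) :
    |f x - f y| ≤ M * |x - y| :=
  (convex_Icc 0 1).norm_image_sub_le_of_norm_hasDerivWithin_le hf hM hy hx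

theorem abs_le_rpow (hε1 : ε ≤ 1) {x y : ℝ} (hx : x ∈ UI) (hy : y ∈ UI) :
    |x - y| ≤ |x - y| ^ ε := by
  rcases (abs_nonneg (x - y)).eq_or_lt with h | h
  · rw [← h]; exact Real.rpow_nonneg le_rfl _
  · simpa using Real.rpow_le_rpow_of_exponent_ge h (abs_sub_le_one hx hy) hε1

theorem of_succ (hε1 : ε ≤ 1) (hf : HolderBound ε (r + 1) M f) : HolderBound ε r M f := by
  induction r generalizing f with
  | zero =>
    obtain ⟨h1, f', h2, h3⟩ := hf
    exact ⟨h1, fun x hx y hy => (abs_sub_le_of_deriv h2 h3.1 hx hy).trans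
      (mul_le_mul_of_nonneg_left (abs_le_rpow hε1 hx hy) h3.nonneg)⟩
  | succ r ih =>
    obtain ⟨h1, f', h2, h3⟩ := hf
    exact ⟨h1, f', h2, ih h3⟩

theorem of_le (hε1 : ε ≤ 1) {s : ℕ} (hf : HolderBound ε r M f) (h : s ≤ r) :
    HolderBound ε s M f := by
  induction r with
  | zero => obtain rfl : s = 0 := by omega
            exact hf
  | succ r ih =>
    rcases h.lt_or_eq with h | rfl
    · exact ih (hf.of_succ hε1) (by omega)
    · exact hf

theorem const (r : ℕ) (a : ℝ) : HolderBound ε r |a| fun _ => a := by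
  induction r generalizing a with
  | zero =>
    refine ⟨fun _ _ => le_rfl, fun x _ y _ => ?_⟩
    rw [sub_self, abs_zero]
    exact mul_nonneg (abs_nonneg _) (Real.rpow_nonneg (abs_nonneg _) _)
  | succ r ih =>
    refine ⟨fun _ _ => le_rfl, fun _ => 0, fun x _ => hasDerivWithinAt_const _ _ _, ?_⟩
    exact (ih 0).mono (by simp)

theorem add (hf : HolderBound ε r M f) (hg : HolderBound ε r N g) :
    HolderBound ε r (M + N) fun x => f x + g x := by
  induction r generalizing f g with
  | zero =>
    refine ⟨fun x hx => (abs_add_le _ _).trans (add_le_add (hf.1 x hx) (hg.1 x hx)),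
      fun x hx y hy => ?_⟩
    rw [add_sub_add_comm, add_mul]
    exact (abs_add_le _ _).trans (add_le_add (hf.2 x hx y hy) (hg.2 x hx y hy))
  | succ r ih =>
    obtain ⟨h1, f', h2, h3⟩ := hf
    obtain ⟨k1, g', k2, k3⟩ := hg
    exact ⟨fun x hx => (abs_add_le _ _).trans (add_le_add (h1 x hx) (k1 x hx)),
      fun x => f' x + g' x, fun x hx => (h2 x hx).add (k2 x hx), ih h3 k3⟩

theorem mul (hε1 : ε ≤ 1) (hf : HolderBound ε r M f) (hg : HolderBound ε r N g) :
    HolderBound ε r (2 ^ (r + 1) * (M * N)) fun x => f x * g x := by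
  have hM := hf.nonneg
  have hN := hg.nonneg
  have hb : ∀ x ∈ UI, |f x * g x| ≤ 2 ^ (r + 1) * (M * N) := fun x hx => by
    rw [abs_mul]
    refine (mul_le_mul (hf.abs_le x hx) (hg.abs_le x hx) (abs_nonneg _) hM).trans ?_
    exact le_mul_of_one_le_left (by positivity) (one_le_pow₀ one_le_two)
  induction r generalizing f g with
  | zero =>
    refine ⟨hb, fun x hx y hy => ?_⟩
    have e : f x * g x - f y * g y = f x * (g x - g y) + g y * (f x - f y) := by ring
    rw [e]
    refine (abs_add_le _ _).trans ?_
    rw [abs_mul, abs_mul]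
    have h1 := mul_le_mul (hf.1 x hx) (hg.2 x hx y hy) (abs_nonneg _) hM
    have h2 := mul_le_mul (hg.1 y hy) (hf.2 x hx y hy) (abs_nonneg _) hN
    exact (add_le_add h1 h2).trans_eq (by ring)
  | succ r ih =>
    have hf0 := hf.of_succ hε1
    have hg0 := hg.of_succ hε1
    obtain ⟨h1, f', h2, h3⟩ := hf
    obtain ⟨k1, g', k2, k3⟩ := hg
    refine ⟨hb, fun x => f' x * g x + f x * g' x, fun x hx => (h2 x hx).mul (k2 x hx), ?_⟩
    have aux : ∀ {u v : ℝ → ℝ}, HolderBound ε r M u → HolderBound ε r N v →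
        ∀ x ∈ UI, |u x * v x| ≤ 2 ^ (r + 1) * (M * N) := fun {u v} hu hv x hx => by
      rw [abs_mul]
      refine (mul_le_mul (hu.abs_le x hx) (hv.abs_le x hx) (abs_nonneg _) hM).trans ?_
      exact le_mul_of_one_le_left (by positivity) (one_le_pow₀ one_le_two)
    refine ((ih h3 hg0 (aux h3 hg0)).add (ih hf0 k3 (aux hf0 k3))).mono (le_of_eq ?_)
    ring

theorem neg (hε1 : ε ≤ 1) (hf : HolderBound ε r M f) :
    HolderBound ε r (2 ^ (r + 1) * M) fun x => -f x :=
  (((const r (-1)).mul hε1 hf).mono (by simp)).congr fun x _ => by simp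

theorem finset_sum {F : ℕ → ℝ → ℝ} {u : ℕ → ℝ}
    (h : ∀ m, HolderBound ε r (u m) (F m)) (s : Finset ℕ) :
    HolderBound ε r (∑ m ∈ s, u m) fun x => ∑ m ∈ s, F m x := by
  classical
  induction s using Finset.induction_on with
  | empty => simpa using const r 0
  | insert m s hm ih =>
    simp only [Finset.sum_insert hm]
    exact (h m).add ih

/-- Termwise differentiation is justified by the first-order remainders: each is at most `u m * |x -
y| ^ (1 + ε)`, which is summable in `m` and of smaller order than `|x - y|`. -/
theorem tsum (hε : 0 < ε) (hε1 : ε ≤ 1) {F : ℕ → ℝ → ℝ} {u : ℕ → ℝ} (hu : Summable u)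
    (h : ∀ m, HolderBound ε r (u m) (F m)) :
    HolderBound ε r (∑' m, u m) fun x => ∑' m, F m x := by
  have hsum : ∀ {G : ℕ → ℝ → ℝ}, (∀ m, ∀ x ∈ UI, |G m x| ≤ u m) → ∀ x ∈ UI,
      Summable fun m => G m x := fun hG x hx => Summable.of_norm_bounded hu fun m => hG m x hx
  have hbd : ∀ {G : ℕ → ℝ → ℝ}, (∀ m, ∀ x ∈ UI, |G m x| ≤ u m) → ∀ x ∈ UI,
      |∑' m, G m x| ≤ ∑' m, u m := fun hG x hx => by
    rw [← Real.norm_eq_abs]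
    exact tsum_of_norm_bounded hu.hasSum fun m => hG m x hx
  induction r generalizing F with
  | zero =>
    have h0 := fun m => (h m).1
    refine ⟨hbd h0, fun x hx y hy => ?_⟩
    rw [← (hsum h0 x hx).tsum_sub (hsum h0 y hy), ← tsum_mul_right]
    exact tsum_of_norm_bounded (f := fun m => F m x - F m y) (hu.mul_right _).hasSum
      fun m => (h m).2 x hx y hy
  | succ r ih =>
    have h0 := fun m => (h m).abs_le
    choose F' hF' hF'b using fun m => (h m).2
    have h1 := fun m => (hF'b m).abs_le
    refine ⟨hbd h0, fun x => ∑' m, F' m x, fun y hy => ?_, ih hF'b⟩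
    have hH : ∀ m, ∀ x ∈ UI, |F m x - F m y - F' m y * (x - y)| ≤ u m * |x - y| ^ (1 + ε) := by
      intro m x hx
      have hF0 : HolderBound ε 0 (u m) (F' m) := (hF'b m).of_le hε1 (Nat.zero_le r)
      have hd : ∀ z ∈ uIcc y x, HasDerivWithinAt (fun z => F m z - F' m y * z)
          (F' m z - F' m y) (uIcc y x) z := by
        intro z hz
        have hzU := uIcc_subset_Icc hy hx hz
        have h2 : HasDerivWithinAt (fun z => F' m y * z) (F' m y) (uIcc y x) z := by
          simpa using ((hasDerivAt_id z).const_mul (F' m y)).hasDerivWithinAt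
        exact ((hF' m z hzU).mono (uIcc_subset_Icc hy hx)).sub h2
      have hb : ∀ z ∈ uIcc y x, ‖F' m z - F' m y‖ ≤ u m * |x - y| ^ ε := by
        intro z hz
        have hzU := uIcc_subset_Icc hy hx hz
        refine (hF0.2 z hzU y hy).trans (mul_le_mul_of_nonneg_left ?_ hF0.nonneg)
        exact Real.rpow_le_rpow (abs_nonneg _) (abs_sub_left_of_mem_uIcc hz) hε.le
      have := (convex_uIcc y x).norm_image_sub_le_of_norm_hasDerivWithin_le hd hb left_mem_uIcc
        right_mem_uIcc
      rw [Real.norm_eq_abs, Real.norm_eq_abs, mul_assoc] at this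
      have e1 : F m x - F' m y * x - (F m y - F' m y * y) =
        F m x - F m y - F' m y * (x - y) := by ring
      rw [e1] at this
      refine this.trans_eq ?_
      rcases (abs_nonneg (x - y)).eq_or_lt with h | h
      · rw [← h, mul_zero, mul_zero, Real.zero_rpow (by linarith), mul_zero]
      · rw [Real.rpow_add h, Real.rpow_one]; ring
    rw [hasDerivWithinAt_iff_isLittleO]
    have hO : (fun x => (∑' m, F m x) - (∑' m, F m y) - (x - y) • ∑' m, F' m y)
        =O[𝓝[UI] y] fun x => |x - y| ^ (1 + ε) := by
      refine Asymptotics.IsBigO.of_bound (∑' m, u m) ?_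
      filter_upwards [self_mem_nhdsWithin] with x hx
      rw [smul_eq_mul, mul_comm (x - y), ← (hsum h0 x hx).tsum_sub (hsum h0 y hy),
        ← tsum_mul_right,
        ← ((hsum h0 x hx).sub (hsum h0 y hy)).tsum_sub ((hsum h1 y hy).mul_right _),
        ← tsum_mul_right]
      refine tsum_of_norm_bounded (hu.mul_right _).hasSum fun m => ?_
      rw [Real.norm_eq_abs, Real.norm_eq_abs, abs_of_nonneg (Real.rpow_nonneg (abs_nonneg _) _)]
      exact hH m x hx
    refine hO.trans_isLittleO ?_
    rw [Asymptotics.isLittleO_iff]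
    intro c hc
    have ht : Tendsto (fun x => |x - y| ^ ε) (𝓝[UI] y) (𝓝 0) := by
      have h2 : Tendsto (fun x => |x - y|) (𝓝 y) (𝓝 0) := by
        have : Continuous fun x => |x - y| := by fun_prop
        simpa using this.tendsto y
      have := (h2.mono_left (nhdsWithin_le_nhds (s := UI))).rpow_const (p := ε) (Or.inr hε.le)
      rwa [Real.zero_rpow hε.ne'] at this
    filter_upwards [ht.eventually (ge_mem_nhds hc)] with x hx
    rw [Real.norm_eq_abs, abs_of_nonneg (Real.rpow_nonneg (abs_nonneg _) _), Real.norm_eq_abs]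
    rcases (abs_nonneg (x - y)).eq_or_lt with h | h
    · rw [← h, Real.zero_rpow (by linarith), mul_zero]
    · rw [add_comm, Real.rpow_add h, Real.rpow_one]
      exact mul_le_mul_of_nonneg_right hx h.le

/-- For order `r` the inner derivative is needed only to orders below `r`, and merely bounded when
`r = 0`. This gain of one order drives the bootstrap in `exists_transition_bound`. -/
theorem exists_comp (hε : 0 < ε) (hε1 : ε ≤ 1) (r : ℕ) (M N : ℝ) :
    ∃ C, ∀ f G G' : ℝ → ℝ, HolderBound ε r M f → MapsTo G UI UI →
      (∀ x ∈ UI, HasDerivWithinAt G (G' x) UI x) → (∀ x ∈ UI, |G' x| ≤ N) →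
      (∀ s < r, HolderBound ε s N G') → HolderBound ε r C fun x => f (G x) := by
  induction r with
  | zero =>
    refine ⟨max M (M * N ^ ε), fun f G G' hf hG hGd hN _ =>
      ⟨fun x hx => (hf.1 _ (hG hx)).trans (le_max_left _ _), fun x hx y hy => ?_⟩⟩
    have hN0 : 0 ≤ N := (abs_nonneg _).trans (hN x hx)
    refine ((hf.2 _ (hG hx) _ (hG hy)).trans ?_).trans (mul_le_mul_of_nonneg_right
      (le_max_right M (M * N ^ ε)) (Real.rpow_nonneg (abs_nonneg _) _))
    rw [mul_assoc, ← Real.mul_rpow hN0 (abs_nonneg _)]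
    exact mul_le_mul_of_nonneg_left (Real.rpow_le_rpow (abs_nonneg _)
      (abs_sub_le_of_deriv hGd hN hx hy) hε.le) hf.nonneg
  | succ r ih =>
    obtain ⟨C, hC⟩ := ih
    refine ⟨max M (2 ^ (r + 1) * (C * N)), fun f G G' hf hG hGd hN hGs => ?_⟩
    obtain ⟨h1, f', h2, h3⟩ := hf
    refine ⟨fun x hx => (h1 _ (hG hx)).trans (le_max_left _ _), fun x => f' (G x) * G' x,
      fun x hx => (h2 _ (hG hx)).comp x (hGd x hx) hG, ?_⟩
    have h4 := hC f' G G' h3 hG hGd hN fun s hs => hGs s (by omega)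
    exact (h4.mul hε1 (hGs r (by omega))).mono (le_max_right _ _)

theorem exists_exp (hε1 : ε ≤ 1) (r : ℕ) (M : ℝ) :
    ∃ C, ∀ f : ℝ → ℝ, HolderBound ε r M f → HolderBound ε r C fun x => Real.exp (f x) := by
  have hb : ∀ {r : ℕ} {f : ℝ → ℝ}, HolderBound ε r M f → ∀ x ∈ UI,
      |Real.exp (f x)| ≤ Real.exp M := fun hf x hx => by
    rw [Real.abs_exp]
    exact Real.exp_le_exp.2 ((le_abs_self _).trans (hf.abs_le x hx))
  induction r with
  | zero =>
    refine ⟨max (Real.exp M) (Real.exp M * M), fun f hf =>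
      ⟨fun x hx => (hb hf x hx).trans (le_max_left _ _), fun x hx y hy => ?_⟩⟩
    have h1 : |Real.exp (f x) - Real.exp (f y)| ≤ Real.exp M * |f x - f y| :=
      (convex_Iic M).norm_image_sub_le_of_norm_hasDerivWithin_le
        (f := Real.exp) (f' := Real.exp)
        (fun z _ => (Real.hasDerivAt_exp z).hasDerivWithinAt)
        (fun z hz => by
          rw [Real.norm_eq_abs, Real.abs_exp]; exact Real.exp_le_exp.2 hz)
        ((le_abs_self _).trans (hf.1 y hy)) ((le_abs_self _).trans (hf.1 x hx))
    refine (h1.trans (mul_le_mul_of_nonneg_left (hf.2 x hx y hy) (Real.exp_pos _).le)).trans ?_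
    rw [← mul_assoc]
    exact mul_le_mul_of_nonneg_right (le_max_right _ _) (Real.rpow_nonneg (abs_nonneg _) _)
  | succ r ih =>
    obtain ⟨C, hC⟩ := ih
    refine ⟨max (Real.exp M) (2 ^ (r + 1) * (C * M)), fun f hf => ?_⟩
    have hf0 := hf.of_succ hε1
    have hfb := hb hf
    obtain ⟨h1, f', h2, h3⟩ := hf
    exact ⟨fun x hx => (hfb x hx).trans (le_max_left _ _), fun x => Real.exp (f x) * f' x,
      fun x hx => (h2 x hx).exp, ((hC f hf0).mul hε1 h3).mono (le_max_right _ _)⟩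

/-- Writing the derivative as `f' * exp (-log f)` reduces the reciprocal to the exponential of a
logarithm already bounded at the lower order. -/
theorem exists_log (hε1 : ε ≤ 1) (hf : HolderBound ε r M f) {m : ℝ} (hm : 0 < m)
    (hfm : ∀ x ∈ UI, m ≤ f x) : ∃ C, HolderBound ε r C fun x => Real.log (f x) := by
  have hb : ∀ {r : ℕ}, HolderBound ε r M f → ∀ x ∈ UI,
      |Real.log (f x)| ≤ |Real.log m| + |Real.log M| := fun {r} hf x hx => by
    have h1 := Real.log_le_log hm (hfm x hx)
    have h2 := Real.log_le_log (hm.trans_le (hfm x hx)) ((le_abs_self _).trans (hf.abs_le x hx))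
    rw [_root_.abs_le]
    constructor
    · linarith [neg_abs_le (Real.log m), abs_nonneg (Real.log M)]
    · linarith [le_abs_self (Real.log M), abs_nonneg (Real.log m)]
  induction r with
  | zero =>
    refine ⟨max (|Real.log m| + |Real.log M|) (m⁻¹ * M),
      fun x hx => (hb hf x hx).trans (le_max_left _ _), fun x hx y hy => ?_⟩
    have h1 : |Real.log (f x) - Real.log (f y)| ≤ m⁻¹ * |f x - f y| :=
      (convex_Ici m).norm_image_sub_le_of_norm_hasDerivWithin_le
        (f := Real.log) (f' := fun z => z⁻¹)
        (fun z hz => (Real.hasDerivAt_log (hm.trans_le hz).ne').hasDerivWithinAt)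
        (fun z hz => by
          rw [Real.norm_eq_abs, abs_inv, abs_of_pos (hm.trans_le hz)]
          exact inv_anti₀ hm hz)
        (hfm y hy) (hfm x hx)
    refine (h1.trans (mul_le_mul_of_nonneg_left (hf.2 x hx y hy) (by positivity))).trans ?_
    rw [← mul_assoc]
    exact mul_le_mul_of_nonneg_right (le_max_right _ _) (Real.rpow_nonneg (abs_nonneg _) _)
  | succ r ih =>
    obtain ⟨C, hC⟩ := ih (hf.of_succ hε1)
    obtain ⟨C', hC'⟩ := exists_exp hε1 r (2 ^ (r + 1) * C)
    have hfb := hb hf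
    obtain ⟨h1, f', h2, h3⟩ := hf
    refine ⟨max (|Real.log m| + |Real.log M|) (2 ^ (r + 1) * (M * C')),
      fun x hx => (hfb x hx).trans (le_max_left _ _), fun x => f' x * Real.exp (-Real.log (f x)),
      fun x hx => ?_, (h3.mul hε1 (hC' _ (hC.neg hε1))).mono (le_max_right _ _)⟩
    have hpos := hm.trans_le (hfm x hx)
    refine ((h2 x hx).log hpos.ne').congr_deriv ?_
    simp only [Real.exp_neg, Real.exp_log hpos]; rfl

/-- The derivatives of a function with a Hölder bound. -/
theorem exists_chain (hf : HolderBound ε r M f) : ∃ g : ℕ → ℝ → ℝ, g 0 = f ∧ IsDerivChain r g ∧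
    HolderBound ε 0 M (g r) := by
  induction r generalizing f with
  | zero => exact ⟨fun _ => f, rfl, fun m hm => absurd hm (Nat.not_lt_zero m), hf⟩
  | succ r ih =>
    obtain ⟨h1, f', h2, h3⟩ := hf
    obtain ⟨g, hg0, hg, hgr⟩ := ih h3
    refine ⟨fun m => Nat.casesOn m f g, rfl, fun m hm x hx => ?_, hgr⟩
    cases m with
    | zero => show HasDerivWithinAt f (g 0 x) UI x
              rw [hg0]; exact h2 x hx
    | succ m => exact hg m (by omega) x hx

theorem exists_of_contDiff (r : ℕ) {F : ℝ → ℝ} (hF : ContDiff ℝ r F) {K : ℝ}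
    (hK : ∀ x y, |iteratedDeriv r F x - iteratedDeriv r F y| ≤ K * |x - y| ^ ε) :
    ∃ M, HolderBound ε r M F := by
  have hb : ∀ {G : ℝ → ℝ}, Continuous G → ∃ M, ∀ x ∈ UI, |G x| ≤ M := fun hG =>
    isCompact_Icc.exists_bound_of_continuousOn hG.continuousOn
  induction r generalizing F with
  | zero =>
    obtain ⟨M, hM⟩ := hb hF.continuous
    refine ⟨max M K, fun x hx => (hM x hx).trans (le_max_left _ _), fun x _ y _ => ?_⟩
    have := hK x y
    rw [iteratedDeriv_zero] at this
    exact this.trans (mul_le_mul_of_nonneg_right (le_max_right _ _)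
      (Real.rpow_nonneg (abs_nonneg _) _))
  | succ r ih =>
    obtain ⟨M, hM⟩ := hb hF.continuous
    push_cast at hF
    rw [contDiff_succ_iff_deriv] at hF
    obtain ⟨M', hM'⟩ := ih hF.2.2 (by simpa only [iteratedDeriv_succ'] using hK)
    exact ⟨max M M', fun x hx => (hM x hx).trans (le_max_left _ _), deriv F,
      fun x _ => (hF.1 x).hasDerivAt.hasDerivWithinAt, hM'.mono (le_max_right _ _)⟩

end HolderBound

end CantorScaling

/-! ### Limits of rescaled compositions -/

namespace CantorScaling

/-- Nearest point retraction onto the unit interval. -/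
noncomputable def clamp (x : ℝ) : ℝ := max 0 (min 1 x)

theorem clamp_mem (x : ℝ) : clamp x ∈ UI :=
  ⟨le_max_left _ _, max_le zero_le_one (min_le_left _ _)⟩

theorem clamp_of_mem {x : ℝ} (hx : x ∈ UI) : clamp x = x := by
  rw [clamp, min_eq_right hx.2, max_eq_right hx.1]

theorem continuous_clamp : Continuous clamp := by unfold clamp; fun_prop

theorem HolderBound.continuousOn {ε M : ℝ} {r : ℕ} {f : ℝ → ℝ} (hε : 0 < ε) (hε1 : ε ≤ 1)
    (hf : HolderBound ε r M f) : ContinuousOn f UI := by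
  have hf0 : HolderBound ε 0 M f := hf.of_le hε1 (Nat.zero_le r)
  intro y hy
  rw [ContinuousWithinAt, tendsto_iff_dist_tendsto_zero]
  have h2 : Tendsto (fun x => M * |x - y| ^ ε) (𝓝[UI] y) (𝓝 0) := by
    have h : Continuous fun x => |x - y| := by fun_prop
    have h' : Tendsto (fun x => |x - y|) (𝓝[UI] y) (𝓝 0) := by
      simpa using (h.tendsto y).mono_left nhdsWithin_le_nhds
    have := (h'.rpow_const (p := ε) (Or.inr hε.le)).const_mul M
    rwa [Real.zero_rpow hε.ne', mul_zero] at this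
  refine squeeze_zero' (Eventually.of_forall fun _ => dist_nonneg) ?_ h2
  filter_upwards [self_mem_nhdsWithin] with x hx
  exact hf0.2 x hx y hy

theorem abs_exp_sub_exp_le {A u v : ℝ} (hu : u ≤ A) (hv : v ≤ A) :
    |Real.exp u - Real.exp v| ≤ Real.exp A * |u - v| :=
  (convex_Iic A).norm_image_sub_le_of_norm_hasDerivWithin_le (f := Real.exp) (f' := Real.exp)
    (fun z _ => (Real.hasDerivAt_exp z).hasDerivWithinAt)
    (fun z hz => by rw [Real.norm_eq_abs, Real.abs_exp]; exact Real.exp_le_exp.2 hz) hv hu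

/-- The diffeomorphism of the line that fixes `0` and `1` and has logarithmic derivative `L` up to
an additive constant. -/
theorem exists_normalized_primitive {L : ℝ → ℝ} (hL : Continuous L) {A : ℝ}
    (hA : ∀ x, |L x| ≤ A) :
    ∃ (a : ℝ) (Φ P : ℝ → ℝ), |a| ≤ A ∧ Φ 0 = 0 ∧ Φ 1 = 1 ∧
      (∀ x, HasDerivAt Φ (Real.exp (L x + a)) x) ∧ (∀ x, P (Φ x) = x) ∧ (∀ y, Φ (P y) = y) ∧
      ∀ y, HasDerivAt P (Real.exp (-(L (P y) + a))) y := by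
  have hEc : Continuous fun x => Real.exp (L x) := Real.continuous_exp.comp hL
  let H : ℝ → ℝ := fun x => ∫ t in (0 : ℝ)..x, Real.exp (L t)
  have hH0 : H 0 = 0 := intervalIntegral.integral_same
  have hHd : ∀ x, HasDerivAt H (Real.exp (L x)) x := fun x =>
    (hEc.integral_hasStrictDerivAt 0 x).hasDerivAt
  have hHdiff : Differentiable ℝ H := fun x => (hHd x).differentiableAt
  -- The mean value theorem gives `H 1 = exp (L ξ)`, so the normalizing constant is `a = -L ξ`,
  -- bounded by `A` like `L` itself.
  obtain ⟨ξ, -, hξ⟩ := exists_hasDerivAt_eq_slope H (fun x => Real.exp (L x)) zero_lt_one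
    hHdiff.continuous.continuousOn fun x _ => hHd x
  rw [hH0, sub_zero, sub_zero, div_one] at hξ
  let Φ : ℝ → ℝ := fun x => Real.exp (-L ξ) * H x
  have hΦd : ∀ x, HasDerivAt Φ (Real.exp (L x + -L ξ)) x := fun x =>
    ((hHd x).const_mul _).congr_deriv (by rw [← Real.exp_add, add_comm])
  have hΦ0 : Φ 0 = 0 := by simp only [Φ, hH0, mul_zero]
  have hΦ1 : Φ 1 = 1 := by simp only [Φ, ← hξ, ← Real.exp_add, neg_add_cancel, Real.exp_zero]
  have hΦc : Continuous Φ := continuous_iff_continuousAt.2 fun x => (hΦd x).continuousAt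
  have hmono : StrictMono Φ := strictMono_of_deriv_pos fun x => by
    rw [(hΦd x).deriv]; exact Real.exp_pos _
  have hlow : ∀ x, Real.exp (-(2 * A)) ≤ Real.exp (L x + -L ξ) := fun x => by
    have h1 := abs_le.1 (hA x)
    have h2 := abs_le.1 (hA ξ)
    exact Real.exp_le_exp.2 (by linarith)
  have hgrow : ∀ x y, x ≤ y → Real.exp (-(2 * A)) * (y - x) ≤ Φ y - Φ x := by
    intro x y hxy
    exact mul_sub_le_image_sub_of_le_deriv (fun x => (hΦd x).differentiableAt)
      (fun x => (hΦd x).deriv ▸ hlow x) hxy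
  have hsurj : Function.Surjective Φ := by
    have hc : 0 < Real.exp (-(2 * A)) := Real.exp_pos _
    refine hΦc.surjective ?_ ?_
    · refine tendsto_atTop_mono' _ ?_ (tendsto_id.const_mul_atTop hc)
      filter_upwards [eventually_ge_atTop 0] with x hx
      have := hgrow 0 x hx
      simpa [hΦ0] using this
    · refine tendsto_atBot_mono' _ ?_ (tendsto_id.const_mul_atBot hc)
      filter_upwards [eventually_le_atBot 0] with x hx
      have := hgrow x 0 hx
      rw [hΦ0] at this
      simp only [id]
      linarith
  let e := (hmono.orderIsoOfSurjective Φ hsurj).toHomeomorph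
  have he : ∀ x, e x = Φ x := fun _ => rfl
  have hr : ∀ y, Φ (e.symm y) = y := fun y => e.apply_symm_apply y
  refine ⟨-L ξ, Φ, e.symm, by rw [abs_neg]; exact hA ξ, hΦ0, hΦ1, hΦd,
    fun x => e.symm_apply_apply x, hr, fun y => ?_⟩
  rw [Real.exp_neg]
  exact HasDerivAt.of_local_left_inverse e.symm.continuous.continuousAt (hΦd _)
    (Real.exp_pos _).ne' (Eventually.of_forall hr)

section Compositions

variable {d : ℕ} (F : Fin d → ℝ → ℝ)

/-- `F (j (n - 1)) ∘ ⋯ ∘ F (j 0)`. -/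
def comps (j : Word d) : ℕ → ℝ → ℝ
  | 0 => id
  | n + 1 => fun x => F (j n) (comps j n x)

theorem comps_prepend (c : Fin d) (j : Word d) (n : ℕ) (x : ℝ) :
    comps F (prepend c j) (n + 1) x = comps F j n (F c x) := by
  induction n with
  | zero => rfl
  | succ n ih =>
    show F (j n) (comps F (prepend c j) (n + 1) x) = F (j n) (comps F j n (F c x))
    rw [ih]

variable {F} {ℓ : Fin d → ℝ → ℝ}

theorem comps_mapsTo (hU : ∀ i, MapsTo (F i) UI UI) (j : Word d) (n : ℕ) :
    MapsTo (comps F j n) UI UI := by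
  induction n with
  | zero => exact mapsTo_id _
  | succ n ih => exact fun x hx => hU _ (ih hx)

variable (hF : ∀ i x, HasDerivAt (F i) (Real.exp (ℓ i x)) x)
include hF

theorem comps_hasDerivAt (j : Word d) (n : ℕ) (x : ℝ) :
    HasDerivAt (comps F j n)
      (Real.exp (∑ m ∈ Finset.range n, ℓ (j m) (comps F j m x))) x := by
  induction n with
  | zero => simpa [comps] using hasDerivAt_id x
  | succ n ih =>
    refine ((hF (j n) (comps F j n x)).comp x ih).congr_deriv ?_
    rw [Finset.sum_range_succ, add_comm, Real.exp_add]

variable (hU : ∀ i, MapsTo (F i) UI UI) {c : ℝ} (hc : ∀ i, ∀ x ∈ UI, Real.exp (ℓ i x) ≤ c)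
include hU hc

omit hF in
theorem exp_sum_le (j : Word d) (n : ℕ) {x : ℝ} (hx : x ∈ UI) :
    Real.exp (∑ m ∈ Finset.range n, ℓ (j m) (comps F j m x)) ≤ c ^ n := by
  rw [Real.exp_sum]
  refine (Finset.prod_le_prod (fun _ _ => (Real.exp_pos _).le) fun m _ =>
    hc (j m) _ (comps_mapsTo hU j m hx)).trans_eq ?_
  rw [Finset.prod_const, Finset.card_range]

variable (hc1 : c < 1) {ε : ℝ} (hε : 0 < ε) (hε1 : ε ≤ 1)
include hc1 hε hε1

/-- At order `0` the decay comes from the contraction of the compositions by `c ^ m`. At order `r +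
1` the derivative contains the factor `comps'`, the exponential of a sum of earlier log-derivatives.
That sum minus its value at `0` is bounded at order `r` by induction, and its value at `0`
contributes at most `c ^ m`. -/
theorem exists_bound_log_deriv (hd : 0 < d) (r : ℕ) {M : ℝ}
    (hℓ : ∀ i, HolderBound ε r M (ℓ i)) :
    ∃ B, ∀ (j : Word d) (m : ℕ), HolderBound ε r (B * (c ^ ε) ^ m)
      fun x => ℓ (j m) (comps F j m x) - ℓ (j m) (comps F j m 0) := by
  have h0 : (0 : ℝ) ∈ UI := ⟨le_rfl, zero_le_one⟩
  have hc0 : 0 < c := (Real.exp_pos _).trans_le (hc ⟨0, hd⟩ 0 h0)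
  have hb0 : 0 < c ^ ε := Real.rpow_pos_of_pos hc0 _
  have hb1 : c ^ ε < 1 := Real.rpow_lt_one hc0.le hc1 hε
  have hcb : ∀ m : ℕ, c ^ m ≤ (c ^ ε) ^ m := fun m => pow_le_pow_left₀ hc0.le
    (by simpa using Real.rpow_le_rpow_of_exponent_ge hc0 hc1.le hε1) m
  induction r generalizing M with
  | zero =>
    refine ⟨M, fun j m => ?_⟩
    have hM := (hℓ ⟨0, hd⟩).nonneg
    have hlip : ∀ x ∈ UI, ∀ y ∈ UI, |comps F j m x - comps F j m y| ≤ c ^ m * |x - y| :=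
      fun x hx y hy => HolderBound.abs_sub_le_of_deriv
        (fun z _ => (comps_hasDerivAt hF j m z).hasDerivWithinAt)
        (fun z hz => by rw [Real.abs_exp]; exact exp_sum_le hU hc j m hz) hx hy
    have hmain : ∀ x ∈ UI, ∀ y ∈ UI, |ℓ (j m) (comps F j m x) - ℓ (j m) (comps F j m y)| ≤
        M * (c ^ ε) ^ m * |x - y| ^ ε := by
      intro x hx y hy
      refine ((hℓ (j m)).2 _ (comps_mapsTo hU j m hx) _ (comps_mapsTo hU j m hy)).trans ?_
      rw [mul_assoc]
      refine mul_le_mul_of_nonneg_left ?_ hM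
      refine (Real.rpow_le_rpow (abs_nonneg _) (hlip x hx y hy) hε.le).trans_eq ?_
      rw [Real.mul_rpow (by positivity) (abs_nonneg _), ← Real.rpow_natCast, ← Real.rpow_natCast,
        ← Real.rpow_mul hc0.le, ← Real.rpow_mul hc0.le, mul_comm ε]
    refine ⟨fun x hx => (hmain x hx 0 h0).trans ?_, fun x hx y hy => ?_⟩
    · exact mul_le_of_le_one_right (by positivity)
        (Real.rpow_le_one (abs_nonneg _) (abs_sub_le_one hx h0) hε.le)
    · rw [sub_sub_sub_cancel_right]
      exact hmain x hx y hy
  | succ r ih =>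
    obtain ⟨B, hB⟩ := ih fun i => (hℓ i).of_succ hε1
    have hB0 : 0 ≤ B := by simpa using (hB (fun _ => ⟨0, hd⟩) 0).nonneg
    obtain ⟨C₁, hC₁⟩ := HolderBound.exists_exp (ε := ε) hε1 r (B / (1 - c ^ ε))
    obtain ⟨C₂, hC₂⟩ := HolderBound.exists_comp hε hε1 r M (2 ^ (r + 1) * C₁)
    choose hℓb ℓ' hℓ' hℓ'b using hℓ
    refine ⟨max B (2 ^ (r + 1) * (C₂ * (2 ^ (r + 1) * C₁))), fun j m => ?_⟩
    have hsum : HolderBound ε r (B / (1 - c ^ ε)) fun x =>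
        ∑ i ∈ Finset.range m, (ℓ (j i) (comps F j i x) - ℓ (j i) (comps F j i 0)) := by
      refine (HolderBound.finset_sum (hB j) (Finset.range m)).mono ?_
      rw [← Finset.mul_sum]
      have := sum_pow_le hb0.le hb1 m
      rw [div_eq_mul_inv]
      exact mul_le_mul_of_nonneg_left (by simpa using this) hB0
    have hexp := hC₁ _ hsum
    obtain ⟨q, hq⟩ : ∃ q, q = Real.exp (∑ i ∈ Finset.range m, ℓ (j i) (comps F j i 0)) :=
      ⟨_, rfl⟩
    have hq0 : 0 < q := hq ▸ Real.exp_pos _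
    have hqc : q ≤ c ^ m := hq ▸ exp_sum_le hU hc j m h0
    have hC₁0 := hexp.nonneg
    have hG' : HolderBound ε r (2 ^ (r + 1) * C₁ * c ^ m) fun x =>
        Real.exp (∑ i ∈ Finset.range m, ℓ (j i) (comps F j i x)) := by
      refine (((HolderBound.const r q).mul hε1 hexp).mono ?_).congr fun x _ => ?_
      · rw [abs_of_pos hq0, mul_comm q, ← mul_assoc]
        exact mul_le_mul_of_nonneg_left hqc (by positivity)
      · simp only [Finset.sum_sub_distrib, Real.exp_sub, ← hq]
        field_simp
    have hG'1 := hG'.mono (mul_le_of_le_one_right (by positivity) (pow_le_one₀ hc0.le hc1.le))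
    have hcomp := hC₂ (ℓ' (j m)) (comps F j m) _ (hℓ'b (j m)) (comps_mapsTo hU j m)
      (fun x _ => (comps_hasDerivAt hF j m x).hasDerivWithinAt) hG'1.abs_le
      (fun s hs => hG'1.of_le hε1 hs.le)
    refine ⟨fun x hx => ((hB j m).abs_le x hx).trans
        (mul_le_mul_of_nonneg_right (le_max_left _ _) (by positivity)), _, fun x hx =>
      ((hℓ' (j m) _ (comps_mapsTo hU j m hx)).comp x
        (comps_hasDerivAt hF j m x).hasDerivWithinAt (comps_mapsTo hU j m)).sub_const _, ?_⟩
    refine (hcomp.mul hε1 hG').mono ?_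
    have hC₂0 := hcomp.nonneg
    have h1 := mul_le_mul_of_nonneg_left (hcb m)
      (show 0 ≤ 2 ^ (r + 1) * (C₂ * (2 ^ (r + 1) * C₁)) by positivity)
    have h2 := mul_le_mul_of_nonneg_right (le_max_right B (2 ^ (r + 1) * (C₂ * (2 ^ (r + 1) * C₁))))
      (show 0 ≤ (c ^ ε) ^ m by positivity)
    refine le_trans (le_of_eq ?_) (h1.trans h2)
    ring

/-- The log-derivatives of the compositions, each normalized to vanish at `0`, converge uniformly.
Hence the compositions converge up to scalar factors, and such factors cancel in the quotients of
increments. -/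
theorem exists_limit_coordinates (hd : 0 < d) (r : ℕ) {M : ℝ}
    (hℓ : ∀ i, HolderBound ε r M (ℓ i)) :
    ∃ (B : ℝ) (Λ Φ P : Word d → ℝ → ℝ), ∀ j, HolderBound ε r B (Λ j) ∧ Φ j 0 = 0 ∧ Φ j 1 = 1 ∧
      (∀ x, HasDerivAt (Φ j) (Real.exp (Λ j x)) x) ∧ (∀ x, P j (Φ j x) = x) ∧
      (∀ y, Φ j (P j y) = y) ∧ (∀ y, HasDerivAt (P j) (Real.exp (-Λ j (P j y))) y) ∧
      ∀ x ∈ UI, ∀ y ∈ UI, Tendsto (fun n => (comps F j n y - comps F j n x) /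
        (comps F j n 1 - comps F j n 0)) atTop (𝓝 (Φ j y - Φ j x)) := by
  have h0 : (0 : ℝ) ∈ UI := ⟨le_rfl, zero_le_one⟩
  have h1 : (1 : ℝ) ∈ UI := ⟨zero_le_one, le_rfl⟩
  have hc0 : 0 < c := (Real.exp_pos _).trans_le (hc ⟨0, hd⟩ 0 h0)
  have hb0 : 0 < c ^ ε := Real.rpow_pos_of_pos hc0 _
  have hb1 : c ^ ε < 1 := Real.rpow_lt_one hc0.le hc1 hε
  obtain ⟨B, hB⟩ := exists_bound_log_deriv hF hU hc hc1 hε hε1 hd r hℓ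
  have hsum : Summable fun m : ℕ => B * (c ^ ε) ^ m :=
    (summable_geometric_of_lt_one hb0.le hb1).mul_left B
  obtain ⟨A, hA⟩ : ∃ A, A = ∑' m : ℕ, B * (c ^ ε) ^ m := ⟨_, rfl⟩
  let T : Word d → ℕ → ℝ → ℝ := fun j m x =>
    ℓ (j m) (comps F j m x) - ℓ (j m) (comps F j m 0)
  let L : Word d → ℝ → ℝ := fun j x => ∑' m, T j m x
  have hL : ∀ j, HolderBound ε r A (L j) := fun j => hA ▸ HolderBound.tsum hε hε1 hsum (hB j)
  -- The series is controlled on `[0,1]` only; extending its sum by constants makes `Φ j` a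
  -- diffeomorphism of the whole line without changing it on `[0,1]`.
  have hLc : ∀ j, Continuous fun x => L j (clamp x) := fun j =>
    ((hL j).continuousOn hε hε1).comp_continuous continuous_clamp clamp_mem
  choose a Φ P ha hΦ0 hΦ1 hΦd hPΦ hΦP hPd using fun j =>
    exists_normalized_primitive (hLc j) fun x => (hL j).abs_le _ (clamp_mem x)
  refine ⟨A + A, fun j x => L j (clamp x) + a j, Φ, P, fun j => ⟨?_, hΦ0 j, hΦ1 j, hΦd j, hPΦ j,
    hΦP j, hPd j, ?_⟩⟩
  · refine ((hL j).add ((HolderBound.const r (a j)).mono (ha j))).congr fun x hx => ?_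
    simp only [clamp_of_mem hx]
  obtain ⟨q, hq⟩ : ∃ q : ℕ → ℝ, q = fun n => Real.exp
    (-(∑ m ∈ Finset.range n, ℓ (j m) (comps F j m 0)) + a j) := ⟨_, rfl⟩
  have hq0 : ∀ n, 0 < q n := fun n => hq ▸ Real.exp_pos _
  have hunif := tendstoUniformlyOn_tsum_nat (f := T j) (s := UI) hsum fun m x hx =>
    (hB j m).abs_le x hx
  have hlim : ∀ x ∈ UI, ∀ y ∈ UI, Tendsto (fun n => q n * (comps F j n y - comps F j n x)) atTop
      (𝓝 (Φ j y - Φ j x)) := by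
    intro x hx y hy
    rw [Metric.tendsto_nhds]
    intro e he
    obtain ⟨E, hE⟩ : ∃ E, E = Real.exp (A + 1 + A) := ⟨_, rfl⟩
    have hE0 : 0 < E := hE ▸ Real.exp_pos _
    obtain ⟨η, hη⟩ : ∃ η, η = min 1 (e / 2 / E) := ⟨_, rfl⟩
    have hη0 : 0 < η := by rw [hη]; positivity
    filter_upwards [(Metric.tendstoUniformlyOn_iff.1 hunif) η hη0] with n hn
    have hder : ∀ z ∈ UI, HasDerivWithinAt (fun z => q n * comps F j n z - Φ j z)
        (Real.exp (∑ m ∈ Finset.range n, T j m z + a j) - Real.exp (L j z + a j)) UI z := by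
      intro z hz
      have := (((comps_hasDerivAt hF j n z).const_mul (q n)).sub (hΦd j z)).hasDerivWithinAt
        (s := UI)
      refine this.congr_deriv ?_
      rw [clamp_of_mem hz, hq, ← Real.exp_add]
      congr 2
      simp only [T, Finset.sum_sub_distrib]
      ring
    have hbd : ∀ z ∈ UI, |Real.exp (∑ m ∈ Finset.range n, T j m z + a j) -
        Real.exp (L j z + a j)| ≤ E * η := by
      intro z hz
      have h2 := hn z hz
      rw [dist_comm, Real.dist_eq] at h2
      have h3 := abs_le.1 ((hL j).abs_le z hz)
      have h4 := abs_lt.1 h2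
      have h5 : η ≤ 1 := hη ▸ min_le_left _ _
      have h6 := abs_le.1 (ha j)
      have h7 : (∑' m, T j m z) = L j z := rfl
      rw [h7] at h4 h2
      refine (abs_exp_sub_exp_le (A := A + 1 + A) (by linarith) (by linarith)).trans ?_
      rw [← hE, add_sub_add_right_eq_sub]
      exact mul_le_mul_of_nonneg_left h2.le hE0.le
    have h8 := HolderBound.abs_sub_le_of_deriv hder hbd hy hx
    have h9 : E * η ≤ e / 2 := by
      have := min_le_right 1 (e / 2 / E)
      rw [← hη, le_div_iff₀ hE0] at this
      linarith
    rw [Real.dist_eq]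
    have e1 : q n * (comps F j n y - comps F j n x) - (Φ j y - Φ j x) =
      q n * comps F j n y - Φ j y - (q n * comps F j n x - Φ j x) := by ring
    rw [e1]
    have h10 : E * η * |y - x| ≤ E * η :=
      mul_le_of_le_one_right (by positivity) (abs_sub_le_one hy hx)
    linarith
  intro x hx y hy
  have h2 := (hlim x hx y hy).div (hlim 0 h0 1 h1) (by rw [hΦ0, hΦ1]; norm_num)
  rw [hΦ0, hΦ1, sub_zero, div_one] at h2
  refine h2.congr fun n => ?_
  simp only [Pi.div_apply]
  exact mul_div_mul_left _ _ (hq0 n).ne'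

end Compositions

end CantorScaling

/-! ### Coordinates of a smooth embedding -/

namespace CantorScaling

section Embedding

variable {d : ℕ} {h : Word d → ℝ}

theorem IsOrderedEmbedding.lt_of_lt (hh : IsOrderedEmbedding h) {α β : Word d} {m : ℕ}
    (heq : ∀ i < m, α i = β i) (hm : α m < β m) : h α < h β :=
  (hh.order β α m (fun i hi => (heq i hi).symm) hm.ne').2 hm

theorem IsOrderedEmbedding.le_of_le (hh : IsOrderedEmbedding h) {α β : Word d}
    (hle : ∀ m, α m ≤ β m) : h α ≤ h β := by
  by_cases hαβ : α = β
  · rw [hαβ]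
  · have hne : α (PiNat.firstDiff α β) ≠ β (PiNat.firstDiff α β) := PiNat.apply_firstDiff_ne hαβ
    have heq : ∀ i < PiNat.firstDiff α β, α i = β i :=
      fun i hi => PiNat.apply_eq_of_lt_firstDiff hi
    exact (hh.lt_of_lt heq (lt_of_le_of_ne (hle _) hne)).le

theorem IsOrderedEmbedding.mem (hh : IsOrderedEmbedding h) (α : Word d) : h α ∈ UI := by
  have := subset_convexHull ℝ _ (mem_range_self (f := h) α)
  rwa [hh.hull] at this

theorem IsOrderedEmbedding.map_first (hh : IsOrderedEmbedding h) (hd : 0 < d) :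
    h (fun _ => ⟨0, hd⟩) = 0 := by
  refine le_antisymm ?_ (hh.mem _).1
  have h1 : convexHull ℝ (range h) ⊆ Ici (h fun _ => ⟨0, hd⟩) := by
    refine convexHull_min ?_ (convex_Ici _)
    rintro _ ⟨α, rfl⟩
    exact hh.le_of_le fun m => Nat.zero_le _
  rw [hh.hull] at h1
  exact h1 ⟨le_rfl, zero_le_one⟩

theorem IsOrderedEmbedding.map_last (hh : IsOrderedEmbedding h) (hd : 0 < d) :
    h (fun _ => ⟨d - 1, by omega⟩) = 1 := by
  refine le_antisymm (hh.mem _).2 ?_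
  have h1 : convexHull ℝ (range h) ⊆ Iic (h fun _ => ⟨d - 1, by omega⟩) := by
    refine convexHull_min ?_ (convex_Iic _)
    rintro _ ⟨α, rfl⟩
    exact hh.le_of_le fun m => Nat.le_pred_of_lt (α m).2
  rw [hh.hull] at h1
  exact h1 ⟨zero_le_one, le_rfl⟩

theorem exists_revApp {l : List (Fin d)} {α : Word d} (hα : pre α l.length = l) :
    ∃ β, α = revApp l β := by
  induction l with
  | nil => exact ⟨α, rfl⟩
  | cons c l ih =>
    simp only [List.length_cons, pre, List.cons.injEq] at hα
    obtain ⟨β, hβ⟩ := ih hα.2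
    have h1 := pre_revApp l β 1
    rw [← hβ] at h1
    simp only [pre, List.cons_append, List.nil_append, List.cons.injEq, hα.1] at h1
    refine ⟨fun m => β (m + 1), ?_⟩
    rw [hβ, revApp]
    congr 1
    funext m
    cases m with
    | zero => exact h1.1.symm
    | succ m => rfl

variable {F : Fin d → ℝ → ℝ}

theorem comps_apply (hF : ∀ i α, F i (h α) = h (prepend i α)) (j : Word d) (n : ℕ) (β : Word d) :
    comps F j n (h β) = h (revApp (tk j n) β) := by
  induction n generalizing j β with
  | zero => rfl
  | succ n ih =>
    have hj : j = prepend (j 0) fun m => j (m + 1) := by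
      funext m
      cases m <;> rfl
    rw [tk, revApp, ← ih, ← hF, ← comps_prepend, ← hj]

theorem piece_eq_image (hF : ∀ i α, F i (h α) = h (prepend i α)) (j : Word d) (n : ℕ) :
    piece h j n = comps F j n '' range h := by
  rw [piece_eq]
  ext x
  constructor
  · rintro ⟨α, hα, rfl⟩
    obtain ⟨β, rfl⟩ := exists_revApp hα
    exact ⟨h β, ⟨β, rfl⟩, comps_apply hF j n β⟩
  · rintro ⟨_, ⟨β, rfl⟩, rfl⟩
    exact ⟨revApp (tk j n) β, pre_revApp (tk j n) β 0, (comps_apply hF j n β).symm⟩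

variable (hh : IsOrderedEmbedding h) (hd : 0 < d) (hF : ∀ i α, F i (h α) = h (prepend i α))
  (hmono : ∀ i, StrictMono (F i))

theorem comps_strictMono (hmono : ∀ i, StrictMono (F i)) (j : Word d) (n : ℕ) :
    StrictMono (comps F j n) := by
  induction n with
  | zero => exact strictMono_id
  | succ n ih => exact (hmono _).comp ih

include hh hd hF hmono

theorem branch_mapsTo (i : Fin d) : MapsTo (F i) UI UI := by
  intro x hx
  have h0 : F i 0 ∈ UI := by rw [← hh.map_first hd, hF]; exact hh.mem _
  have h1 : F i 1 ∈ UI := by rw [← hh.map_last hd, hF]; exact hh.mem _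
  exact ⟨h0.1.trans ((hmono i).monotone hx.1), ((hmono i).monotone hx.2).trans h1.2⟩

theorem sInf_piece (j : Word d) (n : ℕ) : sInf (piece h j n) = comps F j n 0 := by
  rw [piece_eq_image hF]
  refine IsLeast.csInf_eq ⟨⟨0, ⟨_, hh.map_first hd⟩, rfl⟩, ?_⟩
  rintro _ ⟨_, ⟨α, rfl⟩, rfl⟩
  exact (comps_strictMono hmono j n).monotone (hh.mem α).1

theorem sSup_piece (j : Word d) (n : ℕ) : sSup (piece h j n) = comps F j n 1 := by
  rw [piece_eq_image hF]
  refine IsGreatest.csSup_eq ⟨⟨1, ⟨_, hh.map_last hd⟩, rfl⟩, ?_⟩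
  rintro _ ⟨_, ⟨α, rfl⟩, rfl⟩
  exact (comps_strictMono hmono j n).monotone (hh.mem α).2

theorem levelScaling_inl (j : Word d) (n : ℕ) (i : Fin d) :
    levelScaling h j n (Sum.inl i) = (comps F j n (F i 1) - comps F j n (F i 0)) /
      (comps F j n 1 - comps F j n 0) := by
  simp only [levelScaling, hullLength, sInf_piece hh hd hF hmono, sSup_piece hh hd hF hmono,
    comps_prepend]

theorem levelScaling_inr (j : Word d) (n : ℕ) (g : Fin (d - 1)) :
    levelScaling h j n (Sum.inr g) =
      (comps F j n (F ⟨g + 1, by omega⟩ 0) - comps F j n (F ⟨g, by omega⟩ 1)) /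
        (comps F j n 1 - comps F j n 0) := by
  simp only [levelScaling, hullLength, sInf_piece hh hd hF hmono, sSup_piece hh hd hF hmono,
    comps_prepend]

end Embedding

variable {d k : ℕ} {ε : ℝ} {h : Word d → ℝ} {S : Word d → simp d}

/-- The level geometries are quotients of increments of the compositions, so their limits are read
off from `Φ j`. The functional equation is the limit of the identity `comps (prepend i j) (n + 1) =
comps j n ∘ F i` after normalization. -/
theorem IsSmoothEmbedding.exists_coordinates (hh : IsSmoothEmbedding k ε h)
    (hS : IsScalingFunction h S) (hd : 0 < d) (hk : 1 ≤ k) (hε : 0 < ε) (hε1 : ε ≤ 1) :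
    ∃ (B : ℝ) (F : Fin d → ℝ → ℝ) (Λ Φ P : Word d → ℝ → ℝ), (∀ i, MapsTo (F i) UI UI) ∧
      ∀ j, HolderBound ε (k - 1) B (Λ j) ∧ Φ j 0 = 0 ∧ Φ j 1 = 1 ∧
        (∀ x, HasDerivAt (Φ j) (Real.exp (Λ j x)) x) ∧ (∀ x, P j (Φ j x) = x) ∧
        (∀ y, Φ j (P j y) = y) ∧ (∀ y, HasDerivAt (P j) (Real.exp (-Λ j (P j y))) y) ∧
        ∀ i, leftEnd (S j).1 i = Φ j (F i 0) ∧ rightEnd (S j).1 i = Φ j (F i 1) ∧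
          ∀ x ∈ UI, Φ j (F i x) =
            leftEnd (S j).1 i + (S j).1 (Sum.inl i) * Φ (prepend i j) x := by
  have : Nonempty (Fin d) := ⟨⟨0, hd⟩⟩
  obtain ⟨he, hsm⟩ := hh
  choose F hFh hFk hFc hFpos using hsm
  choose c hc using hFc
  have h0 : (0 : ℝ) ∈ UI := ⟨le_rfl, zero_le_one⟩
  have h1 : (1 : ℝ) ∈ UI := ⟨zero_le_one, le_rfl⟩
  have hFd : ∀ i, Differentiable ℝ (F i) := fun i => (hFk i).1.differentiable (by
    have : k ≠ 0 := by omega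
    exact_mod_cast this)
  have hFdc : ∀ i, Continuous (deriv (F i)) := fun i =>
    (hFk i).1.continuous_deriv (by exact_mod_cast hk)
  have hmono : ∀ i, StrictMono (F i) := fun i => strictMono_of_deriv_pos (hFpos i)
  have hU := branch_mapsTo he hd hFh hmono
  let ℓ : Fin d → ℝ → ℝ := fun i x => Real.log (deriv (F i) x)
  have hFℓ : ∀ i x, HasDerivAt (F i) (Real.exp (ℓ i x)) x := fun i x => by
    simp only [ℓ, Real.exp_log (hFpos i x)]
    exact (hFd i x).hasDerivAt
  obtain ⟨i₀, hi₀⟩ := Finite.exists_max c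
  have hcU : ∀ i, ∀ x ∈ UI, Real.exp (ℓ i x) ≤ c i₀ := fun i x _ => by
    have h2 := norm_deriv_le_of_lipschitz (hc i).2 (x₀ := x)
    rw [Real.norm_eq_abs] at h2
    simp only [ℓ, Real.exp_log (hFpos i x)]
    exact (le_abs_self _).trans (h2.trans (by exact_mod_cast hi₀ i))
  have hℓ : ∀ i, ∃ M, HolderBound ε (k - 1) M (ℓ i) := by
    intro i
    obtain ⟨hF1, K, hK⟩ := hFk i
    obtain ⟨r, rfl⟩ : ∃ r, k = r + 1 := ⟨k - 1, by omega⟩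
    push_cast at hF1
    rw [contDiff_succ_iff_deriv] at hF1
    obtain ⟨M, hM⟩ := HolderBound.exists_of_contDiff r hF1.2.2
      (by simpa only [iteratedDeriv_succ'] using hK)
    obtain ⟨z, -, hz⟩ := isCompact_Icc.exists_isMinOn (s := UI) ⟨0, h0⟩ (hFdc i).continuousOn
    exact hM.exists_log hε1 (hFpos i z) fun x hx => hz hx
  choose M hM using hℓ
  obtain ⟨i₁, hi₁⟩ := Finite.exists_max M
  obtain ⟨B, Λ, Φ, P, hΛ⟩ := exists_limit_coordinates hFℓ hU hcU (by exact_mod_cast (hc i₀).1)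
    hε hε1 hd (k - 1) fun i => (hM i).mono (hi₁ i)
  refine ⟨B, F, Λ, Φ, P, hU, fun j => ?_⟩
  obtain ⟨hB, hΦ0, hΦ1, hΦd, hPΦ, hΦP, hPd, hlim⟩ := hΛ j
  refine ⟨hB, hΦ0, hΦ1, hΦd, hPΦ, hΦP, hPd, ?_⟩
  have hSj := tendsto_pi_nhds.1 (hS j)
  have hinl : ∀ i, (S j).1 (Sum.inl i) = Φ j (F i 1) - Φ j (F i 0) := fun i =>
    tendsto_nhds_unique (hSj (Sum.inl i)) ((hlim _ (hU i h0) _ (hU i h1)).congr fun n =>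
      (levelScaling_inl he hd hFh hmono j n i).symm)
  have hinr : ∀ g : Fin (d - 1), (S j).1 (Sum.inr g) =
      Φ j (F ⟨g + 1, by omega⟩ 0) - Φ j (F ⟨g, by omega⟩ 1) := fun g =>
    tendsto_nhds_unique (hSj (Sum.inr g)) ((hlim _ (hU _ h1) _ (hU _ h0)).congr fun n =>
      (levelScaling_inr he hd hFh hmono j n g).symm)
  have hleft : ∀ n (hn : n < d), leftEnd (S j).1 ⟨n, hn⟩ = Φ j (F ⟨n, hn⟩ 0) := by
    intro n
    induction n with
    | zero =>
      intro hn
      have e : prepend ⟨0, hd⟩ (fun _ => ⟨0, hd⟩) = (fun _ => ⟨0, hd⟩ : Word d) := by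
        funext m
        cases m <;> rfl
      have e1 : F ⟨0, hd⟩ 0 = 0 := by
        conv_lhs => rw [← he.map_first hd, hFh, e, he.map_first hd]
      rw [leftEnd_zero _ _ rfl, e1, hΦ0]
    | succ n ih =>
      intro hn
      have h2 := leftEnd_succ (S j).1 ⟨n, by omega⟩
      rw [hinr, rightEnd, ih, hinl] at h2
      refine h2.trans ?_
      ring
  intro i
  have hl := hleft i i.2
  refine ⟨hl, by rw [rightEnd, hinl, show leftEnd (S j).1 i = Φ j (F i 0) from hl]; ring,
    fun x hx => ?_⟩
  have hs : 0 < (S j).1 (Sum.inl i) := simp_pos (S j).2 _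
  obtain ⟨-, hΨ0, -, -, -, -, -, hlim'⟩ := hΛ (prepend i j)
  have t1 := (hlim' 0 h0 x hx).comp (tendsto_add_atTop_nat 1)
  rw [hΨ0, sub_zero] at t1
  have t2 := (hlim _ (hU i h0) _ (hU i hx)).div (hlim _ (hU i h0) _ (hU i h1))
    (by rw [← hinl]; exact hs.ne')
  have t3 : Tendsto ((fun n => (comps F (prepend i j) n x - comps F (prepend i j) n 0) /
      (comps F (prepend i j) n 1 - comps F (prepend i j) n 0)) ∘ fun n => n + 1) atTop
      (𝓝 ((Φ j (F i x) - Φ j (F i 0)) / (Φ j (F i 1) - Φ j (F i 0)))) := by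
    refine t2.congr fun n => ?_
    simp only [Pi.div_apply, Function.comp, comps_prepend]
    refine div_div_div_cancel_right₀ ?_ _ _
    exact (sub_pos.2 (comps_strictMono hmono j n zero_lt_one)).ne'
  have e := tendsto_nhds_unique t1 t3
  rw [← hinl] at e
  rw [e, show leftEnd (S j).1 i = Φ j (F i 0) from hl]
  field_simp
  ring

end CantorScaling

/-! ### Transition maps between coordinates -/

namespace CantorScaling

theorem diffeosVar_congr {k : ℕ} {M : ℝ} {A A' : Set ℝ} {φ ψ : ℝ → ℝ} (hA : A ⊆ UI)
    (h : φ ∈ diffeosVar k M A A') (he : EqOn ψ φ UI) : ψ ∈ diffeosVar k M A A' := by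
  obtain ⟨⟨h1, h2, h3, ⟨χ, h4, h5, h6⟩, h7⟩, h8⟩ := h
  refine ⟨⟨h1.congr he.symm, h2.congr he.symm, h3.congr he, ⟨χ, h4, ⟨?_, ?_⟩, h6⟩, ?_⟩, ?_⟩
  · intro x hx
    rw [he hx]; exact h5.1 hx
  · intro x hx
    rw [he (h4 hx)]; exact h5.2 hx
  · rw [← h7]
    exact image_congr fun x hx => he (hA hx)
  · refine lt_of_eq_of_lt (iSup_congr fun p => ?_) h8
    rw [iteratedDerivWithin_congr he p.1.2, iteratedDerivWithin_congr he p.2.2]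

section Transition

variable {d r : ℕ} {ε B : ℝ} {S : Word d → simp d} {F : Fin d → ℝ → ℝ} {Λ Φ P : Word d → ℝ → ℝ}

/-- The inverse satisfies `P' = exp (-Λ ∘ P)`, so a bound of order `s` on `P'` yields one of order
`s + 1` by composition, up to order `r`. All constants are independent of the words. -/
theorem exists_transition_bound (hε : 0 < ε) (hε1 : ε ≤ 1)
    (hΛ : ∀ j, HolderBound ε r B (Λ j)) (hΦd : ∀ j x, HasDerivAt (Φ j) (Real.exp (Λ j x)) x)
    (hΦU : ∀ j, MapsTo (Φ j) UI UI) (hPU : ∀ j, MapsTo (P j) UI UI)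
    (hPd : ∀ j y, HasDerivAt (P j) (Real.exp (-Λ j (P j y))) y) :
    ∃ K, ∀ j j', HolderBound ε (r + 1) K fun x => Φ j' (P j x) := by
  obtain ⟨C, hC⟩ := HolderBound.exists_exp (ε := ε) hε1 r (2 ^ (r + 1) * B)
  have hE : ∀ j, HolderBound ε r C fun x => Real.exp (-Λ j x) := fun j =>
    hC _ ((hΛ j).neg hε1)
  have hE' : ∀ j, HolderBound ε r C fun x => Real.exp (Λ j x) := fun j =>
    hC _ ((hΛ j).mono (le_mul_of_one_le_left (hΛ j).nonneg (one_le_pow₀ one_le_two)))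
  have hPs : ∀ s ≤ r, ∃ N, ∀ j, HolderBound ε s N fun y => Real.exp (-Λ j (P j y)) := by
    intro s
    induction s with
    | zero =>
      intro hs
      obtain ⟨N, hN⟩ := HolderBound.exists_comp hε hε1 0 C C
      exact ⟨N, fun j => hN _ (P j) _ ((hE j).of_le hε1 hs) (hPU j)
        (fun y _ => (hPd j y).hasDerivWithinAt) (fun y hy => (hE j).abs_le _ (hPU j hy))
        (fun s hs => absurd hs (Nat.not_lt_zero s))⟩
    | succ s ih =>
      intro hs
      obtain ⟨N, hN⟩ := ih (by omega)
      obtain ⟨N', hN'⟩ := HolderBound.exists_comp hε hε1 (s + 1) C N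
      exact ⟨N', fun j => hN' _ (P j) _ ((hE j).of_le hε1 hs) (hPU j)
        (fun y _ => (hPd j y).hasDerivWithinAt) (hN j).abs_le
        (fun s' hs' => (hN j).of_le hε1 (by omega))⟩
  obtain ⟨N, hN⟩ := hPs r le_rfl
  obtain ⟨N', hN'⟩ := HolderBound.exists_comp hε hε1 r C N
  refine ⟨max 1 (2 ^ (r + 1) * (N' * N)), fun j j' => ⟨fun x hx => ?_, _, fun x _ =>
    ((hΦd j' (P j x)).comp x (hPd j x)).hasDerivWithinAt, ?_⟩⟩
  · have := hΦU j' (hPU j hx)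
    rw [abs_of_nonneg this.1]
    exact this.2.trans (le_max_left _ _)
  · have h1 := hN' _ (P j) _ (hE' j') (hPU j) (fun y _ => (hPd j y).hasDerivWithinAt)
      (hN j).abs_le (fun s' hs' => (hN j).of_le hε1 hs'.le)
    exact (h1.mul hε1 (hN j)).mono (le_max_right _ _)

/-- The map `G` is a composition of branches along `l` and so does not depend on `v`; in every
coordinate `Φ v` it becomes affine relative to `Φ (app l v)`. -/
theorem exists_zoom (hFU : ∀ i, MapsTo (F i) UI UI)
    (hΦ : ∀ j i, ∀ x ∈ UI, Φ j (F i x) =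
      leftEnd (S j).1 i + (S j).1 (Sum.inl i) * Φ (prepend i j) x) (l : List (Fin d)) :
    ∃ G : ℝ → ℝ, MapsTo G UI UI ∧ ∀ v, ∃ a, ∀ x ∈ UI,
      Φ v (G x) = a + Pr S l v * Φ (app l v) x := by
  induction l with
  | nil => exact ⟨id, mapsTo_id _, fun v => ⟨0, fun x _ => by simp [Pr]⟩⟩
  | cons c l ih =>
    obtain ⟨G, hG, hv⟩ := ih
    refine ⟨G ∘ F c, hG.comp (hFU c), fun v => ?_⟩
    obtain ⟨a, ha⟩ := hv v
    refine ⟨a + Pr S l v * leftEnd (S (app l v)).1 c, fun x hx => ?_⟩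
    rw [Function.comp, ha _ (hFU c hx), hΦ _ _ x hx, Pr, app_cons]
    ring

/-- The transition map of the pair `l v`, `l v'` is the transition map of `v`, `v'` restricted to an
interval of length `s = Pr S l v` and rescaled. Its top derivative oscillates by at most `s ^ (r +
1) / s' * K * s ^ ε`, with `s'` the length of the image interval. -/
theorem tameCondition_of_coordinates (hε : 0 < ε) (hε1 : ε ≤ 1)
    (hFU : ∀ i, MapsTo (F i) UI UI)
    (hΛ : ∀ j, HolderBound ε r B (Λ j)) (hΦ0 : ∀ j, Φ j 0 = 0) (hΦ1 : ∀ j, Φ j 1 = 1)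
    (hΦd : ∀ j x, HasDerivAt (Φ j) (Real.exp (Λ j x)) x) (hPΦ : ∀ j x, P j (Φ j x) = x)
    (hΦP : ∀ j y, Φ j (P j y) = y)
    (hPd : ∀ j y, HasDerivAt (P j) (Real.exp (-Λ j (P j y))) y)
    (hleft : ∀ j i, leftEnd (S j).1 i = Φ j (F i 0))
    (hright : ∀ j i, rightEnd (S j).1 i = Φ j (F i 1))
    (hΦ : ∀ j i, ∀ x ∈ UI, Φ j (F i x) =
      leftEnd (S j).1 i + (S j).1 (Sum.inl i) * Φ (prepend i j) x) :
    ∃ C, TameCondition S (r + 1) C (((r + 1 : ℕ) : ℝ) + ε - 1) := by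
  have h0 : (0 : ℝ) ∈ UI := ⟨le_rfl, zero_le_one⟩
  have h1 : (1 : ℝ) ∈ UI := ⟨zero_le_one, le_rfl⟩
  have hΦm : ∀ j, StrictMono (Φ j) := fun j => strictMono_of_deriv_pos fun x => by
    rw [(hΦd j x).deriv]; exact Real.exp_pos _
  have hPm : ∀ j, StrictMono (P j) := fun j => strictMono_of_deriv_pos fun x => by
    rw [(hPd j x).deriv]; exact Real.exp_pos _
  have hΦU : ∀ j, MapsTo (Φ j) UI UI := fun j x hx =>
    ⟨by rw [← hΦ0 j]; exact (hΦm j).monotone hx.1, by rw [← hΦ1 j]; exact (hΦm j).monotone hx.2⟩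
  have hPU : ∀ j, MapsTo (P j) UI UI := fun j x hx =>
    ⟨by rw [← hPΦ j 0, hΦ0]; exact (hPm j).monotone hx.1,
      by rw [← hPΦ j 1, hΦ1]; exact (hPm j).monotone hx.2⟩
  obtain ⟨K, hK⟩ := exists_transition_bound hε hε1 hΛ hΦd hΦU hPU hPd
  have hsm : ∀ j j', ContDiffOn ℝ (r + 1 : ℕ) (fun x => Φ j' (P j x)) UI := by
    intro j j'
    obtain ⟨g, hg0, hg, hgr⟩ := (hK j j').exists_chain
    exact hg.contDiffOn (hgr.continuousOn hε hε1) (fun x _ => by rw [hg0])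
  have hdiffeo : ∀ j j', (fun x => Φ j' (P j x)) ∈
      diffeos (r + 1) (endPoints (S j).1) (endPoints (S j').1) := by
    intro j j'
    refine ⟨(hΦU j').comp (hPU j), ((hΦm j').comp (hPm j)).strictMonoOn _, hsm j j',
      ⟨fun x => Φ j (P j' x), (hΦU j).comp (hPU j'), ⟨fun x _ => ?_, fun x _ => ?_⟩, hsm j' j⟩,
      map_endPoints (fun i => ?_) fun i => ?_⟩
    · simp only [hPΦ, hΦP]
    · simp only [hPΦ, hΦP]
    · simp only [hleft, hPΦ]
    · simp only [hright, hPΦ]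
  have hosc : ∀ j j', j ≠ j' → ∀ x ∈ UI, ∀ y ∈ UI,
      |iteratedDerivWithin (r + 1) (fun x => Φ j' (P j x)) UI x -
        iteratedDerivWithin (r + 1) (fun x => Φ j' (P j x)) UI y| ≤
        K * K * rho S j j' ^ (((r + 1 : ℕ) : ℝ) + ε - 1) := by
    intro j j' hjj' x hx y hy
    obtain ⟨l, v, v', hv, rfl, rfl⟩ := exists_app hjj'
    obtain ⟨G, hG, hGv⟩ := exists_zoom hFU hΦ l
    obtain ⟨a, ha⟩ := hGv v
    obtain ⟨a', ha'⟩ := hGv v'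
    obtain ⟨s, hs⟩ : ∃ s, s = Pr S l v := ⟨_, rfl⟩
    obtain ⟨s', hs'⟩ : ∃ s', s' = Pr S l v' := ⟨_, rfl⟩
    rw [← hs] at ha
    rw [← hs'] at ha'
    have hs0 : 0 < s := hs ▸ Pr_pos S l v
    have hs0' : 0 < s' := hs' ▸ Pr_pos S l v'
    have ha0 : Φ v (G 0) = a := by rw [ha 0 h0, hΦ0, mul_zero, add_zero]
    have ha1 : Φ v (G 1) = a + s := by rw [ha 1 h1, hΦ1, mul_one]
    have ha0' : Φ v' (G 0) = a' := by rw [ha' 0 h0, hΦ0, mul_zero, add_zero]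
    have ha1' : Φ v' (G 1) = a' + s' := by rw [ha' 1 h1, hΦ1, mul_one]
    have haU : a ∈ UI := ha0 ▸ hΦU v (hG h0)
    have hasU : a + s ∈ UI := ha1 ▸ hΦU v (hG h1)
    have haU' : a' ∈ UI := ha0' ▸ hΦU v' (hG h0)
    have hasU' : a' + s' ∈ UI := ha1' ▸ hΦU v' (hG h1)
    -- The inverse transition map has derivative at most `K` and carries the interval of length `s'`
    -- onto the one of length `s`.
    have hss' : s ≤ K * s' := by
      obtain ⟨-, f', hf', hf'b⟩ := hK v' v
      have := HolderBound.abs_sub_le_of_deriv hf' hf'b.abs_le hasU' haU'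
      have e1 : Φ v (P v' (a' + s')) = a + s := by rw [← ha1', hPΦ, ha1]
      have e2 : Φ v (P v' a') = a := by rw [← ha0', hPΦ, ha0]
      simp only [e1, e2, add_sub_cancel_left, abs_of_pos hs0, abs_of_pos hs0'] at this
      exact this
    have hK0 : 0 ≤ K := (hK v v').nonneg
    obtain ⟨g, hg0, hg, hgr⟩ := (hK v v').exists_chain
    have hz := hg.zoom a' s' haU.1 hs0.le hasU.2
    have heq : EqOn (fun x => Φ (app l v') (P (app l v) x)) (zoomChain a s a' s' g 0) UI := by
      intro t ht
      have ht' := hPU (app l v) ht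
      have e1 := ha _ ht'
      have e2 := ha' _ ht'
      rw [hΦP] at e1
      simp only [zoomChain, hg0, if_true, pow_zero]
      rw [← e1, hPΦ, e2]
      field_simp
      ring
    have hit := hz.eqOn_iteratedDerivWithin heq le_rfl
    rw [hit hx, hit hy]
    have hxm := zoom_mem haU.1 hs0.le hasU.2 hx
    have hym := zoom_mem haU.1 hs0.le hasU.2 hy
    simp only [zoomChain, Nat.succ_ne_zero, if_false, sub_zero, ← mul_sub]
    rw [abs_mul, abs_of_pos (by positivity)]
    have h2 := hgr.2 _ hxm _ hym
    have e3 : a + s * x - (a + s * y) = s * (x - y) := by ring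
    rw [e3, abs_mul, abs_of_pos hs0, Real.mul_rpow hs0.le (abs_nonneg _)] at h2
    have h3 : |x - y| ^ ε ≤ 1 := Real.rpow_le_one (abs_nonneg _) (abs_sub_le_one hx hy) hε.le
    have hsε : 0 < s ^ ε := Real.rpow_pos_of_pos hs0 _
    have h4 : |g (r + 1) (a + s * x) - g (r + 1) (a + s * y)| ≤ K * s ^ ε :=
      h2.trans (mul_le_mul_of_nonneg_left (mul_le_of_le_one_right hsε.le h3) hK0)
    have h5 : s ^ (r + 1) / s' ≤ K * s ^ r := by
      rw [div_le_iff₀ hs0', pow_succ]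
      have := mul_le_mul_of_nonneg_left hss' (show 0 ≤ s ^ r by positivity)
      linarith
    have h6 : s ^ (((r + 1 : ℕ) : ℝ) + ε - 1) = s ^ r * s ^ ε := by
      rw [← Real.rpow_natCast s r, ← Real.rpow_add hs0]
      congr 1
      push_cast; ring
    have h7 : s ^ (((r + 1 : ℕ) : ℝ) + ε - 1) ≤
        rho S (app l v) (app l v') ^ (((r + 1 : ℕ) : ℝ) + ε - 1) :=
      Real.rpow_le_rpow hs0.le (hs ▸ Pr_le_rho S l hv v) (by
        push_cast
        have : (0 : ℝ) ≤ r := by positivity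
        linarith)
    refine (mul_le_mul h5 h4 (abs_nonneg _) (by positivity)).trans ?_
    refine le_trans (le_of_eq ?_) (mul_le_mul_of_nonneg_left h7 (mul_nonneg hK0 hK0))
    rw [h6]; ring
  have htame : ∀ j j', j ≠ j' → (fun x => Φ j' (P j x)) ∈
      tame S (r + 1) (K * K + 1) (((r + 1 : ℕ) : ℝ) + ε - 1) j j' := by
    intro j j' hjj'
    refine mem_diffeosVar (hdiffeo j j') (hosc j j' hjj') ?_
    exact mul_lt_mul_of_pos_right (lt_add_one _) (Real.rpow_pos_of_pos (rho_pos S hjj') _)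
  -- The summand `1` makes the inequality strict. Renormalizing the transition map of `j`, `j'`
  -- gives exactly that of `prepend c j`, `prepend c j'` on `[0,1]`, so the same family serves both
  -- requirements.
  refine ⟨K * K + 1, fun j j' hjj' c => ⟨_, htame j j' hjj', ?_⟩⟩
  refine diffeosVar_congr (endPoints_subset (S _).2) (htame _ _ (prepend_ne hjj' c)) fun y hy => ?_
  have hy' := hPU (prepend c j) hy
  have e1 := hΦ j c _ hy'
  have e2 := hΦ j' c _ hy'
  rw [hΦP] at e1
  have hs' : 0 < (S j').1 (Sum.inl c) := simp_pos (S j').2 _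
  simp only [renorm, rightEnd, add_sub_cancel_left]
  rw [← e1, hPΦ, e2]
  field_simp
  ring

end Transition

theorem IsSmoothEmbedding.exists_tameCondition {d k : ℕ} {ε : ℝ} {h : Word d → ℝ}
    {S : Word d → simp d} (hh : IsSmoothEmbedding k ε h) (hS : IsScalingFunction h S)
    (hd : 0 < d) (hk : 1 ≤ k) (hε : 0 < ε) (hε1 : ε ≤ 1) :
    ∃ C, TameCondition S k C ((k : ℝ) + ε - 1) := by
  obtain ⟨B, F, Λ, Φ, P, hU, H⟩ := hh.exists_coordinates hS hd hk hε hε1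
  obtain ⟨r, rfl⟩ : ∃ r, k = r + 1 := ⟨k - 1, by omega⟩
  simp only [forall_and] at H
  obtain ⟨h1, h2, h3, h4, h5, h6, h7, h8, h9, h10⟩ := H
  exact tameCondition_of_coordinates hε hε1 hU h1 h2 h3 h4 h5 h6 h7 h8 h9 h10

end CantorScaling

theorem mainTheorem1 (d k : ℕ) (ε : ℝ) (hd : 2 ≤ d) (hk : 1 ≤ k) (hkd : k < 2 * d)
    (hε₀ : 0 < ε) (hε₁ : ε ≤ 1) (S : CantorScaling.Word d → CantorScaling.simp d) :
    (∃ h : CantorScaling.Word d → ℝ,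
      CantorScaling.IsSmoothEmbedding k ε h ∧ CantorScaling.IsScalingFunction h S) ↔
    ∃ C : ℝ, ∀ j j' : CantorScaling.Word d, j ≠ j' → ∀ j₀ : Fin d,
      (CantorScaling.diffeosVar k
          (C * CantorScaling.rho S (CantorScaling.prepend j₀ j) (CantorScaling.prepend j₀ j') ^
            ((k : ℝ) + ε - 1))
          (CantorScaling.endPoints (S (CantorScaling.prepend j₀ j)).1)
          (CantorScaling.endPoints (S (CantorScaling.prepend j₀ j')).1) ∩
        CantorScaling.renorm (S j).1 (S j').1 j₀ ''
          CantorScaling.diffeosVar k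
            (C * CantorScaling.rho S j j' ^ ((k : ℝ) + ε - 1))
            (CantorScaling.endPoints (S j).1) (CantorScaling.endPoints (S j').1)).Nonempty := by
  constructor
  · rintro ⟨h, hh, hS⟩
    obtain ⟨C, hC⟩ := hh.exists_tameCondition hS (by omega) hk hε₀ hε₁
    refine ⟨C, fun j j' hjj' j₀ => ?_⟩
    obtain ⟨ψ, h1, h2⟩ := hC j j' hjj' j₀
    exact ⟨_, h2, ψ, h1, rfl⟩
  · rintro ⟨C, hC⟩
    have H : CantorScaling.TameCondition S k C ((k : ℝ) + ε - 1) := by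
      intro j j' hjj' j₀
      obtain ⟨_, h2, ψ, h1, rfl⟩ := hC j j' hjj' j₀
      exact ⟨ψ, h1, h2⟩
    exact H.exists_embedding hd hk hkd hε₀ hε₁
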